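/- Conventions. Let $D$ be an unoriented link diagram on the sphere (or plane) with $N$ crossings in a chosen order. A Kauffman state $s$ assigns a marker $\pm1$ to each crossing; the marker $+1$ means the smoothing that joins the two regions swept out when the overcrossing strand is rotated counterclockwise, the marker $-1$ the other smoothing. $D_s$ is the resulting system of circles and $|s|$ is the number of these circles; $s_+$ and $s_-$ are the states with all markers $+1$, respectively all markers $-1$. An enhanced state $S$ is a state $s$ with a sign for each circle of $D_s$; let $\sigma(S)$ be the number of positive minus the number of negative markers, and $\tau(S)$ the number of positive minus the number of negative circles. Let $C_{i,j}(D)$ be the free abelian group on the enhanced states with $\sigma(S)=i$ and $\sigma(S)+2\tau(S)=j$. The differential $d\colon C_{i,j}(D)\to C_{i-2,j}(D)$ is $d(S)=\sum_{S'}(-1)^{t(S:S')}[S:S']\,S'$, where $S'$ runs over the enhanced states generating $C_{i-2,j}(D)$, $[S:S']=1$ if the markers of $S$ and $S'$ differ at exactly one crossing $c$ and all circles not touching $c$ have the same signs in $S$ and $S'$, $[S:S']=0$ otherwise, and $t(S:S')$ is the number of negative markers of $S$ at crossings bigger than $c$. Let $H_{i,j}(D)=\ker(d|_{C_{i,j}(D)})/d(C_{i+2,j}(D))$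 be the Khovanov homology of $D$ and $T_{i,j}(D)$ its torsion subgroup. For rational $k_1,k_2$, the diagram $D$ is $TH$-$(k_1,k_2)$-thick if $T_{i,j}(D)=0$ except possibly for $i,j$ with $$N-2|s_-|-4k_2\le j-2i\le 2|s_+|-N+4k_1 ,$$ and $D$ is $TH$-$k$-thick if it is $TH$-$(k_1,k_2)$-thick for some $k_1,k_2$ with $k\ge k_1+k_2+\tfrac12(|s_+|+|s_-|-N)$. The diagram $D$ is non-split if it is nonempty and connected as a subset of the sphere; it is alternating if over- and undercrossings alternate along each component of the link; a crossing is nugatory if some simple closed curve on the sphere meets $D$ only in that crossing, passing there from one corner to the opposite one. **Corollary 5.7.** Let $D$ be a non-split alternating link diagram without nugatory crossings. Then $D$ is $TH$-$(0,-1)$-thick and $TH$-$0$-thick. In other words, $2|s_+|-N=N-2|s_-|+4$, and if $T_{i,j}(D)\ne0$ then $$j-2i=2|s_+|-N=N-2|s_-|+4 .$$ -/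

import Mathlib

/-- The four ends of strands ("darts") at each of `N` crossings.  The darts at the crossing `c` are
`(c, 0), (c, 1), (c, 2), (c, 3)` in counterclockwise order; `(c, 0)` and `(c, 2)` are the two ends of
the lower strand, `(c, 1)` and `(c, 3)` the two ends of the upper strand. -/
abbrev Dart (N : ℕ) : Type := Fin N × Fin 4

/-- Walking along the boundary of a region: `(c, k)` stands for the corner at `c` between the darts
`(c, k)` and `(c, k + 1)`.  Leave `c` along the dart `(c, k)`, with this corner on the left, arrive at
the dart `glue (c, k) = (c', k')`; the corner at `c'` then on the left lies between `(c', k' - 1)` and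
`(c', k')`. -/
def FaceStep {N : ℕ} (glue : Dart N → Dart N) (a b : Dart N) : Prop :=
  b = ((glue a).1, (glue a).2 - 1)

/-- Two darts that are the two ends of one edge, or that lie at the same crossing. -/
def Linked {N : ℕ} (glue : Dart N → Dart N) (a b : Dart N) : Prop :=
  b = glue a ∨ b.1 = a.1

/-- A link diagram on the oriented 2-sphere (equivalently, in the disc or the plane), given
combinatorially: `N` crossings (with the order of `Fin N`), joined along edges by the involution
`glue` of the darts, together with `freeLoops` simple closed curves without crossings.
`planar` is Euler's formula `V - E + F = 2 C` with `V = N`, `E = 2 N`, `F` the number of faces and `C`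
the number of connected components of the 4-valent graph; as every component has `V - E + F ≤ 2`,
it says that each component is drawn on a sphere. -/
structure LinkDiagram where
  /-- number of crossings -/
  N : ℕ
  /-- number of components that are simple closed curves without any crossing -/
  freeLoops : ℕ
  /-- the other end of the edge that starts at a dart -/
  glue : Dart N → Dart N
  glue_glue : ∀ a, glue (glue a) = a
  glue_ne : ∀ a, glue a ≠ a
  planar : Nat.card (Quot (FaceStep glue)) = N + 2 * Nat.card (Quot (Linked glue))

namespace LinkDiagram

noncomputable section

variable (D : LinkDiagram)

/-- The pieces of which the diagram consists: ends of edges, and loops without crossings. -/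
abbrev Piece : Type := Dart D.N ⊕ Fin D.freeLoops

/-! ### Non-split, alternating, nugatory -/

/-- Adjacency of pieces in the diagram. -/
inductive Adjacent : D.Piece → D.Piece → Prop
  | edge (a : Dart D.N) : Adjacent (.inl a) (.inl (D.glue a))
  | crossing (c : Fin D.N) (k l : Fin 4) : Adjacent (.inl (c, k)) (.inl (c, l))

/-- A diagram is non-split if, as a subset of the sphere, it has exactly one connected component. -/
def NonSplit : Prop := Nat.card (Quot D.Adjacent) = 1

/-- The dart is an end of the upper strand of its crossing. -/
def IsOver (a : Dart D.N) : Prop := a.2 = 1 ∨ a.2 = 3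

/-- A diagram is alternating if, travelling along any component of the link, over- and undercrossings
alternate: every edge runs from an overcrossing to an undercrossing. -/
def Alternating : Prop := ∀ a : Dart D.N, D.IsOver (D.glue a) ↔ ¬ D.IsOver a

/-- The region of the diagram that contains the corner between the darts `(c, k)` and `(c, k + 1)`. -/
def region (c : Fin D.N) (k : Fin 4) : Quot (FaceStep D.glue) := Quot.mk _ (c, k)

/-- A crossing is nugatory if some simple closed curve on the sphere meets the diagram in this crossing
only, and there it passes from one corner to the opposite one, that is,
if two opposite corners of the crossing lie in the same region. -/
def Nugatory (c : Fin D.N) : Prop := ∃ k : Fin 4, D.region c k = D.region c (k + 2)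

/-! ### Kauffman states -/

/-- A Kauffman state: a marker at each crossing, `true` for `+1` and `false` for `-1`. -/
abbrev State : Type := Fin D.N → Bool

/-- The sign `±1` as an integer. -/
def sgn (b : Bool) : ℤ := if b then 1 else -1

/-- Smoothing of a crossing: the positive marker joins the two corners that the upper strand sweeps out
when it is rotated counterclockwise, so it connects the darts `0 - 1` and `2 - 3`; the negative marker
connects `1 - 2` and `3 - 0`. -/
def smoothing (marker : Bool) : Fin 4 → Fin 4 :=
  if marker then ![1, 0, 3, 2] else ![3, 2, 1, 0]

/-- Adjacency of pieces in the system of circles `D_s`. -/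
inductive StateAdjacent (s : D.State) : D.Piece → D.Piece → Prop
  | edge (a : Dart D.N) : StateAdjacent s (.inl a) (.inl (D.glue a))
  | smooth (c : Fin D.N) (k : Fin 4) :
      StateAdjacent s (.inl (c, k)) (.inl (c, smoothing (s c) k))

/-- The circles of `D_s`. -/
def Circle (s : D.State) : Type := Quot (D.StateAdjacent s)

instance (s : D.State) : Finite (D.Circle s) :=
  inferInstanceAs (Finite (Quot (D.StateAdjacent s)))

instance (s : D.State) : Fintype (D.Circle s) := Fintype.ofFinite _

/-- The circle of `D_s` that contains a given piece. -/
def circle (s : D.State) (p : D.Piece) : D.Circle s := Quot.mk _ p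

/-- `|s|`, the number of circles of `D_s`. -/
def numCircles (s : D.State) : ℕ := Fintype.card (D.Circle s)

/-- `s₊`, the state with positive markers only. -/
def sPlus : D.State := fun _ => true

/-- `s₋`, the state with negative markers only. -/
def sMinus : D.State := fun _ => false

/-- An enhanced Kauffman state: a Kauffman state with a sign for each circle. -/
@[ext] structure EnhancedState where
  marker : D.State
  sign : D.Circle marker → Bool

instance : Finite D.EnhancedState :=
  Finite.of_injective
    (fun S => (⟨S.marker, S.sign⟩ : Σ s : D.State, (D.Circle s → Bool)))
    (by rintro ⟨s, e⟩ ⟨s', e'⟩ h; cases h; rfl)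

instance : Fintype D.EnhancedState := Fintype.ofFinite _

variable {D}

/-- `σ(S)`: positive minus negative markers. -/
def EnhancedState.sigma (S : D.EnhancedState) : ℤ := ∑ c, sgn (S.marker c)

/-- `τ(S)`: positive minus negative circles. -/
def EnhancedState.tau (S : D.EnhancedState) : ℤ := ∑ C, sgn (S.sign C)

/-- The second grading `σ(S) + 2 τ(S)`. -/
def EnhancedState.degree (S : D.EnhancedState) : ℤ := S.sigma + 2 * S.tau

/-- `[S : S'] = 1`, with `c` the crossing at which the markers differ: the bidegree drops by `(2, 0)`,
the markers of `S` and `S'` differ at `c` and nowhere else, and all circles not touching `c`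
have the same sign in `S` and `S'`. -/
def Incident (c : Fin D.N) (S S' : D.EnhancedState) : Prop :=
  S'.sigma = S.sigma - 2 ∧ S'.degree = S.degree ∧
  (∀ x, S.marker x ≠ S'.marker x ↔ x = c) ∧
  ∀ p : D.Piece, (∀ k, D.circle S.marker p ≠ D.circle S.marker (.inl (c, k))) →
    S.sign (D.circle S.marker p) = S'.sign (D.circle S'.marker p)

/-- The number of negative markers of `S` at crossings bigger than `c`. -/
def negativeAbove (c : Fin D.N) (S : D.EnhancedState) : ℕ :=
  (Finset.univ.filter fun x => c < x ∧ S.marker x = false).card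

open Classical in
/-- The coefficient `(-1)^t(S:S') [S : S']` of `S'` in `d(S)` (at most one summand is nonzero). -/
def coefficient (S S' : D.EnhancedState) : ℤ :=
  ∑ c, if Incident c S S' then (-1) ^ negativeAbove c S else 0

variable (D)

/-! ### The Khovanov complex and its homology -/

/-- The chain group `C(D)`: the free abelian group on the enhanced states. -/
abbrev Chain : Type := D.EnhancedState →₀ ℤ

/-- `C_{i,j}(D)`: the subgroup spanned by the states `S` with `σ(S) = i`, `σ(S) + 2 τ(S) = j`. -/
def chain (i j : ℤ) : Submodule ℤ D.Chain :=
  Finsupp.supported ℤ ℤ {S | S.sigma = i ∧ S.degree = j}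

/-- The differential `d(S) = ∑_{S'} (-1)^t(S:S') [S : S'] S'`; it maps `C_{i,j}` to `C_{i-2,j}`. -/
def d : D.Chain →ₗ[ℤ] D.Chain :=
  Finsupp.linearCombination ℤ fun S => ∑ S', Finsupp.single S' (coefficient S S')

/-- The cycles in `C_{i,j}(D)`. -/
def cycles (i j : ℤ) : Submodule ℤ D.Chain := D.chain i j ⊓ LinearMap.ker D.d

/-- The boundaries `d(C_{i+2,j}(D))`. -/
def boundaries (i j : ℤ) : Submodule ℤ D.Chain := (D.chain (i + 2) j).map D.d

/-- The Khovanov homology group `H_{i,j}(D)`, cycles modulo boundaries. -/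
abbrev H (i j : ℤ) : Type :=
  D.cycles i j ⧸ (D.boundaries i j).submoduleOf (D.cycles i j)

/-- `T_{i,j}(D)`, the torsion subgroup of `H_{i,j}(D)`. -/
def T (i j : ℤ) : Submodule ℤ (D.H i j) := Submodule.torsion ℤ (D.H i j)

/-! ### Thickness of the torsion -/

/-- `D` is `TH`-`(k₁, k₂)`-thick: `T_{i,j}(D) = 0` except possibly for
`N - 2|s₋| - 4 k₂ ≤ j - 2 i ≤ 2|s₊| - N + 4 k₁`. -/
def THThickPair (k₁ k₂ : ℚ) : Prop :=
  ∀ i j : ℤ, D.T i j ≠ ⊥ →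
    (D.N : ℚ) - 2 * D.numCircles D.sMinus - 4 * k₂ ≤ j - 2 * i ∧
    (j : ℚ) - 2 * i ≤ 2 * D.numCircles D.sPlus - D.N + 4 * k₁

/-- `D` is `TH`-`k`-thick: it is `TH`-`(k₁, k₂)`-thick for some `k₁, k₂` with
`k ≥ k₁ + k₂ + (|s₊| + |s₋| - N) / 2`. -/
def THThick (k : ℚ) : Prop :=
  ∃ k₁ k₂ : ℚ, D.THThickPair k₁ k₂ ∧
    k₁ + k₂ + ((D.numCircles D.sPlus : ℚ) + D.numCircles D.sMinus - D.N) / 2 ≤ k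

end

end LinkDiagram

/-! Let `n` be the number of negative markers and `T` the value of τ. Then `i = N - 2n` and `j = i +
2T`, so `j - 2i = 2(n + T) - N`, and the differential raises both `n` and `T` by one. The claim is
that torsion occurs only where `n + T = |s₊|`.

Torsion of order `p` in degree `(n, T)` forces nonzero homology over the field with `p` elements
both in `(n, T)` and in `(n - 1, T - 1)` (`not_exact_of_torsion`). It therefore suffices that
homology over such a field lives where `|s₊| - 2 ≤ n + T ≤ |s₊|`: the first class gives `n + T ≤
|s₊|`, the second `n + T ≥ |s₊|`.

The lower bound is `exact_face`, proved for all faces of the cube of resolutions. If a face starts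
at a vertex with `m` negative markers and `q` circles, and its partially smoothed diagram has `C`
components, its homology vanishes for `n + T < m + q - 2C`. The proof is by induction on the number
of unsmoothed crossings. If the positive smoothing of some crossing keeps the components, the long
exact sequence of the two half faces applies. If there is no such crossing, every edge of the face
is a merge and every crossing is a bridge. The product `A ⊗ A → A` of `A = k[X]/X²` is then onto,
with kernel a copy of `A` embedded by a coproduct with signs, so the homology is controlled by the
face with the bridge contracted (`IsBridge.exact`).

The upper bound `n + T ≤ N + 2 - |s₋|` is the lower bound for the mirror image, transported by
linear duality (`exact_of_dual`). The two bounds fit together because `|s₊| + |s₋| = N + 2`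
(`numCircles_add`): the circles of `s₊` and `s₋` are the regions of the alternating diagram, and
Euler's formula counts them.

Everything except the count of circles takes place in an abstract `StateCube`, where each change of
a marker merges two circles or splits one. Alternation provides this property
(`isFlip_circleSetoid`); planarity enters only through Euler's formula. -/

open scoped Matrix

namespace CircleCalculus

variable {P : Type*}

/-! ### Merging two classes of an equivalence relation -/

/-- The equivalence relation obtained from `r` by merging the classes of `a` and `b`. -/
def join (r : Setoid P) (a b : P) : Setoid P where
  r x y := r x y ∨ (r x a ∨ r x b) ∧ (r y a ∨ r y b)
  iseqv :=
    { refl := fun x => Or.inl (r.refl x)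
      symm := by
        rintro x y (h | ⟨h, h'⟩)
        · exact Or.inl (r.symm h)
        · exact Or.inr ⟨h', h⟩
      trans := by
        rintro x y z (h | ⟨h, h'⟩) (g | ⟨g, g'⟩)
        · exact Or.inl (r.trans h g)
        · exact Or.inr ⟨g.imp (r.trans h) (r.trans h), g'⟩
        · exact Or.inr ⟨h, h'.imp (r.trans (r.symm g)) (r.trans (r.symm g))⟩
        · exact Or.inr ⟨h, g'⟩ }

theorem join_apply {r : Setoid P} {a b x y : P} :
    join r a b x y ↔ r x y ∨ (r x a ∨ r x b) ∧ (r y a ∨ r y b) := Iff.rfl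

theorem le_join (r : Setoid P) (a b : P) : r ≤ join r a b := fun _ _ h => Or.inl h

theorem join_rel (r : Setoid P) (a b : P) : join r a b a b :=
  Or.inr ⟨Or.inl (r.refl a), Or.inr (r.refl b)⟩

theorem join_le_iff {r s : Setoid P} {a b : P} : join r a b ≤ s ↔ r ≤ s ∧ s a b := by
  refine ⟨fun h => ⟨(le_join r a b).trans h, h (join_rel r a b)⟩, ?_⟩
  rintro ⟨h, hab⟩ x y (g | ⟨g, g'⟩)
  · exact h g
  · have key : ∀ z, r z a ∨ r z b → s z a := by
      rintro z (e | e)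
      · exact h e
      · exact s.trans (h e) (s.symm hab)
    exact s.trans (key x g) (s.symm (key y g'))

theorem join_eq_sup (r : Setoid P) (a b : P) : join r a b = r ⊔ join ⊥ a b := by
  apply le_antisymm
  · rw [join_le_iff]
    exact ⟨le_sup_left, (le_sup_right : _ ≤ r ⊔ join ⊥ a b) (join_rel ⊥ a b)⟩
  · refine sup_le (le_join r a b) ?_
    rw [join_le_iff]
    exact ⟨bot_le, join_rel r a b⟩

theorem join_eq_self {r : Setoid P} {a b : P} (h : r a b) : join r a b = r :=
  le_antisymm (join_le_iff.2 ⟨le_rfl, h⟩) (le_join r a b)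

/-- One of two equivalence relations arises from the other by merging the distinct classes of
`a` and `b`. -/
def IsFlip (r r' : Setoid P) (a b : P) : Prop :=
  (¬ r a b ∧ r' = join r a b) ∨ (¬ r' a b ∧ r = join r' a b)

theorem IsFlip.symm {r r' : Setoid P} {a b : P} (h : IsFlip r r' a b) : IsFlip r' r a b :=
  Or.symm h

theorem IsFlip.rel_iff {r r' : Setoid P} {a b : P} (h : IsFlip r r' a b) : r' a b ↔ ¬ r a b := by
  rcases h with ⟨h, rfl⟩ | ⟨h, rfl⟩
  · simp [h, join_rel]
  · simp [h, join_rel]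

theorem IsFlip.join_eq {r r' : Setoid P} {a b : P} (h : IsFlip r r' a b) :
    join r a b = join r' a b := by
  rcases h with ⟨h, rfl⟩ | ⟨h, rfl⟩
  · exact (join_eq_self (join_rel _ _ _)).symm
  · exact join_eq_self (join_rel _ _ _)

theorem IsFlip.eq_join {r r' : Setoid P} {a b : P} (h : IsFlip r r' a b) (h' : ¬ r a b) :
    r' = join r a b := by
  rcases h with ⟨_, g⟩ | ⟨g, rfl⟩
  · exact g
  · exact absurd (join_rel _ _ _) h'

/-! ### Sums over classes -/

section Sums

variable [Fintype P]

open Classical in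
/-- The sum of a function over the classes of an equivalence relation. -/
noncomputable def classSum (r : Setoid P) (f : P → ℤ) : ℤ := ∑ q : Quotient r, f q.out

/-- The classes other than those of `a` and `b` survive the merge unchanged, so only the terms at
`a` and `b` need correction. The number of circles, τ and the parity of labels are all computed from
this. -/
theorem classSum_join {r : Setoid P} {a b : P} (hab : ¬ r a b) {f f' : P → ℤ}
    (hf : ∀ p q, r p q → f p = f q) (hf' : ∀ p q, join r a b p q → f' p = f' q)
    (h : ∀ p, ¬ r p a → ¬ r p b → f p = f' p) :
    classSum r f = classSum (join r a b) f' - f' a + f a + f b := by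
  classical
  have out_rel : ∀ (s : Setoid P) (p : P), s (Quotient.mk s p).out p := fun s p =>
    Quotient.exact (Quotient.out_eq (Quotient.mk s p))
  have hne : Quotient.mk r a ≠ Quotient.mk r b := fun e => hab (Quotient.exact e)
  have e1 : classSum r f = f a + (f b +
      ∑ q ∈ (Finset.univ.erase (Quotient.mk r a)).erase (Quotient.mk r b), f q.out) := by
    unfold classSum
    rw [← Finset.add_sum_erase _ _ (Finset.mem_univ (Quotient.mk r a)),
      ← Finset.add_sum_erase _ _ (Finset.mem_erase.2 ⟨hne.symm, Finset.mem_univ _⟩),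
      hf _ _ (out_rel r a), hf _ _ (out_rel r b)]
  have e2 : classSum (join r a b) f' = f' a +
      ∑ q ∈ Finset.univ.erase (Quotient.mk (join r a b) a), f' q.out := by
    unfold classSum
    rw [← Finset.add_sum_erase _ _ (Finset.mem_univ (Quotient.mk (join r a b) a)),
      hf' _ _ (out_rel _ a)]
  have unt : ∀ q : Quotient r, q ≠ Quotient.mk r a → q ≠ Quotient.mk r b →
      ¬ r q.out a ∧ ¬ r q.out b := by
    intro q ha hb
    constructor
    · intro e; exact ha (by rw [← Quotient.out_eq q]; exact Quotient.sound e)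
    · intro e; exact hb (by rw [← Quotient.out_eq q]; exact Quotient.sound e)
  have unt' : ∀ q : Quotient (join r a b), q ≠ Quotient.mk _ a →
      ¬ r q.out a ∧ ¬ r q.out b := by
    intro q ha
    constructor
    · intro e
      exact ha (by rw [← Quotient.out_eq q]; exact Quotient.sound (Or.inl e))
    · intro e
      exact ha (by
        rw [← Quotient.out_eq q]
        exact Quotient.sound (Or.inr ⟨Or.inr e, Or.inl (r.refl a)⟩))
  have e3 : ∑ q ∈ (Finset.univ.erase (Quotient.mk r a)).erase (Quotient.mk r b), f q.out =
      ∑ q ∈ Finset.univ.erase (Quotient.mk (join r a b) a), f' q.out := by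
    refine Finset.sum_bij' (fun q _ => Quotient.mk _ q.out) (fun q _ => Quotient.mk _ q.out)
      ?_ ?_ ?_ ?_ ?_
    · intro q hq
      simp only [Finset.mem_erase, Finset.mem_univ, and_true] at hq ⊢
      intro e
      obtain ⟨u, v⟩ := unt q hq.2 hq.1
      rcases Quotient.exact e with g | ⟨g, -⟩
      · exact u g
      · exact g.elim u v
    · intro q hq
      simp only [Finset.mem_erase, Finset.mem_univ, and_true] at hq ⊢
      obtain ⟨u, v⟩ := unt' q hq
      exact ⟨fun e => v (Quotient.exact e), fun e => u (Quotient.exact e)⟩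
    · intro q hq
      simp only [Finset.mem_erase, Finset.mem_univ, and_true] at hq
      obtain ⟨u, v⟩ := unt q hq.2 hq.1
      conv_rhs => rw [← Quotient.out_eq q]
      apply Quotient.sound
      rcases out_rel (join r a b) q.out with g | ⟨-, g⟩
      · exact g
      · exact absurd g (by tauto)
    · intro q hq
      conv_rhs => rw [← Quotient.out_eq q]
      exact Quotient.sound (Or.inl (out_rel r q.out))
    · intro q hq
      simp only [Finset.mem_erase, Finset.mem_univ, and_true] at hq
      obtain ⟨u, v⟩ := unt q hq.2 hq.1
      rw [h _ u v]
      exact (hf' _ _ (out_rel (join r a b) q.out)).symm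
  rw [e1, e2, e3]; ring

theorem classSum_one (r : Setoid P) : classSum r (fun _ => 1) = Nat.card (Quotient r) := by
  classical
  simp [classSum, Nat.card_eq_fintype_card]

theorem card_join {r : Setoid P} {a b : P} (hab : ¬ r a b) :
    (Nat.card (Quotient r) : ℤ) = Nat.card (Quotient (join r a b)) + 1 := by
  have := classSum_join hab (f := fun _ => 1) (f' := fun _ => 1) (fun _ _ _ => rfl)
    (fun _ _ _ => rfl) (fun _ _ _ => rfl)
  rw [classSum_one, classSum_one] at this
  linarith

theorem card_join_le (r : Setoid P) (a b : P) :
    (Nat.card (Quotient r) : ℤ) ≤ Nat.card (Quotient (join r a b)) + 1 := by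
  by_cases h : r a b
  · rw [join_eq_self h]; linarith
  · exact (card_join h).le

end Sums

/-! ### Labels, words and the elementary cobordisms -/

/-- A labelling of points that is constant on classes. -/
def Inv (r : Setoid P) (l : P → Bool) : Prop := ∀ p q, r p q → l p = l q

/-- The label `l'` occurs in the image of the label `l` under the elementary cobordism at `a`, `b`:
multiplication in `ℤ[X]/X²` if `a` and `b` lie on different circles, comultiplication otherwise.
The label `true` stands for `X` and `false` for `1`. -/
def EdgeRel (r : Setoid P) (a b : P) (l l' : P → Bool) : Prop :=
  (∀ p, ¬ r p a → ¬ r p b → l p = l' p) ∧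
    ((r a b ∧ l a = (l' a && l' b) ∧ (l' a || l' b) = true) ∨
      (¬ r a b ∧ l' a = (l a || l b) ∧ (l a && l b) = false))

open Classical in
/-- The elementary cobordism between the circles of `r` and those of `r'`, as a matrix. -/
noncomputable def edge (k : Type*) [CommRing k] (r r' : Setoid P) (a b : P) :
    Matrix (P → Bool) (P → Bool) k :=
  fun l l' => if Inv r l ∧ Inv r' l' ∧ EdgeRel r a b l l' then 1 else 0

open Classical in
/-- The label `l` is `X` exactly on the classes that contain a point of the word `w`, and no class
contains two points of `w`. -/
def Rep (r : Setoid P) (w : Multiset P) (l : P → Bool) : Prop :=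
  ∀ p, w.countP (fun q => r p q) = (l p).toNat

open Classical in
/-- The chain given by a word: a basis vector or zero. -/
noncomputable def vec (k : Type*) [CommRing k] (r : Setoid P) (w : Multiset P) :
    (P → Bool) → k :=
  fun l => if Rep r w l then 1 else 0

theorem Rep.unique {r : Setoid P} {w : Multiset P} {l l' : P → Bool} (h : Rep r w l)
    (h' : Rep r w l') : l = l' := by
  funext p
  have := (h p).symm.trans (h' p)
  revert this
  cases l p <;> cases l' p <;> simp

open Classical in
theorem countP_congr_rel {r : Setoid P} {p q : P} (h : r p q) (w : Multiset P) :
    w.countP (fun x => r p x) = w.countP (fun x => r q x) := by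
  congr 1
  funext x
  exact propext ⟨r.trans (r.symm h), r.trans h⟩

theorem Rep.inv {r : Setoid P} {w : Multiset P} {l : P → Bool} (h : Rep r w l) : Inv r l := by
  intro p q hpq
  have := (h p).symm.trans ((countP_congr_rel hpq w).trans (h q))
  revert this
  cases l p <;> cases l q <;> simp

open Classical in
theorem exists_rep [Fintype P] {r : Setoid P} {l : P → Bool} (h : Inv r l) :
    ∃ w, Rep r w l := by
  refine ⟨((Finset.univ.filter fun q : Quotient r => l q.out = true).val).map Quotient.out, ?_⟩
  intro p
  rw [Multiset.countP_map]
  have : (Finset.univ.filter fun q : Quotient r => l q.out = true).val.filter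
      (fun q => r p q.out) =
      (Finset.univ.filter fun q : Quotient r => q = Quotient.mk r p ∧ l p = true).val := by
    rw [← Finset.filter_val, Finset.filter_filter]
    congr 1
    ext q
    simp only [Finset.mem_filter, Finset.mem_univ, true_and]
    constructor
    · rintro ⟨h1, h2⟩
      refine ⟨?_, ?_⟩
      · conv_lhs => rw [← Quotient.out_eq q]
        exact Quotient.sound (r.symm h2)
      · rw [← h1]; exact h _ _ h2
    · rintro ⟨rfl, h2⟩
      have : r p (Quotient.mk r p).out := r.symm (Quotient.exact (Quotient.out_eq _))
      exact ⟨by rw [← h _ _ this]; exact h2, this⟩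
  rw [this, Finset.card_val]
  by_cases hl : l p = true
  · simp only [hl, and_true, Bool.toNat_true]
    rw [Finset.card_eq_one]
    exact ⟨Quotient.mk r p, by ext; simp⟩
  · simp [hl]

open Classical in
theorem exists_rep_of_le_one {r : Setoid P} {w : Multiset P}
    (h : ∀ p, w.countP (fun q => r p q) ≤ 1) : ∃ l, Rep r w l := by
  refine ⟨fun p => decide (w.countP (fun q => r p q) = 1), fun p => ?_⟩
  have := h p
  by_cases e : w.countP (fun q => r p q) = 1
  · simp [e]
  · simp [e]; omega

open Classical in
theorem countP_join_of_not {r : Setoid P} {a b p : P} (ha : ¬ r p a) (hb : ¬ r p b)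
    (w : Multiset P) :
    w.countP (fun q => join r a b p q) = w.countP (fun q => r p q) := by
  congr 1
  funext q
  simp [join_apply, ha, hb]

open Classical in
theorem countP_join {r : Setoid P} {a b : P} (hab : ¬ r a b) {p : P} (hp : r p a ∨ r p b)
    (w : Multiset P) :
    w.countP (fun q => join r a b p q) =
      w.countP (fun q => r a q) + w.countP (fun q => r b q) := by
  induction w using Multiset.induction_on with
  | empty => simp
  | cons x w ih =>
    have h1 : join r a b p x ↔ r a x ∨ r b x := by
      rw [join_apply]
      constructor
      · rintro (h | ⟨-, h⟩)
        · exact hp.imp (fun g => r.trans (r.symm g) h) (fun g => r.trans (r.symm g) h)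
        · exact h.imp r.symm r.symm
      · intro h; exact Or.inr ⟨hp, h.imp r.symm r.symm⟩
    have h2 : ¬ (r a x ∧ r b x) := fun h => hab (r.trans h.1 (r.symm h.2))
    simp only [Multiset.countP_cons, ih, h1]
    by_cases u : r a x <;> by_cases v : r b x <;> simp [u, v] <;> first | omega | tauto

end CircleCalculus

/-! ### Elementary cobordisms acting on words, and commuting squares. -/

namespace CircleCalculus

set_option linter.unusedSectionVars false

variable {P : Type*}

open Classical in
theorem rep_iff (r : Setoid P) (a b : P) (w : Multiset P) (l : P → Bool) :
    Rep r w l ↔ Inv r l ∧ (∀ p, ¬ r p a → ¬ r p b → w.countP (fun q => r p q) = (l p).toNat) ∧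
      w.countP (fun q => r a q) = (l a).toNat ∧ w.countP (fun q => r b q) = (l b).toNat := by
  refine ⟨fun h => ⟨h.inv, fun p _ _ => h p, h a, h b⟩, ?_⟩
  rintro ⟨hi, hu, ha, hb⟩ p
  by_cases pa : r p a
  · rw [countP_congr_rel pa, ha, hi _ _ pa]
  · by_cases pb : r p b
    · rw [countP_congr_rel pb, hb, hi _ _ pb]
    · exact hu p pa pb

theorem toNat_inj' {x y : Bool} (h : x.toNat = y.toNat) : x = y := by
  revert h; cases x <;> cases y <;> simp

open Classical in
theorem rep_join_iff {r : Setoid P} {a b : P} (hab : ¬ r a b) {w : Multiset P} {l l' : P → Bool}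
    (h : Rep r w l) : Rep (join r a b) w l' ↔ Inv (join r a b) l' ∧ EdgeRel r a b l l' := by
  have ca := countP_join hab (Or.inl (r.refl a)) w
  have cb := countP_join hab (Or.inr (r.refl b)) w
  have ha := h a
  have hb := h b
  rw [rep_iff (join r a b) a b]
  refine and_congr_right fun hi => ?_
  have hl : l' a = l' b := hi _ _ (join_rel r a b)
  rw [ca, cb, ha, hb, ← hl]
  have e1 : (∀ p, ¬ join r a b p a → ¬ join r a b p b →
      w.countP (fun q => join r a b p q) = (l' p).toNat) ↔
      ∀ p, ¬ r p a → ¬ r p b → l p = l' p := by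
    constructor
    · intro H p pa pb
      have := H p (by simp [join_apply, pa, pb]) (by simp [join_apply, pa, pb])
      rw [countP_join_of_not pa pb, h p] at this
      exact toNat_inj' this
    · intro H p pa pb
      have pa' : ¬ r p a := fun e => pa (Or.inl e)
      have pb' : ¬ r p b := fun e => pb (Or.inl e)
      rw [countP_join_of_not pa' pb', h p, H p pa' pb']
  rw [e1]
  unfold EdgeRel
  refine and_congr_right fun _ => ?_
  simp only [hab, false_and, not_false_eq_true, true_and, false_or]
  cases l a <;> cases l b <;> cases l' a <;> simp

open Classical in
theorem rep_split_iff {r : Setoid P} {a b : P} (hab : ¬ r a b) {w : Multiset P} {l l' : P → Bool}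
    (h : Rep (join r a b) w l) :
    (Inv r l' ∧ EdgeRel (join r a b) a b l l') ↔ (Rep r (a ::ₘ w) l' ∨ Rep r (b ::ₘ w) l') := by
  have ca := countP_join hab (Or.inl (r.refl a)) w
  have ha := h a
  rw [ca] at ha
  have hba : ¬ r b a := fun e => hab (r.symm e)
  rw [rep_iff r a b (a ::ₘ w), rep_iff r a b (b ::ₘ w), ← and_or_left]
  refine and_congr_right fun hi => ?_
  have e1 : (∀ p, ¬ join r a b p a → ¬ join r a b p b → l p = l' p) ↔
      ∀ p, ¬ r p a → ¬ r p b → w.countP (fun q => r p q) = (l' p).toNat := by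
    constructor
    · intro H p pa pb
      rw [← countP_join_of_not pa pb, h p,
        H p (by simp [join_apply, pa, pb]) (by simp [join_apply, pa, pb])]
    · intro H p pa pb
      have pa' : ¬ r p a := fun e => pa (Or.inl e)
      have pb' : ¬ r p b := fun e => pb (Or.inl e)
      have := H p pa' pb'
      rw [← countP_join_of_not pa' pb', h p] at this
      exact toNat_inj' this
  have e2 : ∀ c, (c = a ∨ c = b) → ((∀ p, ¬ r p a → ¬ r p b →
      (c ::ₘ w).countP (fun q => r p q) = (l' p).toNat) ↔
      ∀ p, ¬ r p a → ¬ r p b → w.countP (fun q => r p q) = (l' p).toNat) := by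
    intro c hc
    refine forall_congr' fun p => forall_congr' fun pa => forall_congr' fun pb => ?_
    have : ¬ r p c := by rcases hc with rfl | rfl <;> assumption
    rw [Multiset.countP_cons_of_neg _ this]
  rw [e2 a (Or.inl rfl), e2 b (Or.inr rfl), ← and_or_left]
  unfold EdgeRel
  rw [e1]
  refine and_congr_right fun _ => ?_
  have hj := join_rel r a b
  have ra := r.refl a
  have rb := r.refl b
  simp only [Multiset.countP_cons, ra, rb, hab, hba, if_true, if_false, add_zero, hj, true_and, not_true_eq_false, false_and, or_false]
  generalize w.countP (fun q => r a q) = A at *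
  generalize w.countP (fun q => r b q) = B at *
  revert ha
  cases l a <;> cases l' a <;> cases l' b <;> simp <;> omega

variable [Fintype P] [DecidableEq P] {k : Type*} [CommRing k]

theorem vec_eq_single {r : Setoid P} {w : Multiset P} {l : P → Bool} (h : Rep r w l) :
    vec k r w = Pi.single l 1 := by
  classical
  funext l'
  by_cases e : l' = l
  · subst e; simp [vec, h]
  · have : ¬ Rep r w l' := fun g => e (g.unique h)
    simp [vec, this, e]

theorem vec_eq_zero {r : Setoid P} {w : Multiset P} (h : ¬ ∃ l, Rep r w l) :
    vec k r w = 0 := by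
  funext l
  simp only [vec, Pi.zero_apply, ite_eq_right_iff]
  exact fun g => absurd ⟨l, g⟩ h

/-- A word is a monomial, with one variable `X` of square zero for each circle. Multiplication
identifies the variables of two circles, so the word itself does not change. -/
theorem vec_mul_merge {r : Setoid P} {a b : P} (hab : ¬ r a b) (w : Multiset P) :
    vec k r w ᵥ* edge k r (join r a b) a b = vec k (join r a b) w := by
  classical
  by_cases h : ∃ l, Rep r w l
  · obtain ⟨l, h⟩ := h
    rw [vec_eq_single h, Matrix.single_one_vecMul]
    funext l'
    simp only [Matrix.row, edge, vec, rep_join_iff hab h, h.inv, true_and]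
  · rw [vec_eq_zero h, Matrix.zero_vecMul, vec_eq_zero]
    rintro ⟨l', h'⟩
    -- The count on the merged circle is the sum of the two old counts, so a word that is nonzero
    -- after the merge was nonzero before.
    refine h (exists_rep_of_le_one fun p => ?_)
    by_cases hp : r p a ∨ r p b
    · have h1 := countP_join hab hp w
      rw [h' p] at h1
      have h2 := Bool.toNat_le (l' p)
      rcases hp with hp | hp
      · rw [countP_congr_rel hp]; omega
      · rw [countP_congr_rel hp]; omega
    · push Not at hp
      rw [← countP_join_of_not hp.1 hp.2, h' p]
      exact Bool.toNat_le _

/-- In terms of monomials, comultiplication is multiplication by `X_a + X_b`; if the circle already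
carries `X`, both summands are the same label on one side and zero on the other, or both words
vanish, according to where the letter of `w` lies. -/
theorem vec_mul_split {r : Setoid P} {a b : P} (hab : ¬ r a b) (w : Multiset P) :
    vec k (join r a b) w ᵥ* edge k (join r a b) r a b =
      vec k r (a ::ₘ w) + vec k r (b ::ₘ w) := by
  classical
  by_cases h : ∃ l, Rep (join r a b) w l
  · obtain ⟨l, h⟩ := h
    rw [vec_eq_single h, Matrix.single_one_vecMul]
    funext l'
    have hx : ¬ (Rep r (a ::ₘ w) l' ∧ Rep r (b ::ₘ w) l') := by
      rintro ⟨h1, h2⟩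
      have := (h1 a).trans (h2 a).symm
      have ra := r.refl a
      simp only [Multiset.countP_cons, ra, hab, if_true, if_false] at this
      omega
    simp only [Matrix.row, edge, vec, rep_split_iff hab h, h.inv, Pi.add_apply]
    by_cases u : Rep r (a ::ₘ w) l' <;> by_cases v : Rep r (b ::ₘ w) l' <;> simp_all
  · rw [vec_eq_zero h, Matrix.zero_vecMul]
    have aux : ∀ c, (c = a ∨ c = b) → vec k r (c ::ₘ w) = 0 := by
      intro c hc
      refine vec_eq_zero ?_
      rintro ⟨l', h'⟩
      refine h (exists_rep_of_le_one fun p => ?_)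
      by_cases hp : r p a ∨ r p b
      · rw [countP_join hab hp]
        have h1 := h' a
        have h2 := h' b
        have h3 := Bool.toNat_le (l' a)
        have h4 := Bool.toNat_le (l' b)
        have ra := r.refl a
        have rb := r.refl b
        have hba : ¬ r b a := fun e => hab (r.symm e)
        rcases hc with rfl | rfl <;>
          simp only [Multiset.countP_cons, ra, rb, hab, hba, if_true, if_false] at h1 h2 <;> omega
      · push Not at hp
        rw [countP_join_of_not hp.1 hp.2]
        have h1 := h' p
        have h3 := Bool.toNat_le (l' p)
        rw [Multiset.countP_cons] at h1
        omega
    rw [aux a (Or.inl rfl), aux b (Or.inr rfl), add_zero]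

theorem vec_cons_congr {r : Setoid P} {a a' : P} (h : r a a') (w : Multiset P) :
    vec k r (a ::ₘ w) = vec k r (a' ::ₘ w) := by
  classical
  funext l
  have : Rep r (a ::ₘ w) l ↔ Rep r (a' ::ₘ w) l := by
    refine forall_congr' fun p => ?_
    have e : r p a ↔ r p a' := ⟨fun g => r.trans g h, fun g => r.trans g (r.symm h)⟩
    simp only [Multiset.countP_cons, e]
  simp only [vec, this]

open Classical in
/-- The chains obtained from a word by an elementary cobordism out of the circles of `r`. -/
noncomputable def step (r : Setoid P) (a b : P) (w : Multiset P) : Multiset (Multiset P) :=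
  if r a b then {a ::ₘ w, b ::ₘ w} else {w}

theorem vec_mul_edge {r r' : Setoid P} {a b : P} (h : IsFlip r r' a b) (w : Multiset P) :
    vec k r w ᵥ* edge k r r' a b = ((step r a b w).map (vec k r')).sum := by
  rcases h with ⟨h, rfl⟩ | ⟨h, rfl⟩
  · rw [vec_mul_merge h]; simp [step, h]
  · rw [vec_mul_split h]; simp [step, join_rel]

/-- Every admissible basis vector is given by a word, so identities between cobordisms need only be
checked on words, where no labels appear. -/
theorem matrix_eq_of_vec {r : Setoid P} {A B : Matrix (P → Bool) (P → Bool) k}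
    (hA : ∀ l, ¬ Inv r l → A l = 0) (hB : ∀ l, ¬ Inv r l → B l = 0)
    (h : ∀ w, vec k r w ᵥ* A = vec k r w ᵥ* B) : A = B := by
  classical
  funext l
  by_cases hl : Inv r l
  · obtain ⟨w, hw⟩ := exists_rep hl
    have := h w
    rw [vec_eq_single hw, Matrix.single_one_vecMul, Matrix.single_one_vecMul] at this
    exact this
  · rw [hA l hl, hB l hl]

theorem edge_eq_zero {r r' : Setoid P} {a b : P} {l : P → Bool} (h : ¬ Inv r l) :
    edge k r r' a b l = 0 := by
  funext l'
  simp [edge, h]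

/-- In a square of flips in which both edges out of one corner differ in type from the opposite
ones, the two pairs of points lie on the same circles at the end. -/
theorem flip_square_matching {r r₁ r₂ r₁₂ : Setoid P} {a b a' b' : P}
    (h₁ : IsFlip r r₁ a b) (h₂ : IsFlip r r₂ a' b') (h₁₂ : IsFlip r₁ r₁₂ a' b')
    (h₂₁ : IsFlip r₂ r₁₂ a b) (hne : ¬ (r a b ↔ r₂ a b)) (heq : r a b ↔ r a' b')
    (hne' : ¬ (r a' b' ↔ r₁ a' b')) :
    (r₁₂ a a' ∧ r₁₂ b b') ∨ (r₁₂ a b' ∧ r₁₂ b a') := by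
  by_cases h : r a b
  · -- both split at first and then merge
    have g : ¬ r₂ a b := by tauto
    have h' := heq.1 h
    have g' : ¬ r₁ a' b' := by tauto
    have e12 : r₁₂ = join r₂ a b := h₂₁.eq_join g
    have e12' : r₁₂ = join r₁ a' b' := h₁₂.eq_join g'
    have er : r = join r₂ a' b' := h₂.symm.eq_join (fun e => (h₂.rel_iff.1 e) h')
    have ab : r₁₂ a b := by rw [e12]; exact join_rel _ _ _
    have ab' : r₁₂ a' b' := by rw [e12']; exact join_rel _ _ _
    have le : r₂ ≤ r₁₂ := by rw [e12]; exact le_join _ _ _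
    -- `a` and `b` are separate in `r₂` and become joined by merging `a'` with `b'`; hence `a` lies
    -- with `a'` or with `b'`, and this fixes the pairing.
    rw [er] at h
    rcases h with h | ⟨h, -⟩
    · exact absurd h g
    · rcases h with h | h
      · have := le h
        exact Or.inl ⟨this, r₁₂.trans (r₁₂.symm ab) (r₁₂.trans this ab')⟩
      · have := le h
        exact Or.inr ⟨this, r₁₂.trans (r₁₂.symm ab) (r₁₂.trans this (r₁₂.symm ab'))⟩
  · -- both merge at first and then split
    have g : r₂ a b := by tauto
    have h' : ¬ r a' b' := fun e => h (heq.2 e)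
    have g' : r₁ a' b' := by tauto
    have n12 : ¬ r₁₂ a b := fun e => (h₂₁.rel_iff.1 e) g
    have n12' : ¬ r₁₂ a' b' := fun e => (h₁₂.rel_iff.1 e) g'
    have e1 : r₁ = join r a b := h₁.eq_join h
    have e1' : r₁ = join r₁₂ a' b' := h₁₂.symm.eq_join n12'
    have ab : r₁ a b := by rw [e1]; exact join_rel _ _ _
    rw [e1'] at ab
    rcases ab with ab | ⟨u, v⟩
    · exact absurd ab n12
    · rcases u with u | u <;> rcases v with v | v
      · exact absurd (r₁₂.trans u (r₁₂.symm v)) n12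
      · exact Or.inl ⟨u, v⟩
      · exact Or.inr ⟨u, v⟩
      · exact absurd (r₁₂.trans u (r₁₂.symm v)) n12

theorem card_flip {r r' : Setoid P} {a b : P} (h : IsFlip r r' a b) [Decidable (r a b)] :
    (Nat.card (Quotient r') : ℤ) = Nat.card (Quotient r) + if r a b then 1 else -1 := by
  rcases h with ⟨h, rfl⟩ | ⟨h, rfl⟩
  · rw [if_neg h, card_join h]; ring
  · rw [if_pos (join_rel _ _ _), card_join h]

/-- The two ways around a square of elementary cobordisms agree. -/
theorem edge_mul_edge_comm {r r₁ r₂ r₁₂ : Setoid P} {a b a' b' : P}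
    (h₁ : IsFlip r r₁ a b) (h₂ : IsFlip r r₂ a' b') (h₁₂ : IsFlip r₁ r₁₂ a' b')
    (h₂₁ : IsFlip r₂ r₁₂ a b) :
    edge k r r₁ a b * edge k r₁ r₁₂ a' b' = edge k r r₂ a' b' * edge k r₂ r₁₂ a b := by
  classical
  refine matrix_eq_of_vec (r := r) ?_ ?_ ?_
  · intro l hl
    rw [Matrix.mul_apply_eq_vecMul, edge_eq_zero hl, Matrix.zero_vecMul]
  · intro l hl
    rw [Matrix.mul_apply_eq_vecMul, edge_eq_zero hl, Matrix.zero_vecMul]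
  intro w
  rw [← Matrix.vecMul_vecMul, ← Matrix.vecMul_vecMul, vec_mul_edge h₁, vec_mul_edge h₂]
  have c1 := card_flip h₁
  have c2 := card_flip h₂
  have c12 := card_flip h₁₂
  have c21 := card_flip h₂₁
  have m := flip_square_matching h₁ h₂ h₁₂ h₂₁
  -- Both paths must change the number of circles by the same amount, which rules out most
  -- combinations of merges and splits. If opposite edges have the same type, the resulting words
  -- agree up to the order of letters. Otherwise `flip_square_matching` places `a`, `b` on the same
  -- final circles as `a'`, `b'`.
  by_cases s : r a b <;> by_cases s' : r a' b' <;> by_cases t : r₂ a b <;>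
    by_cases t' : r₁ a' b' <;> simp only [s, s', t, t', if_true, if_false] at c1 c2 c12 c21 m <;>
    (try omega) <;>
    simp only [step, s, s', t, t', if_true, if_false, Multiset.insert_eq_cons, Multiset.map_cons,
      Multiset.map_singleton, Multiset.sum_cons, Multiset.sum_singleton, Matrix.add_vecMul,
      vec_mul_edge h₁₂, vec_mul_edge h₂₁]
  · rw [Multiset.cons_swap a a', Multiset.cons_swap a b', Multiset.cons_swap b a',
      Multiset.cons_swap b b']
    abel
  all_goals
    rcases m (by simp) (by simp) (by simp) with ⟨u, v⟩ | ⟨u, v⟩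
    · rw [vec_cons_congr u, vec_cons_congr v]
    · rw [vec_cons_congr u, vec_cons_congr v, add_comm]

end CircleCalculus

/-! ### Cubes of systems of circles: grading and differential. -/

namespace CircleCalculus

set_option linter.unusedSectionVars false

variable {P : Type*}

/-- The sign of a label, as an integer. -/
def signOf (b : Bool) : ℤ := if b then 1 else -1

/-- The number of positive minus the number of negative classes. -/
noncomputable def tau [Fintype P] (r : Setoid P) (l : P → Bool) : ℤ :=
  classSum r fun p => signOf (l p)

/-- In each of `1·1 = 1`, `1·X = X`, `1 ↦ X⊗1 + 1⊗X`, `X ↦ X⊗X`, the number of `X` minus the number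
of `1` rises by one. -/
theorem tau_edge [Fintype P] {r r' : Setoid P} {a b : P} (h : IsFlip r r' a b) {l l' : P → Bool}
    (hl : Inv r l) (hl' : Inv r' l') (he : EdgeRel r a b l l') : tau r' l' = tau r l + 1 := by
  obtain ⟨hu, he⟩ := he
  rcases h with ⟨h, rfl⟩ | ⟨h, rfl⟩
  · have key := classSum_join h (f := fun p => signOf (l p)) (f' := fun p => signOf (l' p))
      (fun p q e => congrArg signOf (hl p q e)) (fun p q e => congrArg signOf (hl' p q e))
      (fun p ha hb => congrArg signOf (hu p ha hb))
    simp only [h, false_and, not_false_eq_true, true_and, false_or] at he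
    unfold tau
    rw [key]
    revert he
    cases l a <;> cases l b <;> cases l' a <;> simp [signOf]
  · have key := classSum_join h (f := fun p => signOf (l' p)) (f' := fun p => signOf (l p))
      (fun p q e => congrArg signOf (hl' p q e)) (fun p q e => congrArg signOf (hl p q e))
      (fun p ha hb => congrArg signOf
        (hu p (by simp [join_apply, ha, hb]) (by simp [join_apply, ha, hb])).symm)
    have hj := join_rel r' a b
    simp only [hj, true_and, not_true_eq_false, false_and, or_false] at he
    unfold tau
    rw [key]
    revert he
    cases l a <;> cases l' a <;> cases l' b <;> simp [signOf]

/-- A cube of systems of circles: for each set `E` of crossings (those with negative marker) an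
equivalence relation on the points, such that changing the marker at `c` merges or separates the
circles through `fst c` and `snd c`, together with signs that make the faces anticommute. -/
structure StateCube (ι P : Type*) [DecidableEq ι] where
  /-- the equivalence relation with the circles as classes -/
  rel : Finset ι → Setoid P
  /-- a point at one of the two strands at a crossing -/
  fst : ι → P
  /-- a point at the other strand -/
  snd : ι → P
  /-- the sign of an edge of the cube -/
  sign : Finset ι → ι → ℤˣ
  flip : ∀ E c, c ∉ E → IsFlip (rel E) (rel (insert c E)) (fst c) (snd c)
  sign_comm : ∀ E c c', c ≠ c' → c ∉ E → c' ∉ E →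
    sign E c * sign (insert c E) c' = -(sign E c' * sign (insert c' E) c)

section Blocks

variable {ι L : Type*} [Fintype ι] [DecidableEq ι] [Fintype L] {k : Type*} [CommRing k]

open Classical in
/-- A matrix whose blocks are indexed by vertices of the cube and that has only one nonzero block
in each row. -/
noncomputable def block (p : Finset ι → Prop) (f : Finset ι → Finset ι)
    (A : Finset ι → Matrix L L k) : Matrix (Finset ι × L) (Finset ι × L) k :=
  fun S S' => if p S.1 ∧ S'.1 = f S.1 then A S.1 S.2 S'.2 else 0

theorem block_mul (p q : Finset ι → Prop) (f g : Finset ι → Finset ι)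
    (A B : Finset ι → Matrix L L k) :
    block p f A * block q g B =
      block (fun E => p E ∧ q (f E)) (fun E => g (f E)) (fun E => A E * B (f E)) := by
  classical
  funext S S''
  rw [Matrix.mul_apply, Fintype.sum_prod_type, Finset.sum_eq_single (f S.1)]
  · simp only [block, and_true]
    by_cases hp : p S.1 <;> by_cases hq : q (f S.1) <;> by_cases hg : S''.1 = g (f S.1) <;>
      simp [hp, hq, hg, Matrix.mul_apply]
  · intro E' _ hE
    exact Finset.sum_eq_zero fun l _ => by simp [block, hE]
  · simp

theorem block_congr {p q : Finset ι → Prop} {f g : Finset ι → Finset ι}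
    {A B : Finset ι → Matrix L L k} (hpq : ∀ E, p E ↔ q E) (hf : ∀ E, p E → f E = g E)
    (hA : ∀ E, p E → A E = B E) : block p f A = block q g B := by
  funext S S'
  unfold block
  by_cases h : p S.1
  · simp [h, (hpq S.1).1 h, hf _ h, hA _ h]
  · have : ¬ q S.1 := fun e => h ((hpq _).2 e)
    simp [h, this]

theorem block_neg (p : Finset ι → Prop) (f : Finset ι → Finset ι) (A : Finset ι → Matrix L L k) :
    block p f (fun E => - A E) = - block p f A := by
  funext S S'
  simp only [block, Matrix.neg_apply]
  split_ifs <;> simp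

end Blocks

namespace StateCube

variable {ι : Type*} [Fintype ι] [DecidableEq ι] [Fintype P] [DecidableEq P]
variable (K : StateCube ι P) (k : Type*) [CommRing k]

/-- The cast of a sign to the coefficient ring. -/
def unit (E : Finset ι) (c : ι) : k := ((K.sign E c : ℤ) : k)

theorem unit_mul_self (E : Finset ι) (c : ι) : K.unit k E c * K.unit k E c = 1 := by
  unfold unit
  rw [← Int.cast_mul]
  simp

theorem unit_comm {E : Finset ι} {c c' : ι} (h : c ≠ c') (hc : c ∉ E) (hc' : c' ∉ E) :
    K.unit k E c * K.unit k (insert c E) c' = -(K.unit k E c' * K.unit k (insert c' E) c) := by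
  unfold unit
  rw [← Int.cast_mul, ← Int.cast_mul, ← Int.cast_neg]
  congr 1
  have := congrArg (fun u : ℤˣ => (u : ℤ)) (K.sign_comm E c c' h hc hc')
  simpa using this

/-- The part of the differential that changes the marker at `c`. -/
noncomputable def arrow (c : ι) : Matrix (Finset ι × (P → Bool)) (Finset ι × (P → Bool)) k :=
  block (fun E => c ∉ E) (insert c) fun E =>
    K.unit k E c • edge k (K.rel E) (K.rel (insert c E)) (K.fst c) (K.snd c)

/-- The differential. -/
noncomputable def diff : Matrix (Finset ι × (P → Bool)) (Finset ι × (P → Bool)) k :=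
  ∑ c, K.arrow k c

theorem arrow_mul_self (c : ι) : K.arrow k c * K.arrow k c = 0 := by
  unfold arrow
  rw [block_mul]
  funext S S'
  simp [block]

theorem arrow_anticomm {c c' : ι} (h : c ≠ c') :
    K.arrow k c * K.arrow k c' = -(K.arrow k c' * K.arrow k c) := by
  unfold arrow
  rw [block_mul, block_mul, ← block_neg]
  refine block_congr ?_ ?_ ?_
  · intro E; simp only [Finset.mem_insert, not_or]
    constructor
    · rintro ⟨h1, -, h3⟩; exact ⟨h3, h, h1⟩
    · rintro ⟨h1, -, h3⟩; exact ⟨h3, Ne.symm h, h1⟩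
  · intro E _; exact Finset.insert_comm _ _ _
  · rintro E ⟨h1, h2⟩
    simp only [Finset.mem_insert, not_or] at h2
    simp only [Matrix.smul_mul, Matrix.mul_smul, smul_smul]
    rw [Finset.insert_comm c' c, edge_mul_edge_comm (K.flip E c h1) (K.flip E c' h2.2)
      (by rw [Finset.insert_comm]; exact K.flip _ _ (by simp [h2.2, Ne.symm h]))
      (K.flip _ _ (by simp [h1, h])), ← neg_smul]
    congr 1
    linear_combination K.unit_comm k h h1 h2.2

/-- The squares of cobordisms commute while their signs anticommute, so exchanging the two crossings
is a cancelling involution on the terms of the product. -/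
theorem diff_mul_diff : K.diff k * K.diff k = 0 := by
  unfold diff
  rw [Finset.sum_mul_sum, ← Finset.sum_product']
  refine Finset.sum_involution (fun q _ => (q.2, q.1)) ?_ ?_ ?_ ?_
  · rintro ⟨c, c'⟩ -
    by_cases h : c = c'
    · subst h; simp [arrow_mul_self]
    · simp only
      rw [K.arrow_anticomm k h, neg_add_cancel]
  · rintro ⟨c, c'⟩ - h e
    simp only [Prod.mk.injEq] at e
    obtain ⟨rfl, -⟩ := e
    exact h (K.arrow_mul_self k _)
  · intros; simp
  · intros; rfl

/-! ### Degrees, supports, and exactness over a set of vertices. -/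

variable {k}

/-- The basis element `S` has valid labels, homological degree `n` and `τ = T`. -/
def HasDeg (S : Finset ι × (P → Bool)) (n T : ℤ) : Prop :=
  Inv (K.rel S.1) S.2 ∧ (S.1.card : ℤ) = n ∧ tau (K.rel S.1) S.2 = T

theorem arrow_ne_zero {c : ι} {S S' : Finset ι × (P → Bool)} (h : K.arrow k c S S' ≠ 0) :
    c ∉ S.1 ∧ S'.1 = insert c S.1 ∧ Inv (K.rel S.1) S.2 ∧ Inv (K.rel S'.1) S'.2 ∧
      EdgeRel (K.rel S.1) (K.fst c) (K.snd c) S.2 S'.2 := by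
  unfold arrow block at h
  by_cases h1 : c ∉ S.1 ∧ S'.1 = insert c S.1
  · rw [if_pos h1] at h
    refine ⟨h1.1, h1.2, ?_⟩
    by_contra h2
    rw [h1.2] at h2
    simp [edge, h2] at h
  · rw [if_neg h1] at h; exact absurd rfl h

theorem diff_ne_zero {S S' : Finset ι × (P → Bool)} (h : K.diff k S S' ≠ 0) :
    ∃ c, c ∉ S.1 ∧ S'.1 = insert c S.1 ∧ Inv (K.rel S.1) S.2 ∧ Inv (K.rel S'.1) S'.2 ∧
      EdgeRel (K.rel S.1) (K.fst c) (K.snd c) S.2 S'.2 := by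
  unfold diff at h
  rw [Matrix.sum_apply] at h
  obtain ⟨c, -, hc⟩ := Finset.exists_ne_zero_of_sum_ne_zero h
  exact ⟨c, K.arrow_ne_zero hc⟩

theorem hasDeg_of_diff_ne_zero {S S' : Finset ι × (P → Bool)} {n T : ℤ}
    (h : K.diff k S S' ≠ 0) : K.HasDeg S (n - 1) (T - 1) ↔ K.HasDeg S' n T := by
  obtain ⟨c, hc, hS, h1, h2, h3⟩ := K.diff_ne_zero h
  have fl := K.flip _ _ hc
  rw [← hS] at fl
  have := tau_edge fl h1 h2 h3
  have e : S'.1.card = S.1.card + 1 := by rw [hS, Finset.card_insert_of_notMem hc]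
  unfold HasDeg
  simp only [h1, h2, true_and, this, e]
  push_cast
  constructor
  · rintro ⟨u, v⟩; exact ⟨by omega, by omega⟩
  · rintro ⟨u, v⟩; exact ⟨by omega, by omega⟩

/-- The chain `x` has degree `(n, T)` and is supported over the vertices in `W`. -/
def Supp (W : Finset ι → Prop) (n T : ℤ) (x : Finset ι × (P → Bool) → k) : Prop :=
  ∀ S, x S ≠ 0 → W S.1 ∧ K.HasDeg S n T

variable (k) in
/-- The homology of the subquotient complex over the vertices in `W` vanishes in degree `(n, T)`. -/
def Exact (W : Finset ι → Prop) (n T : ℤ) : Prop :=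
  ∀ x : Finset ι × (P → Bool) → k, K.Supp W n T x → (∀ S, W S.1 → (x ᵥ* K.diff k) S = 0) →
    ∃ y, K.Supp W (n - 1) (T - 1) y ∧ ∀ S, W S.1 → (y ᵥ* K.diff k) S = x S

variable {K}

theorem Supp.add {W : Finset ι → Prop} {n T : ℤ} {x y : Finset ι × (P → Bool) → k}
    (hx : K.Supp W n T x) (hy : K.Supp W n T y) : K.Supp W n T (x + y) := by
  intro S h
  by_cases e : x S = 0
  · exact hy S (by simpa [e] using h)
  · exact hx S e

theorem Supp.neg {W : Finset ι → Prop} {n T : ℤ} {x : Finset ι × (P → Bool) → k}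
    (hx : K.Supp W n T x) : K.Supp W n T (-x) := fun S h => hx S (by simpa using h)

theorem Supp.mono {W W' : Finset ι → Prop} {n T : ℤ} {x : Finset ι × (P → Bool) → k}
    (hx : K.Supp W n T x) (h : ∀ E, W E → W' E) : K.Supp W' n T x :=
  fun S hS => ⟨h _ (hx S hS).1, (hx S hS).2⟩

theorem vecMul_eq_zero_of {X : Type*} [Fintype X] {x : X → k} {M : Matrix X X k} {S' : X}
    (h : ∀ S, x S ≠ 0 → M S S' = 0) : (x ᵥ* M) S' = 0 := by
  rw [Matrix.vecMul_eq_sum, Finset.sum_apply]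
  refine Finset.sum_eq_zero fun S _ => ?_
  by_cases e : x S = 0
  · simp [e]
  · simp [h S e]

theorem exists_of_vecMul_ne_zero {X : Type*} [Fintype X] {x : X → k} {M : Matrix X X k} {S' : X}
    (h : (x ᵥ* M) S' ≠ 0) : ∃ S, x S ≠ 0 ∧ M S S' ≠ 0 := by
  by_contra! H
  exact h (vecMul_eq_zero_of H)

theorem Supp.hasDeg_vecMul {W : Finset ι → Prop} {n T : ℤ} {x : Finset ι × (P → Bool) → k}
    (hx : K.Supp W (n - 1) (T - 1) x) {S : Finset ι × (P → Bool)}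
    (h : (x ᵥ* K.diff k) S ≠ 0) : K.HasDeg S n T := by
  obtain ⟨S', h1, h2⟩ := exists_of_vecMul_ne_zero h
  exact (K.hasDeg_of_diff_ne_zero h2).1 (hx S' h1).2

/-- A set of vertices is convex if it contains what lies between two of its vertices. -/
def Convex (W : Finset ι → Prop) : Prop :=
  ∀ E c c', c ∉ E → c' ∉ insert c E → W E → W (insert c' (insert c E)) → W (insert c E)

open Classical in
/-- Restriction of a chain to the vertices in `W`. -/
noncomputable def res (W : Finset ι → Prop) (x : Finset ι × (P → Bool) → k) :
    Finset ι × (P → Bool) → k := fun S => if W S.1 then x S else 0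

theorem res_apply_of {W : Finset ι → Prop} {x : Finset ι × (P → Bool) → k}
    {S : Finset ι × (P → Bool)} (h : W S.1) : res W x S = x S := by simp [res, h]

theorem Supp.res_eq {W : Finset ι → Prop} {n T : ℤ} {x : Finset ι × (P → Bool) → k}
    (hx : K.Supp W n T x) : res W x = x := by
  funext S
  unfold res
  split_ifs with h
  · rfl
  · by_contra e
    exact h (hx S (Ne.symm e)).1

/-- On a convex set of vertices the restricted differential squares to zero. -/
theorem vecMul_res_vecMul {W : Finset ι → Prop} (hW : Convex W) {n T : ℤ}
    {y : Finset ι × (P → Bool) → k} (hy : K.Supp W n T y) {S : Finset ι × (P → Bool)}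
    (hS : W S.1) : (res W (y ᵥ* K.diff k) ᵥ* K.diff k) S = 0 := by
  have h0 : ((y ᵥ* K.diff k) ᵥ* K.diff k) S = 0 := by
    rw [Matrix.vecMul_vecMul, K.diff_mul_diff]; simp
  rw [← h0, ← sub_eq_zero, ← Pi.sub_apply, ← Matrix.sub_vecMul]
  refine vecMul_eq_zero_of fun S' h => ?_
  have hW' : ¬ W S'.1 := fun e => h (by simp [res, e])
  have h' : (y ᵥ* K.diff k) S' ≠ 0 := by simpa [res, hW'] using h
  obtain ⟨S₀, h1, h2⟩ := exists_of_vecMul_ne_zero h'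
  -- A nonzero contribution would lead from a vertex of `W` out of `W` and back into it, against
  -- convexity.
  by_contra h3
  obtain ⟨c, hc, e, -⟩ := K.diff_ne_zero h2
  obtain ⟨c', hc', e', -⟩ := K.diff_ne_zero h3
  rw [e] at hc' e' hW'
  exact hW' (hW S₀.1 c c' hc hc' (hy S₀ h1).1 (by rw [← e']; exact hS))

/-- If the homology of a subcomplex and of the quotient complex vanish, so does that of the
complex. -/
theorem exact_of_sub_of_quotient {W W₁ W₂ : Finset ι → Prop} (hW : ∀ E, W E ↔ W₁ E ∨ W₂ E)
    (hd : ∀ E, W₁ E → ¬ W₂ E) (hsub : ∀ E c, c ∉ E → W₂ E → ¬ W₁ (insert c E)) (hc : Convex W)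
    {n T : ℤ} (h₁ : K.Exact k W₁ n T) (h₂ : K.Exact k W₂ n T) : K.Exact k W n T := by
  -- `W₂` carries the subcomplex and `W₁` the quotient complex.
  have h21 : ∀ (n T : ℤ) (z : Finset ι × (P → Bool) → k), K.Supp W₂ n T z →
      ∀ S, W₁ S.1 → (z ᵥ* K.diff k) S = 0 := by
    intro n T z hz S hS
    refine vecMul_eq_zero_of fun S' h => ?_
    by_contra e
    obtain ⟨c, hc, e, -⟩ := K.diff_ne_zero e
    exact hsub _ c hc (hz S' h).1 (by rw [← e]; exact hS)
  intro x hx hdx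
  have hx1 : K.Supp W₁ n T (res W₁ x) := by
    intro S h
    unfold res at h
    split_ifs at h with h'
    · exact ⟨h', (hx S h).2⟩
    · exact absurd rfl h
  have hx2 : K.Supp W₂ n T (res W₂ x) := by
    intro S h
    unfold res at h
    split_ifs at h with h'
    · exact ⟨h', (hx S h).2⟩
    · exact absurd rfl h
  have hx12 : x = res W₁ x + res W₂ x := by
    funext S
    simp only [res, Pi.add_apply]
    by_cases u : W₁ S.1
    · simp [u, hd _ u]
    · by_cases v : W₂ S.1
      · simp [u, v]
      · have : x S = 0 := by
          by_contra e
          exact ((hW _).1 (hx S e).1).elim u v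
        simp [u, v, this]
  obtain ⟨y₁, hy₁, e₁⟩ := h₁ (res W₁ x) hx1 (by
    intro S hS
    have := hdx S ((hW _).2 (Or.inl hS))
    rw [hx12, Matrix.add_vecMul, Pi.add_apply, h21 n T _ hx2 S hS, add_zero] at this
    exact this)
  have hy₁' : K.Supp W (n - 1) (T - 1) y₁ := hy₁.mono fun E h => (hW E).2 (Or.inl h)
  -- By the choice of `y₁`, the chain `u` vanishes over `W₁`; what is left of it over `W` is a cycle
  -- of the subcomplex.
  set u : Finset ι × (P → Bool) → k := x - y₁ ᵥ* K.diff k with hu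
  have hx' : K.Supp W₂ n T (res W₂ u) := by
    intro S h
    unfold res at h
    split_ifs at h with h'
    · refine ⟨h', ?_⟩
      by_cases e : x S = 0
      · exact hy₁.hasDeg_vecMul (k := k) (by simpa [hu, e] using h)
      · exact (hx S e).2
    · exact absurd rfl h
  have hresu : res W₂ u = x - res W (y₁ ᵥ* K.diff k) := by
    have : x = res W x := hx.res_eq.symm
    rw [this]
    funext S
    simp only [res, Pi.sub_apply, hu]
    by_cases a : W₁ S.1
    · have b := hd _ a
      have w : W S.1 := (hW _).2 (Or.inl a)
      have := e₁ S a
      simp only [res, a, if_true] at this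
      simp [b, w, this]
    · by_cases b : W₂ S.1
      · have w : W S.1 := (hW _).2 (Or.inr b)
        simp [b, w]
      · have w : ¬ W S.1 := fun w => ((hW _).1 w).elim a b
        simp [b, w]
  obtain ⟨y₂, hy₂, e₂⟩ := h₂ (res W₂ u) hx' (by
    intro S hS
    have hS' : W S.1 := (hW _).2 (Or.inr hS)
    rw [hresu, Matrix.sub_vecMul, Pi.sub_apply, hdx S hS', vecMul_res_vecMul hc hy₁' hS',
      sub_zero])
  refine ⟨y₁ + y₂, hy₁'.add (hy₂.mono fun E h => (hW E).2 (Or.inr h)), fun S hS => ?_⟩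
  rw [Matrix.add_vecMul, Pi.add_apply]
  rcases (hW _).1 hS with h | h
  · rw [e₁ S h, h21 _ _ y₂ hy₂ S h, add_zero, res_apply_of h]
  · rw [e₂ S h, res_apply_of h, hu, Pi.sub_apply]
    ring

end StateCube

end CircleCalculus

namespace CircleCalculus

set_option linter.unusedSectionVars false

variable {P : Type*}

/-! ### The kernel of a merging cobordism -/

open Classical in
/-- The labelling with the value `v` on the classes of `a` and `b` and otherwise as in `l`. -/
noncomputable def mergeLabel (r : Setoid P) (a b : P) (v : Bool) (l : P → Bool) : P → Bool :=
  fun p => if r p a ∨ r p b then v else l p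

open Classical in
/-- The labelling with the value `v` on the class of `a` and otherwise as in `l`. -/
noncomputable def setLabel (r : Setoid P) (a : P) (v : Bool) (l : P → Bool) : P → Bool :=
  fun p => if r p a then v else l p

theorem inv_setLabel {r : Setoid P} {a : P} {v : Bool} {l : P → Bool} (h : Inv r l) :
    Inv r (setLabel r a v l) := by
  intro p q hpq
  have e : r p a ↔ r q a := ⟨fun g => r.trans (r.symm hpq) g, fun g => r.trans hpq g⟩
  classical
  unfold setLabel
  rw [h p q hpq]
  exact if_congr e rfl rfl

theorem inv_mergeLabel {r : Setoid P} {a b : P} {v : Bool} {l : P → Bool} (h : Inv r l) :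
    Inv (join r a b) (mergeLabel r a b v l) := by
  rintro p q (hpq | ⟨hp, hq⟩)
  · have e : (r p a ∨ r p b) ↔ (r q a ∨ r q b) :=
      ⟨fun g => g.imp (r.trans (r.symm hpq)) (r.trans (r.symm hpq)),
        fun g => g.imp (r.trans hpq) (r.trans hpq)⟩
    classical
    unfold mergeLabel
    rw [h p q hpq]
    exact if_congr e rfl rfl
  · simp [mergeLabel, hp, hq]

theorem Inv.of_join {r : Setoid P} {a b : P} {l : P → Bool} (h : Inv (join r a b) l) : Inv r l :=
  fun p q e => h p q (Or.inl e)

variable [Fintype P] [DecidableEq P] {k : Type*} [CommRing k]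

theorem single_vecMul_row {L : Type*} [Fintype L] [DecidableEq L] (l : L) (A : Matrix L L k) :
    (Pi.single l (1 : k)) ᵥ* A = A l := Matrix.single_one_vecMul l A

theorem edge_merge_row {r : Setoid P} {a b : P} (hab : ¬ r a b) {l : P → Bool} (hl : Inv r l) :
    edge k r (join r a b) a b l =
      if (l a && l b) = true then 0 else Pi.single (mergeLabel r a b (l a || l b) l) 1 := by
  classical
  funext l'
  have key : (Inv (join r a b) l' ∧ EdgeRel r a b l l') ↔
      ((l a && l b) = false ∧ l' = mergeLabel r a b (l a || l b) l) := by
    constructor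
    · rintro ⟨hi, hu, h | ⟨-, h1, h2⟩⟩
      · exact absurd h.1 hab
      · refine ⟨h2, funext fun p => ?_⟩
        unfold mergeLabel
        split_ifs with hp
        · rw [← h1]; exact hi _ _ (Or.inr ⟨hp, Or.inl (r.refl a)⟩)
        · push Not at hp
          exact (hu p hp.1 hp.2).symm
    · rintro ⟨h, rfl⟩
      refine ⟨inv_mergeLabel hl, fun p ha hb => by simp [mergeLabel, ha, hb],
        Or.inr ⟨hab, by simp [mergeLabel], h⟩⟩
  simp only [edge, hl, true_and, key]
  by_cases h : (l a && l b) = true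
  · simp [h]
  · rw [Bool.not_eq_true] at h
    simp [h, Pi.single_apply]

theorem edge_split_row {r : Setoid P} {a b : P} (hab : ¬ r a b) {l : P → Bool}
    (hl : Inv (join r a b) l) :
    edge k (join r a b) r a b l =
      if l a = true then Pi.single l 1
      else Pi.single (setLabel r a true l) 1 + Pi.single (setLabel r b true l) 1 := by
  classical
  have hba : ¬ r b a := fun e => hab (r.symm e)
  have lab : l a = l b := hl _ _ (join_rel _ _ _)
  funext l'
  have key : (Inv r l' ∧ EdgeRel (join r a b) a b l l') ↔
      ((l a = true ∧ l' = l) ∨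
        (l a = false ∧ (l' = setLabel r a true l ∨ l' = setLabel r b true l))) := by
    constructor
    · rintro ⟨hi, hu, ⟨-, h1, h2⟩ | h⟩
      swap
      · exact absurd (join_rel _ _ _) h.1
      have off : ∀ p, ¬ r p a → ¬ r p b → l p = l' p := fun p u v =>
        hu p (by simp [join_apply, u, v]) (by simp [join_apply, u, v])
      have cases3 : (l a = true ∧ l' a = true ∧ l' b = true) ∨
          (l a = false ∧ l' a = true ∧ l' b = false) ∨
          (l a = false ∧ l' a = false ∧ l' b = true) := by
        revert h1 h2; cases l a <;> cases l' a <;> cases l' b <;> simp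
      rcases cases3 with ⟨e, ea, eb⟩ | ⟨e, ea, eb⟩ | ⟨e, ea, eb⟩
      · refine Or.inl ⟨e, funext fun p => ?_⟩
        by_cases u : r p a
        · rw [hi _ _ u, hl.of_join _ _ u, ea, e]
        · by_cases v : r p b
          · rw [hi _ _ v, hl.of_join _ _ v, eb, ← lab, e]
          · exact (off p u v).symm
      · refine Or.inr ⟨e, Or.inl (funext fun p => ?_)⟩
        by_cases u : r p a
        · rw [hi _ _ u, ea]; simp [setLabel, u]
        · by_cases v : r p b
          · rw [hi _ _ v, eb]; simp [setLabel, u, hl.of_join _ _ v, ← lab, e]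
          · simp [setLabel, u, off p u v]
      · refine Or.inr ⟨e, Or.inr (funext fun p => ?_)⟩
        by_cases v : r p b
        · rw [hi _ _ v, eb]; simp [setLabel, v]
        · by_cases u : r p a
          · rw [hi _ _ u, ea]; simp [setLabel, v, hl.of_join _ _ u, e]
          · simp [setLabel, v, off p u v]
    · have jl : ∀ p, ¬ join r a b p a → ¬ r p a ∧ ¬ r p b := fun p h =>
        ⟨fun e => h (Or.inl e), fun e => h (Or.inr ⟨Or.inr e, Or.inl (r.refl a)⟩)⟩
      rintro (⟨e, rfl⟩ | ⟨e, rfl | rfl⟩)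
      · exact ⟨hl.of_join, fun _ _ _ => rfl, Or.inl ⟨join_rel _ _ _, by simp [← lab, e]⟩⟩
      · refine ⟨inv_setLabel hl.of_join, fun p u _ => by simp [setLabel, (jl p u).1],
          Or.inl ⟨join_rel _ _ _, ?_⟩⟩
        simp [setLabel, hba, ← lab, e]
      · refine ⟨inv_setLabel hl.of_join, fun p u _ => by simp [setLabel, (jl p u).2],
          Or.inl ⟨join_rel _ _ _, ?_⟩⟩
        simp [setLabel, hab, e]
  have hne : setLabel r a true l ≠ setLabel r b true l ∨ l a = true := by
    by_cases e : l a = true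
    · exact Or.inr e
    · left
      intro g
      have := congrFun g a
      simp [setLabel, hab, e] at this
  simp only [edge, hl, true_and, key]
  by_cases e : l a = true
  · simp [e, Pi.single_apply]
  · have hne := hne.resolve_right e
    rw [if_neg e]
    simp only [e, Pi.add_apply, Pi.single_apply]
    rw [Bool.not_eq_true] at e
    by_cases g : l' = setLabel r a true l
    · have : l' ≠ setLabel r b true l := fun g' => hne (g.symm.trans g')
      simp [g, hne]
    · simp [g]

open Classical in
/-- A right inverse of the merging cobordism: the label is moved to the circle of `b`. -/
noncomputable def mergeSection (k : Type*) [CommRing k] (r : Setoid P) (a b : P) :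
    Matrix (P → Bool) (P → Bool) k :=
  fun l l' => if Inv (join r a b) l ∧ l' = setLabel r a false l then 1 else 0

open Classical in
/-- A left inverse of the splitting cobordism: the circle of `a` is required to carry `X`. -/
noncomputable def splitRetract (k : Type*) [CommRing k] (r : Setoid P) (a b : P) :
    Matrix (P → Bool) (P → Bool) k :=
  fun l l' => if Inv r l ∧ l a = true ∧ l' = mergeLabel r a b (l b) l then 1 else 0

theorem mergeSection_row {r : Setoid P} {a b : P} {l : P → Bool} (hl : Inv (join r a b) l) :
    mergeSection k r a b l = Pi.single (setLabel r a false l) 1 := by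
  classical
  funext l'
  simp [mergeSection, hl, Pi.single_apply]

theorem splitRetract_row {r : Setoid P} {a b : P} {l : P → Bool} (hl : Inv r l) :
    splitRetract k r a b l =
      if l a = true then Pi.single (mergeLabel r a b (l b) l) 1 else 0 := by
  classical
  funext l'
  by_cases h : l a = true <;> simp [splitRetract, hl, h, Pi.single_apply]

theorem mergeSection_mul_edge {r : Setoid P} {a b : P} (hab : ¬ r a b) {l : P → Bool}
    (hl : Inv (join r a b) l) :
    (mergeSection k r a b * edge k r (join r a b) a b) l = Pi.single l 1 := by
  classical
  have hba : ¬ r b a := fun e => hab (r.symm e)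
  have lab : l a = l b := hl _ _ (join_rel _ _ _)
  rw [Matrix.mul_apply_eq_vecMul, mergeSection_row hl, single_vecMul_row,
    edge_merge_row hab (inv_setLabel hl.of_join)]
  have : mergeLabel r a b (setLabel r a false l a || setLabel r a false l b)
      (setLabel r a false l) = l := by
    funext p
    by_cases u : r p a
    · simp [mergeLabel, setLabel, u, hba, hl.of_join _ _ u, lab]
    · by_cases v : r p b
      · simp [mergeLabel, setLabel, v, hba, hl.of_join _ _ v]
      · simp [mergeLabel, setLabel, u, v]
  rw [this]
  simp [setLabel]

/-- A sign that changes when the label `X` is moved from the circle of `a` to that of `b`. -/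
structure Twist (r : Setoid P) (a b : P) (φ : (P → Bool) → k) : Prop where
  mul_self : ∀ l, φ l * φ l = 1
  swap : ∀ l, Inv r l → l a = false → l b = false →
    φ (setLabel r b true l) = - φ (setLabel r a true l)

theorem single_mul_diagonal {L : Type*} [Fintype L] [DecidableEq L] (φ : L → k) (l : L) :
    (Pi.single l (1 : k)) ᵥ* Matrix.diagonal φ = φ l • Pi.single l 1 := by
  funext l'
  rw [Matrix.vecMul_diagonal]
  by_cases h : l' = l
  · subst h; simp
  · simp [h]

/-- With the twist, `1` goes to `±(X⊗1 - 1⊗X)` and `X` to `±X⊗X`, both of which the product kills.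
Without it, `1` would end at `2X`. -/
theorem edge_split_twist_mul_edge {r : Setoid P} {a b : P} (hab : ¬ r a b)
    {φ : (P → Bool) → k} (hφ : Twist r a b φ) {l : P → Bool} (hl : Inv (join r a b) l) :
    (edge k (join r a b) r a b * Matrix.diagonal φ * edge k r (join r a b) a b) l = 0 := by
  classical
  have hba : ¬ r b a := fun e => hab (r.symm e)
  have lab : l a = l b := hl _ _ (join_rel _ _ _)
  rw [Matrix.mul_apply_eq_vecMul, Matrix.mul_apply_eq_vecMul, edge_split_row hab hl]
  by_cases e : l a = true
  · rw [if_pos e, single_mul_diagonal, Matrix.smul_vecMul, single_vecMul_row,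
      edge_merge_row hab hl.of_join, if_pos (by simp [e, ← lab]), smul_zero]
  · rw [if_neg e, Matrix.add_vecMul, single_mul_diagonal, single_mul_diagonal, Matrix.add_vecMul,
      Matrix.smul_vecMul, Matrix.smul_vecMul, single_vecMul_row, single_vecMul_row, edge_merge_row hab (inv_setLabel hl.of_join),
      edge_merge_row hab (inv_setLabel hl.of_join)]
    rw [Bool.not_eq_true] at e
    rw [hφ.swap l hl.of_join e (lab ▸ e)]
    have h1 : mergeLabel r a b (setLabel r a true l a || setLabel r a true l b)
        (setLabel r a true l) = mergeLabel r a b (setLabel r b true l a || setLabel r b true l b)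
        (setLabel r b true l) := by
      funext p
      by_cases u : r p a <;> by_cases v : r p b <;>
        simp [mergeLabel, setLabel, u, v, hab, hba]
    rw [h1]
    simp [setLabel, hab, hba, e, ← lab]

/-- The two twists cancel. Requiring `X` on the circle of `a` selects `X⊗1` from the coproduct of
`1`, and forgetting that `X` recovers the original label. -/
theorem edge_split_mul_splitRetract {r : Setoid P} {a b : P} (hab : ¬ r a b)
    {φ : (P → Bool) → k} (hφ : Twist r a b φ) {l : P → Bool} (hl : Inv (join r a b) l) :
    (edge k (join r a b) r a b * Matrix.diagonal φ *
      (Matrix.diagonal φ * splitRetract k r a b)) l = Pi.single l 1 := by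
  classical
  have hba : ¬ r b a := fun e => hab (r.symm e)
  have lab : l a = l b := hl _ _ (join_rel _ _ _)
  have hd : Matrix.diagonal φ * Matrix.diagonal φ = 1 := by
    rw [Matrix.diagonal_mul_diagonal]
    simp [hφ.mul_self]
  rw [Matrix.mul_assoc, ← Matrix.mul_assoc (Matrix.diagonal φ), hd, Matrix.one_mul,
    Matrix.mul_apply_eq_vecMul, edge_split_row hab hl]
  by_cases e : l a = true
  · rw [if_pos e, single_vecMul_row, splitRetract_row hl.of_join, if_pos e]
    congr 1
    funext p
    by_cases u : r p a
    · simp [mergeLabel, u, hl.of_join _ _ u, lab]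
    · by_cases v : r p b
      · simp [mergeLabel, v, hl.of_join _ _ v]
      · simp [mergeLabel, u, v]
  · rw [if_neg e, Matrix.add_vecMul, single_vecMul_row, single_vecMul_row, splitRetract_row (inv_setLabel hl.of_join),
      splitRetract_row (inv_setLabel hl.of_join)]
    rw [if_pos (by simp [setLabel]), if_neg (by simp [setLabel, hab, e]), add_zero]
    congr 1
    rw [Bool.not_eq_true] at e
    funext p
    by_cases u : r p a
    · simp [mergeLabel, setLabel, u, hba, hl.of_join _ _ u, lab]
    · by_cases v : r p b
      · simp [mergeLabel, setLabel, v, hba, hl.of_join _ _ v]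
      · simp [mergeLabel, setLabel, u, v]

/-- Chains are row vectors, so the factors of a product read in the order in which they act. With
the preceding identities this says that twisted coproduct and product form a split short exact
sequence `0 → A → A ⊗ A → A → 0`. The only case that mixes terms is `X⊗1`: the first summand gives
`1⊗X`, the second `X⊗1 - 1⊗X`. -/
theorem edge_mul_mergeSection_add {r : Setoid P} {a b : P} (hab : ¬ r a b)
    {φ : (P → Bool) → k} (hφ : Twist r a b φ) {l : P → Bool} (hl : Inv r l) :
    (edge k r (join r a b) a b * mergeSection k r a b +
      Matrix.diagonal φ * splitRetract k r a b *
        (edge k (join r a b) r a b * Matrix.diagonal φ)) l = Pi.single l 1 := by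
  classical
  have hba : ¬ r b a := fun e => hab (r.symm e)
  have ra := r.refl a
  have rb := r.refl b
  have hrow : (Matrix.diagonal φ * splitRetract k r a b) l = φ l • splitRetract k r a b l := by
    funext l'
    rw [Matrix.diagonal_mul]
    rfl
  change (edge k r (join r a b) a b * mergeSection k r a b) l + (Matrix.diagonal φ *
    splitRetract k r a b * (edge k (join r a b) r a b * Matrix.diagonal φ)) l = _
  rw [Matrix.mul_apply_eq_vecMul, Matrix.mul_apply_eq_vecMul, hrow, ← Matrix.vecMul_vecMul,
    edge_merge_row hab hl, splitRetract_row hl]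
  by_cases ea : l a = true
  · rw [if_pos ea]
    by_cases eb : l b = true
    · rw [if_pos (by simp [ea, eb]), Matrix.zero_vecMul, zero_add, Matrix.smul_vecMul,
        single_vecMul_row, edge_split_row hab (inv_mergeLabel hl),
        if_pos (by simp [mergeLabel, eb])]
      have : mergeLabel r a b (l b) l = l := by
        funext p
        by_cases u : r p a
        · simp [mergeLabel, u, hl _ _ u, ea, eb]
        · by_cases v : r p b
          · simp [mergeLabel, v, hl _ _ v]
          · simp [mergeLabel, u, v]
      rw [this, Matrix.smul_vecMul, single_mul_diagonal, smul_smul, hφ.mul_self, one_smul]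
    · rw [Bool.not_eq_true] at eb
      rw [if_neg (by simp [eb]), single_vecMul_row,
        mergeSection_row (inv_mergeLabel hl), Matrix.smul_vecMul, single_vecMul_row, edge_split_row hab (inv_mergeLabel hl), if_neg (by simp [mergeLabel, eb]),
        Matrix.smul_vecMul, Matrix.add_vecMul, single_mul_diagonal, single_mul_diagonal]
      have h0 : setLabel r a true (mergeLabel r a b (l b) l) = l := by
        funext p
        by_cases u : r p a
        · simp [setLabel, u, hl _ _ u, ea]
        · by_cases v : r p b
          · simp [mergeLabel, setLabel, u, v, hl _ _ v]
          · simp [mergeLabel, setLabel, u, v]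
      have h1 : setLabel r a false (mergeLabel r a b (l a || l b) l) =
          setLabel r b true (mergeLabel r a b (l b) l) := by
        funext p
        by_cases u : r p a
        · have v : ¬ r p b := fun v => hab (r.trans (r.symm u) v)
          simp [mergeLabel, setLabel, u, v, eb]
        · by_cases v : r p b <;> simp [mergeLabel, setLabel, u, v, ea]
      have h2 := hφ.swap _ ((inv_mergeLabel (a := a) (b := b) (v := l b) hl).of_join)
        (by simp [mergeLabel, eb]) (by simp [mergeLabel, eb])
      rw [h2, h0, h1, smul_add, smul_smul, smul_smul, mul_neg, hφ.mul_self, one_smul, neg_smul,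
        one_smul]
      abel
  · rw [if_neg ea, smul_zero, Matrix.zero_vecMul, Matrix.zero_vecMul, add_zero,
      if_neg (by simp [ea]), single_vecMul_row,
        mergeSection_row (inv_mergeLabel hl)]
    congr 1
    rw [Bool.not_eq_true] at ea
    funext p
    by_cases u : r p a
    · simp [setLabel, u, hl _ _ u, ea]
    · by_cases v : r p b
      · simp [mergeLabel, setLabel, u, v, hl _ _ v, ea]
      · simp [mergeLabel, setLabel, u, v]

open Classical in
/-- The sign of the number of circles in `Z` with label `X`. -/
noncomputable def parity (k : Type*) [CommRing k] (r : Setoid P) (Z : P → Prop) (l : P → Bool) : k :=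
  ((((-1 : ℤˣ) ^ classSum r (fun p => if Z p ∧ l p = true then 1 else 0) : ℤˣ) : ℤ) : k)

theorem parity_mul_self (r : Setoid P) (Z : P → Prop) (l : P → Bool) :
    parity k r Z l * parity k r Z l = 1 := by
  unfold parity
  rw [← Int.cast_mul]
  simp

-- Moving an `X` from the circle of `a` outside `Z` to the circle of `b` inside `Z` changes the
-- count by one.
open Classical in
theorem twist_parity {r : Setoid P} {a b : P} (hab : ¬ r a b) {Z : P → Prop}
    (hZ : ∀ p q, r p q → (Z p ↔ Z q)) (ha : ¬ Z a) (hb : Z b) :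
    Twist r a b (parity k r Z) := by
  refine ⟨parity_mul_self r Z, fun l hl la lb => ?_⟩
  have hba : ¬ r b a := fun e => hab (r.symm e)
  have ra := r.refl a
  have rb := r.refl b
  have inv : ∀ l, Inv r l → ∀ p q, r p q →
      (if Z p ∧ l p = true then (1 : ℤ) else 0) = if Z q ∧ l q = true then 1 else 0 := by
    intro l hl p q e
    rw [hl _ _ e]
    simp only [hZ _ _ e]
  -- Both counts are compared with one sum over the merged classes, in which the class of `a` and
  -- `b` contributes zero.
  have inv' : ∀ p q, join r a b p q →
      (if r p a ∨ r p b then (0 : ℤ) else if Z p ∧ l p = true then 1 else 0) =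
      if r q a ∨ r q b then 0 else if Z q ∧ l q = true then 1 else 0 := by
    rintro p q (e | ⟨e, e'⟩)
    · have g : (r p a ∨ r p b) ↔ (r q a ∨ r q b) :=
        ⟨fun g => g.imp (r.trans (r.symm e)) (r.trans (r.symm e)),
          fun g => g.imp (r.trans e) (r.trans e)⟩
      simp only [g, hl _ _ e, hZ _ _ e]
    · rw [if_pos e, if_pos e']
  have h1 := classSum_join hab (inv _ (inv_setLabel (a := a) (v := true) hl)) inv'
    (fun p u v => by simp [setLabel, u, v])
  have h2 := classSum_join hab (inv _ (inv_setLabel (a := b) (v := true) hl)) inv'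
    (fun p u v => by simp [setLabel, u, v])
  unfold parity
  rw [h1, h2]
  simp only [setLabel, ra, rb, hab, hba, ha, hb, lb, if_true, if_false, true_or, false_and,
    true_and, Bool.false_eq_true, sub_zero, add_zero]
  rw [zpow_add, zpow_one, ← Int.cast_neg]
  simp

-- The merged circle lies entirely inside or entirely outside `Z`, and the nonzero products `1·1`,
-- `1·X`, `X·1` preserve the number of `X`.
open Classical in
theorem parity_edge_merge {r : Setoid P} {a b : P} (hab : ¬ r a b) {Z : P → Prop}
    (hZ : ∀ p q, join r a b p q → (Z p ↔ Z q)) {l l' : P → Bool} (hl : Inv r l)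
    (hl' : Inv (join r a b) l') (h : EdgeRel r a b l l') :
    parity k r Z l = parity k (join r a b) Z l' := by
  have h1 := classSum_join hab (f := fun p => if Z p ∧ l p = true then 1 else 0)
    (f' := fun p => if Z p ∧ l' p = true then 1 else 0)
    (fun p q e => by simp only [hl _ _ e, hZ _ _ (Or.inl e)])
    (fun p q e => by simp only [hl' _ _ e, hZ _ _ e])
    (fun p u v => by simp only [h.1 p u v])
  obtain ⟨-, h | ⟨-, h2, h3⟩⟩ := h
  · exact absurd h.1 hab
  have hz := hZ _ _ (join_rel r a b)
  have e : classSum r (fun p => if Z p ∧ l p = true then 1 else 0) =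
      classSum (join r a b) (fun p => if Z p ∧ l' p = true then 1 else 0) := by
    rw [h1]
    simp only [hz, h2]
    by_cases z : Z b
    · revert h3
      cases l a <;> cases l b <;> simp [z]
    · simp [z]
  unfold parity
  rw [e]

end CircleCalculus

/-! ### Bridges and their contraction. -/

namespace CircleCalculus

set_option linter.unusedSectionVars false

variable {P : Type*}

section Blocks

variable {ι L : Type*} [Fintype ι] [DecidableEq ι] [Fintype L] {k : Type*} [CommRing k]

theorem block_add (p : Finset ι → Prop) (f : Finset ι → Finset ι) (A B : Finset ι → Matrix L L k) :
    block p f A + block p f B = block p f fun E => A E + B E := by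
  funext S S'
  change block p f A S S' + block p f B S S' = _
  simp only [block]
  split_ifs <;> simp

theorem block_row_eq_single [DecidableEq L] {p : Finset ι → Prop} {f : Finset ι → Finset ι}
    {A : Finset ι → Matrix L L k} {S : Finset ι × L} (hp : p S.1) (hf : f S.1 = S.1)
    (hA : A S.1 S.2 = Pi.single S.2 1) : block p f A S = Pi.single S 1 := by
  classical
  funext S'
  simp only [block, hp, hf, hA, true_and, Pi.single_apply, Prod.ext_iff]
  by_cases h1 : S'.1 = S.1 <;> by_cases h2 : S'.2 = S.2 <;> simp [h1, h2]

theorem block_row_eq_zero {p : Finset ι → Prop} {f : Finset ι → Finset ι}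
    {A : Finset ι → Matrix L L k} {S : Finset ι × L} (hA : A S.1 S.2 = 0) :
    block p f A S = 0 := by
  funext S'
  simp [block, hA]

theorem block_ne_zero {p : Finset ι → Prop} {f : Finset ι → Finset ι}
    {A : Finset ι → Matrix L L k} {S S' : Finset ι × L} (h : block p f A S S' ≠ 0) :
    p S.1 ∧ S'.1 = f S.1 ∧ A S.1 S.2 S'.2 ≠ 0 := by
  unfold block at h
  split_ifs at h with h'
  · exact ⟨h'.1, h'.2, h⟩
  · exact absurd rfl h

theorem vecMul_eq_self_of {X : Type*} [Fintype X] [DecidableEq X] {x : X → k} {M : Matrix X X k}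
    (h : ∀ S, x S ≠ 0 → M S = Pi.single S 1) : x ᵥ* M = x := by
  rw [← Matrix.vecMul_one x, Matrix.vecMul_vecMul, Matrix.one_mul, Matrix.vecMul_eq_sum,
    Matrix.vecMul_eq_sum]
  refine Finset.sum_congr rfl fun S _ => ?_
  by_cases e : x S = 0
  · simp [e]
  · rw [h S e]
    congr 1
    funext S'
    simp [Matrix.one_apply, Pi.single_apply, eq_comm]

theorem vecMul_eq_zero_of_rows {X : Type*} [Fintype X] {x : X → k} {M : Matrix X X k}
    (h : ∀ S, x S ≠ 0 → M S = 0) : x ᵥ* M = 0 := by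
  funext S'
  exact StateCube.vecMul_eq_zero_of fun S hS => by rw [h S hS]; rfl

end Blocks

theorem edgeRel_setLabel {r : Setoid P} {a b : P} (hab : ¬ r a b) {l : P → Bool}
    (hl : Inv (join r a b) l) : EdgeRel r a b (setLabel r a false l) l := by
  have hba : ¬ r b a := fun e => hab (r.symm e)
  have lab : l a = l b := hl _ _ (join_rel _ _ _)
  exact ⟨fun p u _ => by simp [setLabel, u],
    Or.inr ⟨hab, by simp [setLabel, hba, lab], by simp [setLabel]⟩⟩

theorem edgeRel_mergeLabel {r : Setoid P} {a b : P} {l : P → Bool}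
    (ha : l a = true) : EdgeRel (join r a b) a b (mergeLabel r a b (l b) l) l := by
  refine ⟨fun p u v => ?_, Or.inl ⟨join_rel _ _ _, by simp [mergeLabel, ha], by simp [ha]⟩⟩
  have u' : ¬ r p a := fun e => u (Or.inl e)
  have v' : ¬ r p b := fun e => v (Or.inl e)
  simp [mergeLabel, u', v']

namespace StateCube

variable {ι : Type*} [Fintype ι] [DecidableEq ι] [Fintype P] [DecidableEq P]
variable {K : StateCube ι P} {k : Type*} [CommRing k]

/-- A crossing `c` all of whose edges over the vertices in `W` are merges, and that separates the
points into the set `Z` and its complement so that no other edge over `W` joins the two sides. -/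
structure IsBridge (K : StateCube ι P) (W : Finset ι → Prop) (c : ι) (Z : P → Prop) : Prop where
  convex : Convex W
  insert_mem : ∀ E, W E → W (insert c E)
  erase_mem : ∀ E, W E → W (E.erase c)
  merge : ∀ E, W E → ∀ c', c' ∉ E → W (insert c' E) → ¬ K.rel E (K.fst c') (K.snd c')
  saturated : ∀ E, W E → c ∉ E → ∀ p q, K.rel E p q → (Z p ↔ Z q)
  fst_not_mem : ¬ Z (K.fst c)
  snd_mem : Z (K.snd c)

variable (K k) in
/-- The chain map from the part over `c ∈ E` onto the kernel of the arrow at a bridge `c`. -/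
noncomputable def bridgeSplit (c : ι) (Z : P → Prop) :
    Matrix (Finset ι × (P → Bool)) (Finset ι × (P → Bool)) k :=
  block (fun E => c ∈ E) (fun E => E.erase c) fun E => K.unit k (E.erase c) c •
    (edge k (K.rel E) (K.rel (E.erase c)) (K.fst c) (K.snd c) *
      Matrix.diagonal (parity k (K.rel (E.erase c)) Z))

variable (K k) in
/-- A left inverse of `bridgeSplit`. -/
noncomputable def bridgeRetract (c : ι) (Z : P → Prop) :
    Matrix (Finset ι × (P → Bool)) (Finset ι × (P → Bool)) k :=
  block (fun E => c ∉ E) (fun E => insert c E) fun E => K.unit k E c •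
    (Matrix.diagonal (parity k (K.rel E) Z) * splitRetract k (K.rel E) (K.fst c) (K.snd c))

variable (K k) in
/-- A right inverse of the arrow at a bridge `c`. -/
noncomputable def bridgeSection (c : ι) :
    Matrix (Finset ι × (P → Bool)) (Finset ι × (P → Bool)) k :=
  block (fun E => c ∈ E) (fun E => E.erase c) fun E => K.unit k (E.erase c) c •
    mergeSection k (K.rel (E.erase c)) (K.fst c) (K.snd c)

namespace IsBridge

variable {W : Finset ι → Prop} {c : ι} {Z : P → Prop} (h : IsBridge K W c Z)
include h

theorem not_rel {E : Finset ι} (hE : W E) (hc : c ∉ E) : ¬ K.rel E (K.fst c) (K.snd c) :=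
  h.merge E hE c hc (h.insert_mem E hE)

theorem rel_insert {E : Finset ι} (hE : W E) {c' : ι} (hc : c' ∉ E) (hE' : W (insert c' E)) :
    K.rel (insert c' E) = join (K.rel E) (K.fst c') (K.snd c') :=
  (K.flip E c' hc).eq_join (h.merge E hE c' hc hE')

theorem rel_eq {E : Finset ι} (hE : W E) (hc : c ∈ E) :
    K.rel E = join (K.rel (E.erase c)) (K.fst c) (K.snd c) := by
  conv_lhs => rw [← Finset.insert_erase hc]
  exact h.rel_insert (h.erase_mem E hE) (Finset.notMem_erase c E) (by rwa [Finset.insert_erase hc])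

theorem twist {E : Finset ι} (hE : W E) (hc : c ∉ E) :
    Twist (K.rel E) (K.fst c) (K.snd c) (parity k (K.rel E) Z) :=
  twist_parity (h.not_rel hE hc) (h.saturated E hE hc) h.fst_not_mem h.snd_mem

theorem section_mul_arrow {S : Finset ι × (P → Bool)} (hS : W S.1) (hc : c ∈ S.1)
    (hi : Inv (K.rel S.1) S.2) :
    (K.bridgeSection k c * K.arrow k c) S = Pi.single S 1 := by
  have hn := Finset.notMem_erase c S.1
  unfold bridgeSection arrow
  rw [block_mul]
  refine block_row_eq_single ⟨hc, hn⟩ (Finset.insert_erase hc) ?_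
  have e := h.rel_eq hS hc
  simp only [Finset.insert_erase hc]
  rw [Matrix.smul_mul, Matrix.mul_smul, smul_smul, unit_mul_self, one_smul, e]
  exact mergeSection_mul_edge (h.not_rel (h.erase_mem _ hS) hn) (e ▸ hi)

theorem split_mul_arrow {S : Finset ι × (P → Bool)} (hS : W S.1) (hc : c ∈ S.1)
    (hi : Inv (K.rel S.1) S.2) : (K.bridgeSplit k c Z * K.arrow k c) S = 0 := by
  have hn := Finset.notMem_erase c S.1
  unfold bridgeSplit arrow
  rw [block_mul]
  refine block_row_eq_zero ?_
  have e := h.rel_eq hS hc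
  simp only [Finset.insert_erase hc]
  rw [Matrix.smul_mul, Matrix.mul_smul, smul_smul, unit_mul_self, one_smul, e]
  exact edge_split_twist_mul_edge (h.not_rel (h.erase_mem _ hS) hn) (h.twist (h.erase_mem _ hS) hn) (e ▸ hi)

theorem split_mul_retract {S : Finset ι × (P → Bool)} (hS : W S.1) (hc : c ∈ S.1)
    (hi : Inv (K.rel S.1) S.2) :
    (K.bridgeSplit k c Z * K.bridgeRetract k c Z) S = Pi.single S 1 := by
  have hn := Finset.notMem_erase c S.1
  unfold bridgeSplit bridgeRetract
  rw [block_mul]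
  refine block_row_eq_single ⟨hc, hn⟩ (Finset.insert_erase hc) ?_
  have e := h.rel_eq hS hc
  rw [Matrix.smul_mul, Matrix.mul_smul, smul_smul, unit_mul_self, one_smul, e]
  exact edge_split_mul_splitRetract (h.not_rel (h.erase_mem _ hS) hn) (h.twist (h.erase_mem _ hS) hn)
    (e ▸ hi)

theorem arrow_mul_section_add {S : Finset ι × (P → Bool)} (hS : W S.1) (hc : c ∉ S.1)
    (hi : Inv (K.rel S.1) S.2) :
    (K.arrow k c * K.bridgeSection k c + K.bridgeRetract k c Z * K.bridgeSplit k c Z) S =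
      Pi.single S 1 := by
  unfold bridgeSplit bridgeRetract bridgeSection arrow
  rw [block_mul, block_mul, block_add]
  refine block_row_eq_single ⟨hc, Finset.mem_insert_self _ _⟩ (Finset.erase_insert hc) ?_
  simp only [Finset.erase_insert hc]
  rw [Matrix.smul_mul, Matrix.mul_smul, smul_smul, unit_mul_self, one_smul, Matrix.smul_mul,
    Matrix.mul_smul, smul_smul, unit_mul_self, one_smul, h.rel_insert hS hc (h.insert_mem _ hS)]
  exact edge_mul_mergeSection_add (h.not_rel hS hc) (h.twist hS hc) hi

theorem supp_section {n T : ℤ} {x : Finset ι × (P → Bool) → k}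
    (hx : K.Supp (fun E => W E ∧ c ∈ E) n T x) :
    K.Supp (fun E => W E ∧ c ∉ E) (n - 1) (T - 1) (x ᵥ* K.bridgeSection k c) := by
  intro S' hS'
  obtain ⟨S, h1, h2⟩ := exists_of_vecMul_ne_zero hS'
  obtain ⟨hc, e, hA⟩ := block_ne_zero h2
  obtain ⟨⟨hW, -⟩, hi, hn, hT⟩ := hx S h1
  have hn' := Finset.notMem_erase c S.1
  have hW' := h.erase_mem _ hW
  have er := h.rel_eq hW hc
  have hA' : S'.2 = setLabel (K.rel (S.1.erase c)) (K.fst c) false S.2 := by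
    by_contra g
    exact hA (by simp [mergeSection, g])
  rw [er] at hi hT
  have ht := tau_edge (Or.inl ⟨h.not_rel hW' hn', rfl⟩) (inv_setLabel hi.of_join) hi
    (edgeRel_setLabel (h.not_rel hW' hn') hi)
  unfold HasDeg
  rw [e, hA', Finset.card_erase_of_mem hc]
  refine ⟨⟨hW', hn'⟩, inv_setLabel hi.of_join, ?_, by omega⟩
  have : 0 < S.1.card := Finset.card_pos.2 ⟨c, hc⟩
  omega

theorem supp_split {n T : ℤ} {x : Finset ι × (P → Bool) → k}
    (hx : K.Supp (fun E => W E ∧ c ∈ E) n T x) :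
    K.Supp (fun E => W E ∧ c ∉ E) (n - 1) (T + 1) (x ᵥ* K.bridgeSplit k c Z) := by
  intro S' hS'
  obtain ⟨S, h1, h2⟩ := exists_of_vecMul_ne_zero hS'
  obtain ⟨hc, e, hA⟩ := block_ne_zero h2
  obtain ⟨⟨hW, -⟩, hi, hn, hT⟩ := hx S h1
  have hn' := Finset.notMem_erase c S.1
  have hW' := h.erase_mem _ hW
  have er := h.rel_eq hW hc
  rw [Matrix.smul_apply, Matrix.mul_diagonal] at hA
  have hA' : Inv (K.rel S.1) S.2 ∧ Inv (K.rel (S.1.erase c)) S'.2 ∧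
      EdgeRel (K.rel S.1) (K.fst c) (K.snd c) S.2 S'.2 := by
    by_contra g
    exact hA (by simp [edge, g])
  have ht := tau_edge (Or.inr ⟨h.not_rel hW' hn', er⟩) hA'.1 hA'.2.1 hA'.2.2
  unfold HasDeg
  rw [e, Finset.card_erase_of_mem hc]
  refine ⟨⟨hW', hn'⟩, hA'.2.1, ?_, by omega⟩
  have : 0 < S.1.card := Finset.card_pos.2 ⟨c, hc⟩
  omega

theorem supp_retract {n T : ℤ} {x : Finset ι × (P → Bool) → k}
    (hx : K.Supp (fun E => W E ∧ c ∉ E) n T x) :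
    K.Supp (fun E => W E ∧ c ∈ E) (n + 1) (T - 1) (x ᵥ* K.bridgeRetract k c Z) := by
  intro S' hS'
  obtain ⟨S, h1, h2⟩ := exists_of_vecMul_ne_zero hS'
  obtain ⟨hc, e, hA⟩ := block_ne_zero h2
  obtain ⟨⟨hW, -⟩, hi, hn, hT⟩ := hx S h1
  have er := h.rel_insert hW hc (h.insert_mem _ hW)
  rw [Matrix.smul_apply, Matrix.diagonal_mul] at hA
  have hA' : S.2 (K.fst c) = true ∧
      S'.2 = mergeLabel (K.rel S.1) (K.fst c) (K.snd c) (S.2 (K.snd c)) S.2 := by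
    by_contra g
    exact hA (by simp [splitRetract, g])
  have ht := tau_edge (Or.inr ⟨h.not_rel hW hc, rfl⟩) (inv_mergeLabel hi) hi
    (edgeRel_mergeLabel hA'.1)
  unfold HasDeg
  rw [e, hA'.2, er, Finset.card_insert_of_notMem hc]
  refine ⟨⟨h.insert_mem _ hW, Finset.mem_insert_self _ _⟩, inv_mergeLabel hi, ?_, by omega⟩
  push_cast
  omega

/-- `bridgeSplit` anticommutes with the arrows at the other crossings. -/
theorem split_mul_arrow_anticomm {c' : ι} (hcc : c' ≠ c) {R S : Finset ι × (P → Bool)}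
    (hR : W R.1) (hS : W S.1) :
    (K.bridgeSplit k c Z * K.arrow k c') R S = -(K.arrow k c' * K.bridgeSplit k c Z) R S := by
  unfold bridgeSplit arrow
  rw [block_mul, block_mul]
  unfold block
  by_cases hc : c ∈ R.1
  swap
  · simp [hc, hcc.symm]
  by_cases hc' : c' ∈ R.1
  · simp [hc', hcc]
  have hG : c' ∉ R.1.erase c := fun e => hc' (Finset.mem_of_mem_erase e)
  have ei : (insert c' R.1).erase c = insert c' (R.1.erase c) :=
    Finset.erase_insert_of_ne hcc
  have hc2 : c ∈ insert c' R.1 := Finset.mem_insert_of_mem hc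
  by_cases eS : S.1 = insert c' (R.1.erase c)
  swap
  · simp [ei, eS]
  rw [if_pos ⟨⟨hc, hG⟩, eS⟩, if_pos ⟨⟨hc', hc2⟩, eS.trans ei.symm⟩]
  beta_reduce
  rw [ei]
  set G := R.1.erase c with hGdef
  have hcG : c ∉ G := Finset.notMem_erase c R.1
  have eR : R.1 = insert c G := (Finset.insert_erase hc).symm
  have hWG : W G := h.erase_mem _ hR
  have hWG' : W (insert c' G) := eS ▸ hS
  have hcG' : c ∉ insert c' G := by simp [hcc.symm, hcG]
  have e1 := h.rel_insert hWG hG hWG'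
  -- merging preserves the parity
  have hpar : Matrix.diagonal (parity k (K.rel G) Z) *
      edge k (K.rel G) (K.rel (insert c' G)) (K.fst c') (K.snd c') =
      edge k (K.rel G) (K.rel (insert c' G)) (K.fst c') (K.snd c') *
        Matrix.diagonal (parity k (K.rel (insert c' G)) Z) := by
    funext l l'
    rw [Matrix.diagonal_mul, Matrix.mul_diagonal]
    by_cases g : Inv (K.rel G) l ∧ Inv (K.rel (insert c' G)) l' ∧
        EdgeRel (K.rel G) (K.fst c') (K.snd c') l l'
    · have sat := h.saturated _ hWG' hcG'
      rw [e1] at g sat ⊢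
      rw [parity_edge_merge (h.merge _ hWG c' hG hWG') sat g.1 g.2.1 g.2.2, mul_comm]
    · simp [edge, g]
  -- The square starts at `insert c G` and uses the edges at `c` backwards. A flip read backwards is
  -- again a flip, so the same commutation applies to splits against the direction of the cube.
  have hsq := edge_mul_edge_comm (k := k) (r := K.rel (insert c G)) (r₁ := K.rel G)
    (r₂ := K.rel (insert c' (insert c G))) (r₁₂ := K.rel (insert c' G))
    (K.flip G c hcG).symm (K.flip _ c' (by rw [← eR]; exact hc')) (K.flip G c' hG)
    (by rw [Finset.insert_comm]; exact (K.flip _ c hcG').symm)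
  have hu := K.unit_comm k hcc.symm hcG hG
  have hA : (K.unit k G c • (edge k (K.rel R.1) (K.rel G) (K.fst c) (K.snd c) *
        Matrix.diagonal (parity k (K.rel G) Z))) *
      (K.unit k G c' • edge k (K.rel G) (K.rel (insert c' G)) (K.fst c') (K.snd c')) =
      -((K.unit k R.1 c' • edge k (K.rel R.1) (K.rel (insert c' R.1)) (K.fst c') (K.snd c')) *
        (K.unit k (insert c' G) c •
          (edge k (K.rel (insert c' R.1)) (K.rel (insert c' G)) (K.fst c) (K.snd c) *
            Matrix.diagonal (parity k (K.rel (insert c' G)) Z)))) := by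
    rw [Matrix.smul_mul, Matrix.mul_smul, Matrix.smul_mul, Matrix.mul_smul, smul_smul, smul_smul,
      Matrix.mul_assoc, hpar, ← Matrix.mul_assoc, ← Matrix.mul_assoc, eR, hsq, ← neg_smul]
    congr 1
    -- Since signs are their own inverses, the sign rule for the square carries over to the reversed
    -- edges.
    have s1 := K.unit_mul_self k G c
    have s2 := K.unit_mul_self k (insert c' G) c
    linear_combination (K.unit k G c * K.unit k (insert c' G) c) * hu -
      (K.unit k (insert c G) c' * K.unit k (insert c' G) c) * s1 +
      (- K.unit k G c * K.unit k G c') * s2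
  exact congrFun (congrFun hA R.2) S.2

/-- Arrows at other crossings anticommute with the split. The two terms with the arrow at `c` vanish
separately: the split lands in the kernel of that arrow, and that arrow is zero where `c` already
has a negative marker. -/
theorem split_diff {n T : ℤ} {z : Finset ι × (P → Bool) → k}
    (hz : K.Supp (fun E => W E ∧ c ∈ E) n T z) {S : Finset ι × (P → Bool)} (hS : W S.1) :
    ((z ᵥ* K.bridgeSplit k c Z) ᵥ* K.diff k) S =
      -((z ᵥ* K.diff k) ᵥ* K.bridgeSplit k c Z) S := by
  have e1 : z ᵥ* (K.bridgeSplit k c Z * K.arrow k c) = 0 :=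
    vecMul_eq_zero_of_rows fun R hR => h.split_mul_arrow (hz R hR).1.1 (hz R hR).1.2 (hz R hR).2.1
  have e2 : z ᵥ* (K.arrow k c * K.bridgeSplit k c Z) = 0 := by
    rw [← Matrix.vecMul_vecMul]
    have : z ᵥ* K.arrow k c = 0 := by
      funext S'
      refine vecMul_eq_zero_of fun R hR => ?_
      by_contra g
      exact (K.arrow_ne_zero g).1 (hz R hR).1.2
    rw [this, Matrix.zero_vecMul]
  rw [Matrix.vecMul_vecMul, Matrix.vecMul_vecMul]
  unfold diff
  rw [Finset.mul_sum, Finset.sum_mul]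
  simp only [Matrix.vecMul_eq_sum, Finset.sum_apply, Pi.smul_apply, smul_eq_mul]
  rw [← Finset.sum_neg_distrib]
  simp only [Matrix.sum_apply, Finset.mul_sum]
  simp only [← Finset.sum_neg_distrib]
  conv_lhs => rw [Finset.sum_comm]
  conv_rhs => rw [Finset.sum_comm]
  refine Finset.sum_congr rfl fun c' _ => ?_
  by_cases hcc : c' = c
  · subst hcc
    have f1 := congrFun e1 S
    have f2 := congrFun e2 S
    simp only [Matrix.vecMul_eq_sum, Finset.sum_apply, Pi.smul_apply, smul_eq_mul,
      Pi.zero_apply] at f1 f2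
    rw [Finset.sum_neg_distrib, f1, f2, neg_zero]
  · refine Finset.sum_congr rfl fun R _ => ?_
    by_cases g : z R = 0
    · simp [g]
    · rw [h.split_mul_arrow_anticomm hcc (hz R g).1.1 hS, mul_neg]

/-- At a bridge, the homology embeds into the homology of the part with the bridge contracted. -/
theorem exact {n T : ℤ} (hE : K.Exact k (fun E => W E ∧ c ∈ E) (n + 1) (T - 1)) :
    K.Exact k W n T := by
  intro x hx hdx
  set xm := res (fun E => W E ∧ c ∈ E) x with hxm
  have hxms : K.Supp (fun E => W E ∧ c ∈ E) n T xm := by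
    intro S g
    unfold xm res at g
    split_ifs at g with g'
    · exact ⟨g', (hx S g).2⟩
    · exact absurd rfl g
  -- The arrow at `c` maps onto the part over `c ∈ E`; subtracting the boundary of `y₀` clears that
  -- part of `x`.
  set y₀ := xm ᵥ* K.bridgeSection k c with hy₀
  have hy₀s := h.supp_section hxms
  have hy₀W : K.Supp W (n - 1) (T - 1) y₀ := hy₀s.mono fun E g => g.1
  -- over the vertices containing `c` only the arrow at `c` matters
  have arrow_only : ∀ (n T : ℤ) (u : Finset ι × (P → Bool) → k),
      K.Supp (fun E => W E ∧ c ∉ E) n T u → ∀ S : Finset ι × (P → Bool), c ∈ S.1 →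
      (u ᵥ* K.diff k) S = (u ᵥ* K.arrow k c) S := by
    intro n T u hu S hS
    rw [← sub_eq_zero, ← Pi.sub_apply, ← Matrix.vecMul_sub]
    refine vecMul_eq_zero_of fun R hR => ?_
    have hcR := (hu R hR).1.2
    unfold diff
    rw [← Finset.add_sum_erase _ _ (Finset.mem_univ c), add_sub_cancel_left, Matrix.sum_apply]
    refine Finset.sum_eq_zero fun c' hc' => ?_
    by_contra g
    obtain ⟨-, e, -⟩ := K.arrow_ne_zero g
    rw [e, Finset.mem_insert] at hS
    exact hS.elim (fun e => (Finset.mem_erase.1 hc').1 e.symm) hcR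
  have hy₀c : ∀ S : Finset ι × (P → Bool), W S.1 → c ∈ S.1 → (y₀ ᵥ* K.diff k) S = x S := by
    intro S hS hc
    rw [arrow_only _ _ _ hy₀s S hc, Matrix.vecMul_vecMul, vecMul_eq_self_of fun R hR =>
      h.section_mul_arrow (hxms R hR).1.1 (hxms R hR).1.2 (hxms R hR).2.1, hxm,
      res_apply_of (W := fun E => W E ∧ c ∈ E) ⟨hS, hc⟩]
  set x₁ := x - res W (y₀ ᵥ* K.diff k) with hx₁
  have hx₁s : K.Supp (fun E => W E ∧ c ∉ E) n T x₁ := by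
    intro S g
    have hW : W S.1 := by
      by_contra hW
      have : x S = 0 := by
        by_contra e
        exact hW (hx S e).1
      exact g (by simp [hx₁, res, hW, this])
    refine ⟨⟨hW, fun hc => g ?_⟩, ?_⟩
    · simp [hx₁, res, hW, hy₀c S hW hc]
    · by_cases e : x S = 0
      · exact hy₀W.hasDeg_vecMul (k := k) (by simpa [hx₁, res, hW, e] using g)
      · exact (hx S e).2
  have hdx₁ : ∀ S : Finset ι × (P → Bool), W S.1 → (x₁ ᵥ* K.diff k) S = 0 := by
    intro S hS
    rw [hx₁, Matrix.sub_vecMul, Pi.sub_apply, hdx S hS, vecMul_res_vecMul h.convex hy₀W hS,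
      sub_zero]
  have hx₁c : x₁ ᵥ* K.arrow k c = 0 := by
    funext S
    by_cases hS : W S.1 ∧ c ∈ S.1
    · rw [← arrow_only _ _ _ hx₁s S hS.2, hdx₁ S hS.1]
      rfl
    · refine vecMul_eq_zero_of fun R hR => ?_
      by_contra g
      obtain ⟨-, e, -⟩ := K.arrow_ne_zero g
      refine hS ?_
      rw [e]
      exact ⟨h.insert_mem _ (hx₁s R hR).1.1, Finset.mem_insert_self _ _⟩
  -- The cycle `x₁` is killed by the arrow at `c`, so it is the image of `z` under the split, and
  -- injectivity of the split makes `z` a cycle over the contracted face.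
  set z := x₁ ᵥ* K.bridgeRetract k c Z with hz
  have hzs : K.Supp (fun E => W E ∧ c ∈ E) (n + 1) (T - 1) z := h.supp_retract hx₁s
  have hzx : z ᵥ* K.bridgeSplit k c Z = x₁ := by
    have := vecMul_eq_self_of (x := x₁) fun R hR =>
      h.arrow_mul_section_add (k := k) (hx₁s R hR).1.1 (hx₁s R hR).1.2 (hx₁s R hR).2.1
    rw [Matrix.vecMul_add, ← Matrix.vecMul_vecMul, hx₁c, Matrix.zero_vecMul, zero_add,
      ← Matrix.vecMul_vecMul] at this
    exact this
  -- only the vertex `insert c S.1` contributes to `bridgeSplit` at `S`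
  have split_local : ∀ (u v : Finset ι × (P → Bool) → k) (S : Finset ι × (P → Bool)), W S.1 →
      (∀ R : Finset ι × (P → Bool), W R.1 → c ∈ R.1 → u R = v R) →
      (u ᵥ* K.bridgeSplit k c Z) S = (v ᵥ* K.bridgeSplit k c Z) S := by
    intro u v S hS huv
    rw [← sub_eq_zero, ← Pi.sub_apply, ← Matrix.sub_vecMul]
    refine vecMul_eq_zero_of fun R hR => ?_
    by_contra g
    obtain ⟨hc, e, -⟩ := block_ne_zero g
    refine hR (sub_eq_zero.2 (huv R ?_ hc))
    rw [← Finset.insert_erase hc, ← e]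
    exact h.insert_mem _ hS
  have hdz : ∀ S : Finset ι × (P → Bool), W S.1 ∧ c ∈ S.1 → (z ᵥ* K.diff k) S = 0 := by
    set v := res (fun E => W E ∧ c ∈ E) (z ᵥ* K.diff k) with hv
    have hvs : K.Supp (fun E => W E ∧ c ∈ E) (n + 1 + 1) (T - 1 + 1) v := by
      intro S g
      unfold v res at g
      split_ifs at g with g'
      · refine ⟨g', ?_⟩
        refine Supp.hasDeg_vecMul (k := k) (W := fun E => W E ∧ c ∈ E) (x := z) ?_ g
        simpa using hzs
      · exact absurd rfl g
    have hv0 : v ᵥ* K.bridgeSplit k c Z = 0 := by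
      funext S
      by_cases hS : W S.1
      · rw [split_local v (z ᵥ* K.diff k) S hS fun R hR hc => by
          rw [hv, res_apply_of (W := fun E => W E ∧ c ∈ E) ⟨hR, hc⟩]]
        have := h.split_diff hzs hS
        rw [hzx, hdx₁ S hS] at this
        simpa using this.symm
      · by_contra g
        exact hS (h.supp_split hvs S g).1.1
    have hv' : v = 0 := by
      have := vecMul_eq_self_of (x := v) fun R hR =>
        h.split_mul_retract (k := k) (hvs R hR).1.1 (hvs R hR).1.2 (hvs R hR).2.1
      rw [← Matrix.vecMul_vecMul, hv0, Matrix.zero_vecMul] at this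
      exact this.symm
    intro S hS
    have := congrFun hv' S
    rwa [hv, res_apply_of (W := fun E => W E ∧ c ∈ E) hS] at this
  obtain ⟨w, hw, hwz⟩ := hE z hzs hdz
  have hws := h.supp_split hw
  -- The minus sign appears because the split anticommutes with the differential.
  refine ⟨y₀ - w ᵥ* K.bridgeSplit k c Z, ?_, ?_⟩
  · have e1 : n + 1 - 1 - 1 = n - 1 := by ring
    have e2 : T - 1 - 1 + 1 = T - 1 := by ring
    rw [e1, e2] at hws
    have := hy₀W.add (hws.mono fun E g => g.1).neg
    rwa [← sub_eq_add_neg] at this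
  · intro S hS
    rw [Matrix.sub_vecMul, Pi.sub_apply, h.split_diff hw hS,
      split_local (w ᵥ* K.diff k) z S hS fun R hR hc => hwz R ⟨hR, hc⟩, hzx, hx₁, Pi.sub_apply,
      res_apply_of hS]
    ring

end IsBridge

end StateCube

end CircleCalculus

namespace CircleCalculus

set_option linter.unusedSectionVars false

variable {P : Type*}

theorem neg_card_le_tau [Fintype P] (r : Setoid P) (l : P → Bool) :
    -(Nat.card (Quotient r) : ℤ) ≤ tau r l := by
  classical
  rw [← classSum_one, tau, classSum, classSum, ← Finset.sum_neg_distrib]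
  refine Finset.sum_le_sum fun q _ => ?_
  unfold signOf
  split_ifs <;> norm_num

namespace StateCube

variable {ι : Type*} [Fintype ι] [DecidableEq ι] [Fintype P] [DecidableEq P]
variable (K : StateCube ι P) {k : Type*} [CommRing k]

/-! ### Vanishing on faces of the cube -/

/-- The vertices of the face in which the crossings in `F` are free, those in `E₀` have negative
marker and all others positive marker. -/
def face (E₀ F : Finset ι) (E : Finset ι) : Prop := E₀ ⊆ E ∧ E ⊆ E₀ ∪ F

/-- The connected components of the diagram in which the crossings outside `F` are smoothed. -/
def span (E₀ F : Finset ι) : Setoid P :=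
  K.rel E₀ ⊔ F.sup fun c => join ⊥ (K.fst c) (K.snd c)

theorem span_insert (E₀ F : Finset ι) (c : ι) :
    K.span E₀ (insert c F) = join (K.span E₀ F) (K.fst c) (K.snd c) := by
  rw [join_eq_sup, span, span, Finset.sup_insert, sup_assoc, sup_comm (join ⊥ _ _)]

/-- Once the two strands at `c` are joined, it no longer matters how `c` was smoothed. -/
theorem join_span_insert {E₀ : Finset ι} (F : Finset ι) {c : ι} (hc : c ∉ E₀) :
    join (K.span (insert c E₀) F) (K.fst c) (K.snd c) =
      join (K.span E₀ F) (K.fst c) (K.snd c) := by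
  have h := (K.flip E₀ c hc).join_eq
  rw [join_eq_sup, join_eq_sup (K.rel (insert c E₀))] at h
  rw [join_eq_sup, join_eq_sup (K.span E₀ F), span, span, sup_assoc, sup_assoc,
    sup_comm (F.sup _), ← sup_assoc, ← sup_assoc, h]

/-- Turning the marker at a free crossing changes circles only within the join of its two strands,
and these are already in one component. -/
theorem rel_le_span {E₀ F E : Finset ι} (h : face E₀ F E) : K.rel E ≤ K.span E₀ F := by
  have key : ∀ G ⊆ F, K.rel (E₀ ∪ G) ≤ K.span E₀ F := by
    intro G
    induction G using Finset.induction_on with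
    | empty => intro _; rw [Finset.union_empty]; exact le_sup_left
    | insert c G _ ih =>
      intro hG
      have hc : c ∈ F := hG (Finset.mem_insert_self _ _)
      have ih := ih ((Finset.subset_insert _ _).trans hG)
      by_cases hcE : c ∈ E₀ ∪ G
      · rwa [Finset.union_insert, Finset.insert_eq_of_mem hcE]
      · rw [Finset.union_insert]
        refine (le_join _ (K.fst c) (K.snd c)).trans ?_
        rw [← (K.flip _ c hcE).join_eq, join_le_iff]
        refine ⟨ih, ?_⟩
        have := Finset.le_sup (f := fun c => join (⊥ : Setoid P) (K.fst c) (K.snd c)) hc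
        exact (this.trans le_sup_right : _ ≤ K.span E₀ F) (join_rel _ _ _)
  have e : E = E₀ ∪ (E \ E₀) := (Finset.union_sdiff_of_subset h.1).symm
  rw [e]
  refine key _ ?_
  intro c hc
  rw [Finset.mem_sdiff] at hc
  exact (Finset.mem_union.1 (h.2 hc.1)).resolve_left hc.2

theorem convex_face (E₀ F : Finset ι) : Convex (face E₀ F) := fun _ _ _ _ _ h h' =>
  ⟨h.1.trans (Finset.subset_insert _ _), (Finset.subset_insert _ _).trans h'.2⟩

theorem face_insert_iff {E₀ F : Finset ι} {c : ι} (hc : c ∈ F) (E : Finset ι) :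
    face (insert c E₀) (F.erase c) E ↔ face E₀ F E ∧ c ∈ E := by
  unfold face
  rw [Finset.insert_subset_iff]
  have : insert c E₀ ∪ F.erase c = E₀ ∪ F := by
    rw [Finset.insert_union, ← Finset.union_insert, Finset.insert_erase hc]
  rw [this]
  tauto

theorem face_erase_iff {E₀ F : Finset ι} {c : ι} (hc : c ∉ E₀) (E : Finset ι) :
    face E₀ (F.erase c) E ↔ face E₀ F E ∧ c ∉ E := by
  unfold face
  constructor
  · rintro ⟨h1, h2⟩
    refine ⟨⟨h1, h2.trans (Finset.union_subset_union_right (Finset.erase_subset _ _))⟩, ?_⟩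
    intro h
    simpa [hc] using h2 h
  · rintro ⟨⟨h1, h2⟩, h3⟩
    refine ⟨h1, fun x hx => ?_⟩
    have : x ≠ c := fun e => h3 (e ▸ hx)
    simpa [this] using h2 hx

/-- Each free crossing has its two strands in different components as soon as it alone is smoothed
positively. Circles stay within components, so every edge of the face is a merge. The set `Z` is the
component of one strand after this smoothing at `c`. -/
theorem isBridge_face {E₀ F : Finset ι} (hd : Disjoint E₀ F)
    (hbad : ∀ c ∈ F, ¬ K.span E₀ (F.erase c) (K.fst c) (K.snd c)) {c : ι} (hc : c ∈ F) :
    IsBridge K (face E₀ F) c fun p => K.span E₀ (F.erase c) p (K.snd c) where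
  convex := convex_face E₀ F
  insert_mem E h := ⟨h.1.trans (Finset.subset_insert _ _),
    Finset.insert_subset (Finset.mem_union_right _ hc) h.2⟩
  erase_mem E h := ⟨Finset.subset_erase.2 ⟨h.1, Finset.disjoint_right.1 hd hc⟩,
    (Finset.erase_subset _ _).trans h.2⟩
  merge E h c' hc' h' := by
    have hE₀ : c' ∉ E₀ := fun e => hc' (h.1 e)
    have hF : c' ∈ F :=
      (Finset.mem_union.1 (h'.2 (Finset.mem_insert_self _ _))).resolve_left hE₀
    exact fun e => hbad c' hF (K.rel_le_span ((face_erase_iff hE₀ E).2 ⟨h, hc'⟩) e)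
  saturated E h hcE p q hpq := by
    have : K.span E₀ (F.erase c) p q :=
      K.rel_le_span ((face_erase_iff (Finset.disjoint_right.1 hd hc) E).2 ⟨h, hcE⟩) hpq
    exact ⟨fun g => (K.span _ _).trans ((K.span _ _).symm this) g,
      fun g => (K.span _ _).trans this g⟩
  fst_not_mem := hbad c hc
  snd_mem := (K.span _ _).refl _

/-- The homology over a face vanishes below the diagonals that are determined by the number of
circles at its initial vertex and the number of connected components of the face. -/
theorem exact_face (F : Finset ι) : ∀ E₀ : Finset ι, Disjoint E₀ F → ∀ n T : ℤ,
    2 * (Nat.card (Quotient (K.span E₀ F)) : ℤ) <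
      -T - n + E₀.card + Nat.card (Quotient (K.rel E₀)) → K.Exact k (face E₀ F) n T := by
  induction hm : F.card generalizing F with
  | zero =>
    rw [Finset.card_eq_zero] at hm
    subst hm
    intro E₀ _ n T hT x hx _
    have hs : K.span E₀ ∅ = K.rel E₀ := by simp [span]
    rw [hs] at hT
    -- On a single vertex the bound asks for τ below minus the number of circles, where there are no
    -- labels.
    have hx0 : x = 0 := by
      funext S
      by_contra g
      obtain ⟨⟨h1, h2⟩, -, hn, ht⟩ := hx S g
      have e : S.1 = E₀ := Finset.Subset.antisymm (by simpa using h2) h1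
      rw [e] at hn ht
      have := neg_card_le_tau (K.rel E₀) S.2
      omega
    refine ⟨0, fun S g => absurd rfl g, fun S _ => by simp [hx0]⟩
  | succ m ih =>
    intro E₀ hd n T hT
    have hm' : ∀ c ∈ F, (F.erase c).card = m := fun c hc => by
      rw [Finset.card_erase_of_mem hc, hm]; rfl
    have hdisj : ∀ c ∈ F, Disjoint (insert c E₀) (F.erase c) := fun c hc => by
      rw [Finset.disjoint_insert_left]
      exact ⟨Finset.notMem_erase _ _, hd.mono_right (Finset.erase_subset _ _)⟩
    have hspan : ∀ c ∈ F, K.span E₀ F = join (K.span E₀ (F.erase c)) (K.fst c) (K.snd c) :=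
      fun c hc => by rw [← span_insert, Finset.insert_erase hc]
    -- the bound for the part with negative marker at `c`
    have hminus : ∀ c ∈ F, ∀ n' T' : ℤ, n' + T' = n + T →
        K.Exact k (face (insert c E₀) (F.erase c)) n' T' := by
      intro c hc n' T' hnT
      have hcE : c ∉ E₀ := Finset.disjoint_right.1 hd hc
      refine ih _ (hm' c hc) _ (hdisj c hc) _ _ ?_
      rw [Finset.card_insert_of_notMem hcE]
      have hj := K.join_span_insert (F.erase c) hcE
      rw [← hspan c hc] at hj
      -- If `c` merges circles, the extra negative marker compensates for the lost circle and the
      -- components stay the same. If it splits a circle, the right-hand side grows by two, enough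
      -- for the at most one new component.
      rcases K.flip E₀ c hcE with ⟨h1, h2⟩ | ⟨h1, h2⟩
      · have h3 := card_join h1
        rw [← h2] at h3
        have h4 : K.span (insert c E₀) (F.erase c) (K.fst c) (K.snd c) := by
          refine (le_sup_left : K.rel (insert c E₀) ≤ K.span (insert c E₀) (F.erase c)) ?_
          rw [h2]
          exact join_rel _ _ _
        rw [join_eq_self h4] at hj
        rw [hj]
        push_cast
        linarith
      · have h3 := card_join h1
        rw [← h2] at h3
        have h4 := card_join_le (K.span (insert c E₀) (F.erase c)) (K.fst c) (K.snd c)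
        rw [hj] at h4
        push_cast
        linarith
    -- Contracting a bridge keeps `n + T`, so the bound is inherited; all free crossings have to be
    -- bridges, as only then is every edge known to be a merge. Otherwise some positive smoothing
    -- keeps the components, and both half faces satisfy the bound.
    by_cases hbad : ∀ c ∈ F, ¬ K.span E₀ (F.erase c) (K.fst c) (K.snd c)
    · obtain ⟨c, hc⟩ : F.Nonempty := Finset.card_pos.1 (by omega)
      refine (K.isBridge_face hd hbad hc).exact ?_
      have e := hminus c hc (n + 1) (T - 1) (by ring)
      rwa [show face (insert c E₀) (F.erase c) = fun E => face E₀ F E ∧ c ∈ E from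
        funext fun E => propext (face_insert_iff hc E)] at e
    · push Not at hbad
      obtain ⟨c, hc, hcs⟩ := hbad
      have hcE : c ∉ E₀ := Finset.disjoint_right.1 hd hc
      refine exact_of_sub_of_quotient (W₁ := face E₀ (F.erase c))
        (W₂ := face (insert c E₀) (F.erase c)) ?_ ?_ ?_ (convex_face _ _) ?_ (hminus c hc n T rfl)
      · intro E
        rw [face_insert_iff hc, face_erase_iff hcE]
        tauto
      · intro E h1 h2
        rw [face_insert_iff hc] at h2
        rw [face_erase_iff hcE] at h1
        exact h1.2 h2.2
      · intro E c' _ h2 h1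
        rw [face_insert_iff hc] at h2
        rw [face_erase_iff hcE] at h1
        exact h1.2 (Finset.mem_insert_of_mem h2.2)
      · refine ih _ (hm' c hc) _ (hd.mono_right (Finset.erase_subset _ _)) _ _ ?_
        rwa [hspan c hc, join_eq_self hcs] at hT

variable (k) in
/-- The lower vanishing bound for the whole cube. -/
theorem exact_univ {n T : ℤ}
    (h : 2 * (Nat.card (Quotient (K.span ∅ Finset.univ)) : ℤ) <
      -T - n + Nat.card (Quotient (K.rel ∅))) : K.Exact k (fun _ => True) n T := by
  have := K.exact_face (k := k) Finset.univ ∅ (Finset.disjoint_empty_left _) n T (by simpa using h)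
  rwa [show face ∅ Finset.univ = fun _ : Finset ι => True from
    funext fun E => propext (by simp [face])] at this

/-! ### Duality -/

/-- The cube of the mirror image. -/
def dual : StateCube ι P where
  rel E := K.rel Eᶜ
  fst := K.fst
  snd := K.snd
  -- The dual edge from `E` to `insert c E` is the original edge that starts at the complement of
  -- `insert c E`, run backwards.
  sign E c := K.sign (insert c E)ᶜ c
  flip E c hc := by
    have e : insert c (insert c E)ᶜ = Eᶜ := by
      ext x
      by_cases hx : x = c
      · subst hx; simp [hc]
      · simp [hx]
    have := K.flip (insert c E)ᶜ c (by simp)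
    rw [e] at this
    exact this.symm
  sign_comm E c c' hcc hc hc' := by
    have e : ∀ a b : ι, a ≠ b → b ∉ E → insert b (insert b (insert a E))ᶜ = (insert a E)ᶜ := by
      intro a b hab hb
      ext x
      by_cases hx : x = b
      · subst hx; simp [hb, hab.symm]
      · simp [hx]
    have h := K.sign_comm (insert c' (insert c E))ᶜ c c' hcc (by simp) (by simp)
    rw [e c c' hcc hc', Finset.insert_comm, e c' c hcc.symm hc] at h
    rw [Finset.insert_comm c c' E] at h ⊢
    rw [mul_comm, mul_comm (K.sign (insert c' E)ᶜ c'), h, neg_neg]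

/-- The basis element of the dual cube that corresponds to a basis element. -/
def dualIndex (S : Finset ι × (P → Bool)) : Finset ι × (P → Bool) := (S.1ᶜ, fun p => !S.2 p)

theorem dualIndex_dualIndex (S : Finset ι × (P → Bool)) : dualIndex (dualIndex S) = S := by
  simp [dualIndex]

end StateCube

theorem inv_not {r : Setoid P} {l : P → Bool} : Inv r (fun p => !l p) ↔ Inv r l := by
  simp [Inv]

theorem tau_not [Fintype P] (r : Setoid P) (l : P → Bool) : tau r (fun p => !l p) = - tau r l := by
  classical
  simp only [tau, classSum, ← Finset.sum_neg_distrib]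
  refine Finset.sum_congr rfl fun q _ => ?_
  cases l q.out <;> simp [signOf]

/-- Exchanging `1` and `X` turns the multiplication table into the transpose of the comultiplication
table: `k[X]/X²` is a self-dual Frobenius algebra. -/
theorem edgeRel_not {r r' : Setoid P} {a b : P} (h : IsFlip r r' a b) {l l' : P → Bool} :
    EdgeRel r' a b (fun p => !l' p) (fun p => !l p) ↔ EdgeRel r a b l l' := by
  have hj : ∀ s : Setoid P, ∀ p, (¬ s p a ∧ ¬ s p b) ↔ ¬ join s a b p a := by
    intro s p
    simp only [join_apply, not_or, not_and]
    have := s.refl a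
    tauto
  have e : ∀ p, (¬ r p a ∧ ¬ r p b) ↔ (¬ r' p a ∧ ¬ r' p b) := by
    intro p
    rw [hj, hj, h.join_eq]
  unfold EdgeRel
  simp only [← and_imp, e, h.rel_iff, Bool.not_eq_eq_eq_not, Bool.not_not]
  refine and_congr (forall_congr' fun p => imp_congr_right fun _ => eq_comm) ?_
  by_cases hr : r a b
  · simp only [hr, not_true_eq_false, false_and, false_or, not_false_eq_true, true_and, or_false]
    cases l a <;> cases l' a <;> cases l' b <;> simp
  · simp only [hr, not_true_eq_false, false_and, false_or, not_false_eq_true, true_and, or_false]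
    cases l' a <;> cases l a <;> cases l b <;> simp

theorem edge_not [Fintype P] [DecidableEq P] {k : Type*} [CommRing k] {r r' : Setoid P} {a b : P}
    (h : IsFlip r r' a b) (l l' : P → Bool) :
    edge k r' r a b (fun p => !l' p) (fun p => !l p) = edge k r r' a b l l' := by
  unfold edge
  rw [edgeRel_not h, inv_not, inv_not]
  congr 1
  exact propext (by tauto)

namespace StateCube

variable {ι : Type*} [Fintype ι] [DecidableEq ι] [Fintype P] [DecidableEq P]
variable (K : StateCube ι P)

theorem dual_arrow (k : Type*) [CommRing k] (c : ι) (S S' : Finset ι × (P → Bool)) :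
    K.dual.arrow k c (dualIndex S') (dualIndex S) = K.arrow k c S S' := by
  unfold arrow block
  have hiff : (c ∉ (dualIndex S').1 ∧ (dualIndex S).1 = insert c (dualIndex S').1) ↔
      (c ∉ S.1 ∧ S'.1 = insert c S.1) := by
    simp only [dualIndex, Finset.mem_compl, not_not]
    constructor
    · rintro ⟨h1, h2⟩
      have h3 : ∀ x, x ∉ S.1 ↔ x = c ∨ x ∉ S'.1 := fun x => by
        rw [← Finset.mem_compl, h2, Finset.mem_insert, Finset.mem_compl]
      refine ⟨(h3 c).2 (Or.inl rfl), ?_⟩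
      ext x
      have := h3 x
      rw [Finset.mem_insert]
      by_cases hx : x = c
      · subst hx; simp [h1]
      · tauto
    · rintro ⟨h1, h2⟩
      refine ⟨by simp [h2], ?_⟩
      ext x
      by_cases hx : x = c
      · subst hx; simp [h1]
      · simp [h2, hx]
  by_cases h : c ∉ S.1 ∧ S'.1 = insert c S.1
  · rw [if_pos h, if_pos (hiff.2 h)]
    have h2 := (hiff.2 h).2
    simp only [dual, unit] at h2 ⊢
    rw [Matrix.smul_apply, Matrix.smul_apply, ← h2]
    have fl := K.flip S.1 c h.1
    rw [← h.2] at fl ⊢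
    simp only [dualIndex, compl_compl]
    rw [edge_not fl]
  · rw [if_neg h, if_neg (fun g => h (hiff.1 g))]

theorem dual_diff (k : Type*) [CommRing k] (S S' : Finset ι × (P → Bool)) :
    K.dual.diff k (dualIndex S') (dualIndex S) = K.diff k S S' := by
  simp only [diff, Matrix.sum_apply, dual_arrow]

theorem hasDeg_dual (S : Finset ι × (P → Bool)) (n T : ℤ) :
    K.dual.HasDeg (dualIndex S) (Fintype.card ι - n) (-T) ↔ K.HasDeg S n T := by
  simp only [HasDeg, dual, dualIndex, compl_compl, inv_not, tau_not, Finset.card_compl, neg_inj]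
  refine and_congr_right fun _ => and_congr_left fun _ => ?_
  have := Finset.card_le_univ S.1
  rw [Nat.cast_sub this]
  constructor <;> intro h <;> linarith

/-- Over a field, vanishing of the homology of the dual cube implies that of the homology. -/
theorem exact_of_dual {k : Type*} [Field k] {n T : ℤ}
    (h : K.dual.Exact k (fun _ => True) (Fintype.card ι - n) (-T)) :
    K.Exact k (fun _ => True) n T := by
  classical
  intro x hx hdx
  have hdx0 : x ᵥ* K.diff k = 0 := funext fun S => hdx S trivial
  let V : Submodule k (Finset ι × (P → Bool) → k) :=
    { carrier := {y | K.Supp (fun _ => True) (n - 1) (T - 1) y}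
      add_mem' := by
        intro y z h1 h2
        rw [Set.mem_ofPred_eq] at h1 h2 ⊢
        exact h1.add h2
      zero_mem' := fun S g => absurd rfl g
      smul_mem' := fun a y hy S g => hy S (fun e => g (by simp [e])) }
  by_cases hmem : x ∈ V.map (Matrix.vecMulLinear (K.diff k))
  · obtain ⟨y, hy, e⟩ := hmem
    exact ⟨y, hy, fun S _ => congrFun e S⟩
  exfalso
  -- Here a field is needed: some functional kills the boundaries but not `x`. Its part in degree
  -- `(n, T)` is a cocycle, hence a cycle of the dual cube.
  obtain ⟨f, hf, hV⟩ := Submodule.exists_le_ker_of_notMem hmem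
  have hV' : ∀ y ∈ V, f (y ᵥ* K.diff k) = 0 := fun y hy =>
    hV (Submodule.mem_map_of_mem (f := Matrix.vecMulLinear (K.diff k)) hy)
  set v : Finset ι × (P → Bool) → k := fun S => f (Pi.single S 1) with hv
  have hfv : ∀ u, f u = u ⬝ᵥ v := by
    intro u
    rw [LinearMap.pi_apply_eq_sum_univ f u, dotProduct]
    refine Finset.sum_congr rfl fun S _ => ?_
    rw [hv, smul_eq_mul]
    congr 2
    funext S'
    simp [Pi.single_apply, eq_comm]
  set v' : Finset ι × (P → Bool) → k := fun S => if K.HasDeg S n T then v S else 0 with hv'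
  have hmul : ∀ (g : Finset ι × (P → Bool) → k) (S),
      ((fun R => g (dualIndex R)) ᵥ* K.dual.diff k) (dualIndex S) = (K.diff k *ᵥ g) S := by
    intro g S
    rw [Matrix.vecMul, Matrix.mulVec, dotProduct, dotProduct]
    refine Fintype.sum_equiv ⟨dualIndex, dualIndex, dualIndex_dualIndex, dualIndex_dualIndex⟩ _ _ ?_
    intro R
    simp only [Equiv.coe_fn_mk]
    rw [← K.dual_diff k S (dualIndex R), dualIndex_dualIndex, mul_comm]
  have hDv : K.diff k *ᵥ v' = 0 := by
    funext S
    by_cases hS : K.HasDeg S (n - 1) (T - 1)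
    · have h1 := hV' (Pi.single S 1) (fun S' g => by
        have : S' = S := by
          by_contra e
          exact g (by simp [e])
        subst this
        exact ⟨trivial, hS⟩)
      rw [hfv, single_vecMul_row] at h1
      rw [Pi.zero_apply, ← h1, Matrix.mulVec, dotProduct, dotProduct]
      refine Finset.sum_congr rfl fun S' _ => ?_
      by_cases g : K.diff k S S' = 0
      · simp [g]
      · rw [hv']
        simp only [(K.hasDeg_of_diff_ne_zero g).1 hS, if_true]
    · rw [Matrix.mulVec, dotProduct]
      refine Finset.sum_eq_zero fun S' _ => ?_
      by_cases g : K.diff k S S' = 0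
      · simp [g]
      · have : ¬ K.HasDeg S' n T := fun e => hS ((K.hasDeg_of_diff_ne_zero g).2 e)
        simp [hv', this]
  obtain ⟨w, -, hw⟩ := h (fun R => v' (dualIndex R)) (by
      intro R g
      refine ⟨trivial, ?_⟩
      have : K.HasDeg (dualIndex R) n T := by
        by_contra e
        exact g (by simp [hv', e])
      rw [← K.hasDeg_dual, dualIndex_dualIndex] at this
      exact this)
    (by
      intro R _
      have := hmul v' (dualIndex R)
      rwa [dualIndex_dualIndex, hDv] at this)
  have hDw : K.diff k *ᵥ (fun S => w (dualIndex S)) = v' := by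
    funext S
    have h1 := hmul (fun S => w (dualIndex S)) S
    simp only [dualIndex_dualIndex] at h1
    rw [← h1, hw _ trivial, dualIndex_dualIndex]
  -- The cocycle is the coboundary of `w`, so pairing it with `x` equals pairing the boundary of the
  -- cycle `x` with `w`.
  apply hf
  rw [hfv]
  have : x ⬝ᵥ v = x ⬝ᵥ v' := by
    refine Finset.sum_congr rfl fun S _ => ?_
    by_cases g : x S = 0
    · simp [g]
    · simp [hv', (hx S g).2]
  rw [this, ← hDw, Matrix.dotProduct_mulVec, hdx0, zero_dotProduct]

end StateCube

end CircleCalculus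

/-! ### Circles of an alternating diagram as cycles of a permutation. -/

/-- Composing with a transposition merges two cycles or cuts one. Follow `a` until `π` first reaches
`a` or `b`: up to then both permutations agree, and at that moment they take opposite values. Only
points of the invariant set `S` are visited. -/
theorem Equiv.Perm.sameCycle_iff_not_sameCycle_of_swap {α : Type*} [Finite α] [DecidableEq α]
    {π σ : Equiv.Perm α} {a b : α} (hab : a ≠ b) {S : α → Prop} (hS : ∀ x, S x → S (π x))
    (ha : S a) (h : ∀ x, S x → σ x = Equiv.swap a b (π x)) :
    π.SameCycle a b ↔ ¬ σ.SameCycle a b := by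
  have hex : ∃ k, 0 < k ∧ ((π ^ k) a = a ∨ (π ^ k) a = b) := by
    refine ⟨orderOf π, orderOf_pos π, Or.inl ?_⟩
    rw [pow_orderOf_eq_one]; rfl
  classical
  set k := Nat.find hex with hk
  obtain ⟨hk0, hkab⟩ := Nat.find_spec hex
  have hmin : ∀ j, 0 < j → j < k → (π ^ j) a ≠ a ∧ (π ^ j) a ≠ b := by
    intro j h0 hj
    have := Nat.find_min hex hj
    push Not at this
    exact this h0
  have hSπ : ∀ j, S ((π ^ j) a) := by
    intro j
    induction j with
    | zero => exact ha
    | succ j ih => rw [pow_succ', Equiv.Perm.mul_apply]; exact hS _ ih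
  have hσ : ∀ j, j < k → (σ ^ j) a = (π ^ j) a := by
    intro j
    induction j with
    | zero => intro _; rfl
    | succ j ih =>
      intro hj
      rw [pow_succ', Equiv.Perm.mul_apply, ih (by omega), h _ (hSπ j), ← Equiv.Perm.mul_apply π,
        ← pow_succ']
      obtain ⟨h1, h2⟩ := hmin (j + 1) (by omega) hj
      exact Equiv.swap_apply_of_ne_of_ne h1 h2
  have hσk : (σ ^ k) a = Equiv.swap a b ((π ^ k) a) := by
    obtain ⟨j, hj⟩ : ∃ j, k = j + 1 := ⟨k - 1, by omega⟩
    rw [hj, pow_succ', Equiv.Perm.mul_apply, hσ j (by omega), h _ (hSπ j),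
      ← Equiv.Perm.mul_apply π, ← pow_succ']
  -- if `ρ ^ k` fixes `a` and no smaller power takes `a` to `b`, then no power does
  have aux : ∀ ρ : Equiv.Perm α, (ρ ^ k) a = a → (∀ j, j < k → (ρ ^ j) a ≠ b) →
      ¬ ρ.SameCycle a b := by
    intro ρ h1 h2 h3
    obtain ⟨m, -, hm⟩ := h3.exists_pow_eq'
    refine h2 (m % k) (Nat.mod_lt _ hk0) ?_
    rw [← hm, ← Equiv.Perm.iterate_eq_pow, ← Equiv.Perm.iterate_eq_pow]
    refine Function.IsPeriodicPt.iterate_mod_apply (f := ρ) (n := k) (x := a) ?_ m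
    rw [Function.IsPeriodicPt, Function.IsFixedPt, Equiv.Perm.iterate_eq_pow]
    exact h1
  have hne : ∀ j, j < k → (π ^ j) a ≠ b := by
    intro j hj
    rcases Nat.eq_zero_or_pos j with rfl | h0
    · exact hab
    · exact (hmin j h0 hj).2
  rcases hkab with e | e
  · have h1 : σ.SameCycle a b := ⟨k, by rw [zpow_natCast, hσk, e, Equiv.swap_apply_left]⟩
    have h2 : ¬ π.SameCycle a b := aux π e hne
    tauto
  · have h1 : π.SameCycle a b := ⟨k, by rw [zpow_natCast, e]⟩
    have h2 : ¬ σ.SameCycle a b := by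
      refine aux σ (by rw [hσk, e, Equiv.swap_apply_right]) fun j hj => ?_
      rw [hσ j hj]
      exact hne j hj
    tauto

namespace LinkDiagram

open CircleCalculus

set_option linter.unusedSectionVars false

variable (D : LinkDiagram)

/-- Two pieces are equivalent if they lie on the same circle of `D_s`. -/
def circleSetoid (s : D.State) : Setoid D.Piece := Setoid.ker (D.circle s)

theorem circleSetoid_le {s : D.State} {t : Setoid D.Piece}
    (h : ∀ p q, D.StateAdjacent s p q → t p q) : D.circleSetoid s ≤ t := by
  intro p q e
  have := congrArg (Quot.lift (Quotient.mk t) fun p q g => Quotient.sound (h p q g)) e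
  exact Quotient.exact this

theorem circleSetoid_edge (s : D.State) (a : Dart D.N) :
    D.circleSetoid s (.inl a) (.inl (D.glue a)) := Quot.sound (.edge a)

theorem circleSetoid_smooth (s : D.State) (c : Fin D.N) (k : Fin 4) :
    D.circleSetoid s (.inl (c, k)) (.inl (c, smoothing (s c) k)) := Quot.sound (.smooth c k)

/-- Every end at a crossing lies on the circle of one of the two ends of the upper strand. -/
theorem circleSetoid_touch (s : D.State) (c : Fin D.N) (k : Fin 4) :
    D.circleSetoid s (.inl (c, k)) (.inl (c, 1)) ∨
      D.circleSetoid s (.inl (c, k)) (.inl (c, 3)) := by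
  have h := D.circleSetoid_smooth s c k
  have hr := (D.circleSetoid s).refl (.inl (c, k))
  revert h hr
  generalize s c = m
  fin_cases k <;> cases m <;> simp [smoothing] <;> tauto

/-- Gluing darts along edges, as a permutation. -/
def gluePerm : Equiv.Perm (Dart D.N) := Function.Involutive.toPerm D.glue D.glue_glue

theorem smoothing_smoothing (m : Bool) (k : Fin 4) : smoothing m (smoothing m k) = k := by
  cases m <;> fin_cases k <;> rfl

/-- Following the smoothing at each crossing, as a permutation. -/
def smoothPerm (s : D.State) : Equiv.Perm (Dart D.N) :=
  Function.Involutive.toPerm (fun a => (a.1, smoothing (s a.1) a.2)) fun a => by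
    simp [smoothing_smoothing]

/-- Walking one step along the circles of `D_s`. -/
def walk (s : D.State) : Equiv.Perm (Dart D.N) := D.smoothPerm s * D.gluePerm

theorem walk_apply (s : D.State) (a : Dart D.N) :
    D.walk s a = ((D.glue a).1, smoothing (s (D.glue a).1) (D.glue a).2) := rfl

theorem isOver_smoothing (c : Fin D.N) (m : Bool) (k : Fin 4) :
    D.IsOver (c, smoothing m k) ↔ ¬ D.IsOver (c, k) := by
  unfold IsOver
  cases m <;> fin_cases k <;> simp [smoothing]

variable {D}

theorem isOver_walk (halt : D.Alternating) (s : D.State) (a : Dart D.N) :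
    D.IsOver (D.walk s a) ↔ D.IsOver a := by
  have h1 := D.isOver_smoothing (D.glue a).1 (s (D.glue a).1) (D.glue a).2
  have h2 : D.IsOver ((D.glue a).1, (D.glue a).2) ↔ ¬ D.IsOver a := halt a
  rw [walk_apply, h1, h2, not_not]

/-- In an alternating diagram every edge has exactly one upper end, and every smoothing joins an
upper end to a lower one. The upper ends on a circle are thus visited by `walk` in one direction,
and form a single cycle. -/
theorem circleSetoid_iff_sameCycle (halt : D.Alternating) (s : D.State) {a b : Dart D.N}
    (ha : D.IsOver a) (hb : D.IsOver b) :
    D.circleSetoid s (.inl a) (.inl b) ↔ (D.walk s).SameCycle a b := by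
  classical
  constructor
  · intro h
    -- Each dart is replaced by the upper end of its edge.
    let f : D.Piece → Quotient (Equiv.Perm.SameCycle.setoid (D.walk s)) ⊕ Fin D.freeLoops :=
      Sum.map (fun x => Quotient.mk _ (if D.IsOver x then x else D.glue x)) id
    have hf : D.circleSetoid s ≤ Setoid.ker f := by
      refine D.circleSetoid_le ?_
      rintro _ _ (x | ⟨c, k⟩)
      · change f _ = f _
        simp only [f, Sum.map_inl]
        by_cases hx : D.IsOver x
        · have : ¬ D.IsOver (D.glue x) := fun e => (halt x).1 e hx
          simp [hx, this, D.glue_glue]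
        · have : D.IsOver (D.glue x) := (halt x).2 hx
          simp [hx, this]
      · change f _ = f _
        simp only [f, Sum.map_inl]
        congr 1
        by_cases hx : D.IsOver (c, k)
        · have h' : ¬ D.IsOver (c, smoothing (s c) k) := by
            rw [isOver_smoothing]; exact not_not.2 hx
          rw [if_pos hx, if_neg h']
          refine Quotient.sound ?_
          refine Equiv.Perm.SameCycle.symm ⟨1, ?_⟩
          rw [zpow_one, walk_apply, D.glue_glue]
          simp [smoothing_smoothing]
        · have h' : D.IsOver (c, smoothing (s c) k) := by
            rw [isOver_smoothing]; exact hx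
          rw [if_neg hx, if_pos h']
          refine Quotient.sound ⟨1, ?_⟩
          rw [zpow_one, walk_apply, D.glue_glue]
    have := hf h
    change f _ = f _ at this
    simp only [f, Sum.map_inl, if_pos ha, if_pos hb, Sum.inl.injEq] at this
    exact Quotient.exact this
  · intro h
    obtain ⟨m, -, rfl⟩ := h.exists_pow_eq'
    clear h hb
    induction m with
    | zero => exact (D.circleSetoid s).refl _
    | succ m ih =>
      rw [pow_succ', Equiv.Perm.mul_apply, walk_apply]
      exact (D.circleSetoid s).trans ih ((D.circleSetoid s).trans
        (D.circleSetoid_edge s _) (D.circleSetoid_smooth s _ _))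

/-- On upper ends, changing the marker at `c` composes `walk` with the transposition of the two
upper ends at `c`. A circle therefore never turns into just one other circle. -/
theorem isFlip_circleSetoid (halt : D.Alternating) {s s' : D.State} {c : Fin D.N}
    (hs : s c = true) (hs' : s' c = false) (heq : ∀ x, x ≠ c → s x = s' x) :
    IsFlip (D.circleSetoid s) (D.circleSetoid s') (.inl (c, 1)) (.inl (c, 3)) := by
  have hle : ∀ u v : D.State, (∀ x, x ≠ c → u x = v x) → D.circleSetoid u ≤
      join (D.circleSetoid v) (.inl (c, 1)) (.inl (c, 3)) := by
    intro u v huv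
    refine D.circleSetoid_le ?_
    rintro _ _ (x | ⟨x, k⟩)
    · exact Or.inl (D.circleSetoid_edge v x)
    · by_cases hx : x = c
      · subst hx
        exact Or.inr ⟨D.circleSetoid_touch v x k, D.circleSetoid_touch v x _⟩
      · rw [huv x hx]
        exact Or.inl (D.circleSetoid_smooth v x k)
  have hj : join (D.circleSetoid s) (.inl (c, 1)) (.inl (c, 3)) =
      join (D.circleSetoid s') (.inl (c, 1)) (.inl (c, 3)) :=
    le_antisymm (join_le_iff.2 ⟨hle s s' heq, join_rel _ _ _⟩)
      (join_le_iff.2 ⟨hle s' s fun x hx => (heq x hx).symm, join_rel _ _ _⟩)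
  have h1 : D.IsOver (c, 1) := Or.inl rfl
  have h3 : D.IsOver (c, 3) := Or.inr rfl
  have hxor := Equiv.Perm.sameCycle_iff_not_sameCycle_of_swap (π := D.walk s) (σ := D.walk s')
    (a := (c, 1)) (b := (c, 3)) (by simp) (S := D.IsOver)
    (fun x hx => (isOver_walk halt s x).2 hx) h1 (by
      intro x hx
      rw [walk_apply, walk_apply]
      have hg : ¬ D.IsOver (D.glue x) := fun e => (halt x).1 e hx
      revert hg
      generalize D.glue x = y
      obtain ⟨y, k⟩ := y
      intro hg
      by_cases hy : y = c
      · subst hy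
        have hk : k = 0 ∨ k = 2 := by
          unfold IsOver at hg
          revert hg
          fin_cases k <;> simp
        rcases hk with rfl | rfl
        · simp [hs, hs', smoothing]
        · simp [hs, hs', smoothing]
      · rw [heq y hy, Equiv.swap_apply_of_ne_of_ne] <;> simp [hy])
  rw [← circleSetoid_iff_sameCycle halt s h1 h3, ← circleSetoid_iff_sameCycle halt s' h1 h3] at hxor
  by_cases h : D.circleSetoid s (.inl (c, 1)) (.inl (c, 3))
  · right
    refine ⟨hxor.1 h, ?_⟩
    rw [← hj, join_eq_self h]
  · left
    have h' : D.circleSetoid s' (.inl (c, 1)) (.inl (c, 3)) := by tauto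
    refine ⟨h, ?_⟩
    rw [hj, join_eq_self h']

variable (D)

/-- The state whose negative markers are at the crossings in `E`. -/
def stateOf (E : Finset (Fin D.N)) : D.State := fun c => decide (c ∉ E)

variable {D}

/-- The cube of resolutions of an alternating diagram. -/
def cube (halt : D.Alternating) : StateCube (Fin D.N) D.Piece where
  rel E := D.circleSetoid (D.stateOf E)
  fst c := .inl (c, 1)
  snd c := .inl (c, 3)
  sign E c := (-1) ^ (E.filter fun x => c < x).card
  flip E c hc := isFlip_circleSetoid halt (by simp [stateOf, hc]) (by simp [stateOf])
    (fun x hx => by simp [stateOf, hx])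
  sign_comm E c c' hne hc hc' := by
    have key : ∀ a b : Fin D.N, a < b → a ∉ E → b ∉ E →
        (-1 : ℤˣ) ^ (E.filter fun x => a < x).card *
          (-1) ^ ((insert a E).filter fun x => b < x).card =
        -((-1) ^ (E.filter fun x => b < x).card *
          (-1) ^ ((insert b E).filter fun x => a < x).card) := by
      intro a b hab ha hb
      rw [Finset.filter_insert, if_neg (not_lt.2 hab.le), Finset.filter_insert, if_pos hab,
        Finset.card_insert_of_notMem (by simp [hb]), pow_succ]
      simp [mul_comm]
    rcases lt_or_gt_of_ne hne with h | h
    · exact key c c' h hc hc'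
    · rw [key c' c h hc' hc, neg_neg]

/-! ### Counting circles and components -/

/-- This is the checkerboard colouring. A walk around a region departs either always along upper
ends, and then it is the walk of `s₋`, or always along lower ends, and then it is the walk of `s₊`.
A loop without crossings is a circle of both states, which explains the factor 2. -/
theorem card_circles_eq_regions (halt : D.Alternating) :
    D.numCircles D.sPlus + D.numCircles D.sMinus =
      Nat.card (Quot (FaceStep D.glue)) + 2 * D.freeLoops := by
  classical
  have walk_minus : ∀ x, D.IsOver x → ((D.glue x).1, (D.glue x).2 - 1) = D.walk D.sMinus x := by
    intro x hx
    have hg : ¬ D.IsOver (D.glue x) := fun e => (halt x).1 e hx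
    rw [walk_apply]
    revert hg
    generalize D.glue x = y
    obtain ⟨y, k⟩ := y
    unfold IsOver
    fin_cases k <;> simp [smoothing, sMinus]
    rfl
  have walk_plus : ∀ x, ¬ D.IsOver x → ((D.glue x).1, (D.glue x).2 - 1) = D.walk D.sPlus x := by
    intro x hx
    have hg : D.IsOver (D.glue x) := (halt x).2 hx
    rw [walk_apply]
    revert hg
    generalize D.glue x = y
    obtain ⟨y, k⟩ := y
    unfold IsOver
    fin_cases k <;> simp [smoothing, sPlus]
  have circle_walk : ∀ s x, D.circle s (.inl (D.walk s x)) = D.circle s (.inl x) := fun s x =>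
    ((D.circleSetoid s).trans (D.circleSetoid_edge s x) (D.circleSetoid_smooth s _ _)).symm
  have walk_glue_smooth : ∀ (s : D.State) c k,
      D.walk s (D.glue (c, smoothing (s c) k)) = (c, k) := by
    intro s c k
    rw [walk_apply, D.glue_glue]
    simp [smoothing_smoothing]
  let f : Quot (FaceStep D.glue) ⊕ (Fin D.freeLoops ⊕ Fin D.freeLoops) →
      D.Circle D.sPlus ⊕ D.Circle D.sMinus :=
    Sum.elim
      (Quot.lift (fun x => if D.IsOver x then Sum.inr (D.circle D.sMinus (.inl x))
        else Sum.inl (D.circle D.sPlus (.inl x))) (by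
          rintro x y rfl
          by_cases hx : D.IsOver x
          · rw [walk_minus x hx, if_pos hx, if_pos ((isOver_walk halt _ x).2 hx), circle_walk]
          · rw [walk_plus x hx, if_neg hx, if_neg (fun e => hx ((isOver_walk halt _ x).1 e)),
              circle_walk]))
      (Sum.elim (fun i => Sum.inl (D.circle D.sPlus (.inr i)))
        (fun i => Sum.inr (D.circle D.sMinus (.inr i))))
  -- An edge lies on one circle of each state; its lower end records the region for `s₊`, its upper
  -- end the region for `s₋`.
  let g : D.Circle D.sPlus ⊕ D.Circle D.sMinus →
      Quot (FaceStep D.glue) ⊕ (Fin D.freeLoops ⊕ Fin D.freeLoops) :=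
    Sum.elim
      (Quot.lift (Sum.elim
          (fun x => Sum.inl (Quot.mk _ (if D.IsOver x then D.glue x else x)))
          (fun i => Sum.inr (Sum.inl i))) (by
        rintro _ _ (x | ⟨c, k⟩)
        · simp only [Sum.elim_inl]
          by_cases hx : D.IsOver x
          · have : ¬ D.IsOver (D.glue x) := fun e => (halt x).1 e hx
            simp [hx, this]
          · have : D.IsOver (D.glue x) := (halt x).2 hx
            simp [hx, this, D.glue_glue]
        · simp only [Sum.elim_inl]
          congr 1
          have hs := D.isOver_smoothing c (D.sPlus c) k
          by_cases hx : D.IsOver (c, k)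
          · rw [if_pos hx, if_neg (by rw [hs]; exact not_not.2 hx)]
            refine Quot.sound ?_
            rw [FaceStep, walk_plus _ (fun e => (halt (c, k)).1 e hx), walk_apply, D.glue_glue]
          · rw [if_neg hx, if_pos (hs.2 hx)]
            refine (Quot.sound ?_).symm
            rw [FaceStep, walk_plus _ (fun e => (halt _).1 e (hs.2 hx)), walk_glue_smooth]))
      (Quot.lift (Sum.elim
          (fun x => Sum.inl (Quot.mk _ (if D.IsOver x then x else D.glue x)))
          (fun i => Sum.inr (Sum.inr i))) (by
        rintro _ _ (x | ⟨c, k⟩)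
        · simp only [Sum.elim_inl]
          by_cases hx : D.IsOver x
          · have : ¬ D.IsOver (D.glue x) := fun e => (halt x).1 e hx
            simp [hx, this, D.glue_glue]
          · have : D.IsOver (D.glue x) := (halt x).2 hx
            simp [hx, this]
        · simp only [Sum.elim_inl]
          congr 1
          have hs := D.isOver_smoothing c (D.sMinus c) k
          by_cases hx : D.IsOver (c, k)
          · have hs' : ¬ D.IsOver (c, smoothing (D.sMinus c) k) := by rw [hs]; exact not_not.2 hx
            rw [if_pos hx, if_neg hs']
            refine (Quot.sound ?_).symm
            rw [FaceStep, walk_minus _ ((halt _).2 hs'), walk_glue_smooth]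
          · rw [if_neg hx, if_pos (hs.2 hx)]
            refine Quot.sound ?_
            rw [FaceStep, walk_minus _ ((halt (c, k)).2 hx), walk_apply, D.glue_glue]))
  have hgf : ∀ x, g (f x) = x := by
    rintro (x | i | i)
    · induction x using Quot.ind with | _ x
      by_cases hx : D.IsOver x
      · have : f (Sum.inl (Quot.mk _ x)) = Sum.inr (D.circle D.sMinus (.inl x)) := if_pos hx
        rw [this]
        change Sum.inl (Quot.mk _ (if D.IsOver x then x else D.glue x)) = _
        rw [if_pos hx]
      · have : f (Sum.inl (Quot.mk _ x)) = Sum.inl (D.circle D.sPlus (.inl x)) := if_neg hx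
        rw [this]
        change Sum.inl (Quot.mk _ (if D.IsOver x then D.glue x else x)) = _
        rw [if_neg hx]
    · rfl
    · rfl
  have hfg : ∀ y, f (g y) = y := by
    rintro (x | x) <;> induction x using Quot.ind with | _ x <;> rcases x with x | i
    · change (if D.IsOver (if D.IsOver x then D.glue x else x) then _ else _) = _
      by_cases hx : D.IsOver x
      · have h' : ¬ D.IsOver (D.glue x) := fun e => (halt x).1 e hx
        simp only [if_pos hx, if_neg h']
        exact congrArg Sum.inl (D.circleSetoid_edge D.sPlus x).symm
      · simp only [if_neg hx]
        rfl
    · rfl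
    · change (if D.IsOver (if D.IsOver x then x else D.glue x) then _ else _) = _
      by_cases hx : D.IsOver x
      · simp only [if_pos hx]
        rfl
      · have h' : D.IsOver (D.glue x) := (halt x).2 hx
        simp only [if_neg hx, if_pos h']
        exact congrArg Sum.inr (D.circleSetoid_edge D.sMinus x).symm
    · rfl
  have := Nat.card_congr (Equiv.mk f g hgf hfg)
  rw [Nat.card_sum, Nat.card_sum, Nat.card_sum, Nat.card_eq_fintype_card (α := D.Circle D.sPlus),
    Nat.card_eq_fintype_card (α := D.Circle D.sMinus), Nat.card_eq_fintype_card (α := Fin _),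
    Fintype.card_fin] at this
  unfold numCircles
  omega

variable (D) in
theorem card_components :
    Nat.card (Quot D.Adjacent) = Nat.card (Quot (Linked D.glue)) + D.freeLoops := by
  have adj_of_linked : ∀ a b, Linked D.glue a b →
      Quot.mk D.Adjacent (.inl a) = Quot.mk D.Adjacent (.inl b) := by
    rintro ⟨c, k⟩ ⟨c', k'⟩ (h | h)
    · rw [h]; exact Quot.sound (.edge _)
    · simp only at h
      subst h
      exact Quot.sound (.crossing _ _ _)
  let f : Quot D.Adjacent → Quot (Linked D.glue) ⊕ Fin D.freeLoops :=
    Quot.lift (Sum.map (Quot.mk _) id) (by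
      rintro _ _ (a | ⟨c, k, l⟩)
      · exact congrArg Sum.inl (Quot.sound (Or.inl rfl))
      · exact congrArg Sum.inl (Quot.sound (Or.inr rfl)))
  let g : Quot (Linked D.glue) ⊕ Fin D.freeLoops → Quot D.Adjacent :=
    Sum.elim (Quot.lift (fun a => Quot.mk _ (.inl a)) adj_of_linked) (fun i => Quot.mk _ (.inr i))
  have hfg : ∀ y, f (g y) = y := by
    rintro (a | i)
    · induction a using Quot.ind with | _ a
      rfl
    · rfl
  have := Nat.card_congr (Equiv.mk f g (by rintro ⟨a | i⟩ <;> rfl) hfg)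
  rw [this, Nat.card_sum, Nat.card_eq_fintype_card (α := Fin _), Fintype.card_fin]

/-- Euler's formula gives two more regions than crossings for each component with crossings, and
each crossingless loop adds two circles; in all there is one component. -/
theorem numCircles_add (hsplit : D.NonSplit) (halt : D.Alternating) :
    D.numCircles D.sPlus + D.numCircles D.sMinus = D.N + 2 := by
  have h1 := card_circles_eq_regions halt
  have h2 := D.card_components
  have h3 := D.planar
  unfold NonSplit at hsplit
  omega

theorem card_circleSetoid (s : D.State) :
    Nat.card (Quotient (D.circleSetoid s)) = D.numCircles s := by
  unfold numCircles
  rw [← Nat.card_eq_fintype_card]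
  exact Nat.card_congr (Setoid.quotientKerEquivOfSurjective _ Quot.mk_surjective)

/-- Rejoining the strands of a smoothed diagram at every crossing restores its connectedness. The
cube is left arbitrary so that the result serves the dual cube as well. -/
theorem card_span_le_one (hsplit : D.NonSplit) (K : StateCube (Fin D.N) D.Piece)
    (hfst : ∀ c, K.fst c = .inl (c, 1)) (hsnd : ∀ c, K.snd c = .inl (c, 3)) (s : D.State)
    (hrel : K.rel ∅ = D.circleSetoid s) :
    Nat.card (Quotient (K.span ∅ Finset.univ)) ≤ 1 := by
  have hle : D.circleSetoid s ≤ K.span ∅ Finset.univ := by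
    rw [← hrel]; exact le_sup_left
  have h13 : ∀ c, K.span ∅ Finset.univ (.inl (c, 1)) (.inl (c, 3)) := by
    intro c
    have := Finset.le_sup (f := fun c => join (⊥ : Setoid D.Piece) (K.fst c) (K.snd c))
      (Finset.mem_univ c)
    have := (this.trans le_sup_right : _ ≤ K.span ∅ Finset.univ) (join_rel _ _ _)
    rwa [hfst, hsnd] at this
  have h1 : ∀ c k, K.span ∅ Finset.univ (.inl (c, k)) (.inl (c, 1)) := by
    intro c k
    rcases D.circleSetoid_touch s c k with h | h
    · exact hle h
    · exact (K.span _ _).trans (hle h) ((K.span _ _).symm (h13 c))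
  have hadj : ∀ p q, D.Adjacent p q → K.span ∅ Finset.univ p q := by
    rintro _ _ (a | ⟨c, k, l⟩)
    · exact hle (D.circleSetoid_edge s a)
    · exact (K.span _ _).trans (h1 c k) ((K.span _ _).symm (h1 c l))
  have hsub : Subsingleton (Quot D.Adjacent) := (Nat.card_eq_one_iff_unique.1 hsplit).1
  rw [Finite.card_le_one_iff_subsingleton]
  refine ⟨?_⟩
  rintro ⟨p⟩ ⟨q⟩
  exact congrArg (Quot.lift (Quotient.mk (K.span ∅ Finset.univ))
    fun p q h => Quotient.sound (hadj p q h)) (Subsingleton.elim (Quot.mk _ p) (Quot.mk _ q))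

end LinkDiagram

/-! ### Recovering the cobordism from the degree. -/

namespace CircleCalculus

/-- The converse of `tau_edge`: the elementary cobordisms are determined by the degree. -/
theorem edgeRel_of_tau {P : Type*} [Fintype P] {r r' : Setoid P} {a b : P} (h : IsFlip r r' a b)
    {l l' : P → Bool} (hl : Inv r l) (hl' : Inv r' l') (hu : ∀ p, ¬ r p a → ¬ r p b → l p = l' p)
    (ht : tau r' l' = tau r l + 1) : EdgeRel r a b l l' := by
  refine ⟨hu, ?_⟩
  rcases h with ⟨h, rfl⟩ | ⟨h, rfl⟩
  · have key := classSum_join h (f := fun p => signOf (l p)) (f' := fun p => signOf (l' p))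
      (fun p q e => congrArg signOf (hl p q e)) (fun p q e => congrArg signOf (hl' p q e))
      (fun p ha hb => congrArg signOf (hu p ha hb))
    simp only [h, false_and, not_false_eq_true, true_and, false_or]
    unfold tau at ht
    rw [key] at ht
    generalize classSum (join r a b) (fun p => signOf (l' p)) = X at ht
    revert ht
    cases l a <;> cases l b <;> cases l' a <;> simp [signOf] <;> lia
  · have key := classSum_join h (f := fun p => signOf (l' p)) (f' := fun p => signOf (l p))
      (fun p q e => congrArg signOf (hl' p q e)) (fun p q e => congrArg signOf (hl p q e))
      (fun p ha hb => congrArg signOf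
        (hu p (by simp [join_apply, ha, hb]) (by simp [join_apply, ha, hb])).symm)
    have hj := join_rel r' a b
    simp only [hj, true_and, not_true_eq_false, false_and, or_false]
    unfold tau at ht
    rw [key] at ht
    generalize classSum (join r' a b) (fun p => signOf (l p)) = X at ht
    revert ht
    cases l a <;> cases l' a <;> cases l' b <;> simp [signOf] <;> lia

end CircleCalculus

namespace LinkDiagram

open CircleCalculus

set_option linter.unusedSectionVars false

variable {D : LinkDiagram}

/-! ### Comparison with the Khovanov complex -/

/-- The basis element of the cube of resolutions that corresponds to an enhanced state. -/
def index (S : D.EnhancedState) : Finset (Fin D.N) × (D.Piece → Bool) :=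
  (Finset.univ.filter fun c => S.marker c = false, fun p => S.sign (D.circle S.marker p))

theorem mem_index (S : D.EnhancedState) (c : Fin D.N) : c ∈ (index S).1 ↔ S.marker c = false := by
  simp [index]

theorem stateOf_index (S : D.EnhancedState) : D.stateOf (index S).1 = S.marker := by
  funext c
  simp only [stateOf, mem_index]
  cases S.marker c <;> simp

theorem index_injective : Function.Injective (index (D := D)) := by
  intro S S' h
  have h1 : S.marker = S'.marker := by
    rw [← stateOf_index, ← stateOf_index, h]
  have h2 := congrArg Prod.snd h
  obtain ⟨s, e⟩ := S
  obtain ⟨s', e'⟩ := S'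
  simp only at h1
  subst h1
  congr 1
  funext C
  induction C using Quot.ind with | _ p
  exact congrFun h2 p

theorem inv_index (S : D.EnhancedState) : Inv (D.circleSetoid S.marker) (index S).2 :=
  fun _ _ h => congrArg S.sign h

theorem exists_index {E : Finset (Fin D.N)} {l : D.Piece → Bool}
    (h : Inv (D.circleSetoid (D.stateOf E)) l) : ∃ S : D.EnhancedState, index S = (E, l) := by
  refine ⟨⟨D.stateOf E, Quot.lift l fun p q e => h p q (Quot.sound e)⟩, ?_⟩
  refine Prod.ext ?_ rfl
  ext c
  simp [index, stateOf]

theorem sigma_eq (S : D.EnhancedState) : S.sigma = D.N - 2 * ((index S).1.card : ℤ) := by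
  have h : ∀ c, sgn (S.marker c) = 1 - 2 * (if S.marker c = false then 1 else 0) := by
    intro c
    cases S.marker c <;> simp [sgn]
  unfold EnhancedState.sigma
  simp only [h, Finset.sum_sub_distrib, ← Finset.mul_sum, Finset.sum_boole, index]
  simp

theorem tau_eq (S : D.EnhancedState) :
    tau (D.circleSetoid S.marker) (index S).2 = S.tau := by
  classical
  unfold tau classSum EnhancedState.tau
  refine Fintype.sum_equiv (Setoid.quotientKerEquivOfSurjective (D.circle S.marker)
    Quot.mk_surjective) _ _ fun q => ?_
  conv_rhs => rw [← Quotient.out_eq q]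
  rfl

theorem hasDeg_index (halt : D.Alternating) (S : D.EnhancedState) (n T : ℤ) :
    (cube halt).HasDeg (index S) n T ↔ ((index S).1.card : ℤ) = n ∧ S.tau = T := by
  unfold StateCube.HasDeg
  simp only [cube, stateOf_index, tau_eq, inv_index, true_and]

theorem degree_eq (S : D.EnhancedState) : S.degree = S.sigma + 2 * S.tau := rfl

theorem hasDeg_index_iff (halt : D.Alternating) (S : D.EnhancedState) {n T i j : ℤ}
    (hi : i = D.N - 2 * n) (hj : j = i + 2 * T) :
    (cube halt).HasDeg (index S) n T ↔ S.sigma = i ∧ S.degree = j := by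
  rw [hasDeg_index, degree_eq, sigma_eq]
  constructor
  · rintro ⟨h1, h2⟩; constructor <;> linarith
  · rintro ⟨h1, h2⟩; constructor <;> linarith

/-- The drop of σ forces the marker at `c` to go from positive to negative. The equality of the
second degrees then means that τ rises by one, which leaves exactly the product and coproduct of
`ℤ[X]/X²`. -/
theorem incident_iff (halt : D.Alternating) (c : Fin D.N) (S S' : D.EnhancedState) :
    Incident c S S' ↔ c ∉ (index S).1 ∧ (index S').1 = insert c (index S).1 ∧
      EdgeRel (D.circleSetoid S.marker) (.inl (c, 1)) (.inl (c, 3)) (index S).2 (index S').2 := by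
  have touch : ∀ p : D.Piece,
      (∀ k, D.circle S.marker p ≠ D.circle S.marker (.inl (c, k))) ↔
      (¬ D.circleSetoid S.marker p (.inl (c, 1)) ∧
        ¬ D.circleSetoid S.marker p (.inl (c, 3))) := by
    intro p
    refine ⟨fun h => ⟨h 1, h 3⟩, fun h k e => ?_⟩
    have e : D.circleSetoid S.marker p (.inl (c, k)) := e
    rcases D.circleSetoid_touch S.marker c k with g | g
    · exact h.1 ((D.circleSetoid _).trans e g)
    · exact h.2 ((D.circleSetoid _).trans e g)
  have hflip : c ∉ (index S).1 → (index S').1 = insert c (index S).1 →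
      IsFlip (D.circleSetoid S.marker) (D.circleSetoid S'.marker) (.inl (c, 1)) (.inl (c, 3)) := by
    intro h1 h2
    have := (cube halt).flip _ _ h1
    rw [← h2] at this
    simpa only [cube, stateOf_index] using this
  unfold Incident
  simp only [touch, and_imp]
  constructor
  · rintro ⟨h1, h2, h3, h4⟩
    have hc : c ∉ (index S).1 := by
      intro hc
      have e : (index S).1 = insert c (index S').1 := by
        ext x
        rw [Finset.mem_insert, mem_index, mem_index]
        have := h3 x
        by_cases hx : x = c
        · subst hx
          rw [mem_index] at hc
          simp [hc]
        · have : S.marker x = S'.marker x := by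
            by_contra g; exact hx (this.1 g)
          simp [hx, this]
      have hc' : c ∉ (index S').1 := by
        rw [mem_index] at hc ⊢
        have := (h3 c).2 rfl
        rw [hc] at this
        exact fun g => this g.symm
      have hcard : (index S).1.card = (index S').1.card + 1 := by
        rw [e, Finset.card_insert_of_notMem hc']
      rw [sigma_eq, sigma_eq, hcard] at h1
      push_cast at h1
      linarith
    have hE : (index S').1 = insert c (index S).1 := by
      ext x
      rw [Finset.mem_insert, mem_index, mem_index]
      have := h3 x
      by_cases hx : x = c
      · subst hx
        have hne := this.2 rfl
        rw [mem_index, Bool.not_eq_false] at hc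
        rw [hc] at hne
        simp only [true_or, iff_true]
        cases hS : S'.marker x
        · rfl
        · rw [hS] at hne; exact absurd rfl hne
      · have : S.marker x = S'.marker x := by
          by_contra g; exact hx (this.1 g)
        simp [hx, this]
    refine ⟨hc, hE, edgeRel_of_tau (hflip hc hE) (inv_index S) (inv_index S') h4 ?_⟩
    rw [tau_eq, tau_eq]
    rw [degree_eq, degree_eq] at h2
    linarith
  · rintro ⟨hc, hE, hR⟩
    have ht := tau_edge (hflip hc hE) (inv_index S) (inv_index S') hR
    rw [tau_eq, tau_eq] at ht
    have hs : S'.sigma = S.sigma - 2 := by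
      rw [sigma_eq, sigma_eq, hE, Finset.card_insert_of_notMem hc]
      push_cast
      ring
    refine ⟨hs, by rw [degree_eq, degree_eq, hs, ht]; ring, fun x => ?_, hR.1⟩
    have h1 := mem_index S x
    have h2 := mem_index S' x
    rw [hE, Finset.mem_insert, h1] at h2
    by_cases hx : x = c
    · subst hx
      rw [h1, Bool.not_eq_false] at hc
      rw [hc] at h2 ⊢
      simp only [true_or, true_iff] at h2
      simp [h2]
    · simp only [hx, false_or, iff_false, not_not] at h2 ⊢
      revert h2
      cases S.marker x <;> cases S'.marker x <;> simp

theorem diff_index (halt : D.Alternating) (k : Type*) [CommRing k] (S S' : D.EnhancedState) :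
    (cube halt).diff k (index S) (index S') = (coefficient S S' : k) := by
  classical
  unfold StateCube.diff coefficient
  rw [Matrix.sum_apply, Int.cast_sum]
  refine Finset.sum_congr rfl fun c _ => ?_
  unfold StateCube.arrow block
  by_cases h : c ∉ (index S).1 ∧ (index S').1 = insert c (index S).1
  · rw [if_pos h]
    beta_reduce
    rw [Matrix.smul_apply, ← h.2]
    have e : (cube halt).unit k (index S).1 c = (((-1) ^ negativeAbove c S : ℤ) : k) := by
      simp only [StateCube.unit, cube, negativeAbove, index, Finset.filter_filter]
      push_cast
      congr 2
      simp only [and_comm]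
    rw [e]
    have hI := incident_iff halt c S S'
    simp only [h.1, h.2, not_false_eq_true, true_and] at hI
    unfold edge
    simp only [cube, stateOf_index, inv_index, true_and]
    simp only [hI, smul_eq_mul]
    split_ifs <;> simp
  · have : ¬ Incident c S S' := fun g => h ⟨((incident_iff halt c S S').1 g).1,
      ((incident_iff halt c S S').1 g).2.1⟩
    rw [if_neg h, if_neg this, Int.cast_zero]

theorem d_apply (x : D.Chain) (S' : D.EnhancedState) :
    D.d x S' = ∑ S, x S * coefficient S S' := by
  classical
  rw [d, Finsupp.linearCombination_apply, Finsupp.sum_fintype _ _ (by simp), Finsupp.finsetSum_apply]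
  refine Finset.sum_congr rfl fun S _ => ?_
  rw [Finsupp.smul_apply, Finsupp.finsetSum_apply]
  simp [Finsupp.single_apply]

theorem coefficient_ne_zero {S S' : D.EnhancedState} (h : coefficient S S' ≠ 0) :
    S'.sigma = S.sigma - 2 ∧ S'.degree = S.degree := by
  obtain ⟨c, -, hc⟩ := Finset.exists_ne_zero_of_sum_ne_zero h
  have : Incident c S S' := by
    by_contra g
    exact hc (if_neg g)
  exact ⟨this.1, this.2.1⟩

theorem mem_chain_iff {i j : ℤ} {x : D.Chain} :
    x ∈ D.chain i j ↔ ∀ S, x S ≠ 0 → S.sigma = i ∧ S.degree = j := by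
  rw [chain, Finsupp.mem_supported]
  constructor
  · intro h S hS
    exact h (Finsupp.mem_support_iff.2 hS)
  · intro h S hS
    exact h S (Finsupp.mem_support_iff.1 hS)

theorem d_mem_chain {i j : ℤ} {x : D.Chain} (hx : x ∈ D.chain (i + 2) j) :
    D.d x ∈ D.chain i j := by
  rw [mem_chain_iff] at hx ⊢
  intro S' h
  rw [d_apply] at h
  obtain ⟨S, -, hS⟩ := Finset.exists_ne_zero_of_sum_ne_zero h
  have h1 := hx S (left_ne_zero_of_mul hS)
  have h2 := coefficient_ne_zero (right_ne_zero_of_mul hS)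
  exact ⟨by linarith [h1.1, h2.1], h2.2.trans h1.2⟩

/-- Transferred from the cube over `ℤ`; intermediate labels that do not come from enhanced states
contribute nothing. -/
theorem d_d (halt : D.Alternating) (x : D.Chain) : D.d (D.d x) = 0 := by
  classical
  have hM : ∀ S S'' : D.EnhancedState, ∑ S', coefficient S S' * coefficient S' S'' = 0 := by
    intro S S''
    have h := congrFun (congrFun ((cube halt).diff_mul_diff ℤ) (index S)) (index S'')
    rw [Matrix.mul_apply] at h
    rw [← h.trans (by rfl : _ = (0 : ℤ))]
    refine Fintype.sum_of_injective index index_injective _ _ ?_ ?_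
    · intro R hR
      by_contra g
      obtain ⟨c, -, -, -, hi, -⟩ := (cube halt).diff_ne_zero (left_ne_zero_of_mul g)
      exact hR (exists_index hi)
    · intro S'
      rw [diff_index, diff_index, Int.cast_id, Int.cast_id]
  ext S''
  rw [d_apply]
  simp only [d_apply, Finset.sum_mul]
  rw [Finset.sum_comm]
  refine Finset.sum_eq_zero fun S _ => ?_
  simp only [mul_assoc, ← Finset.mul_sum, hM, mul_zero]

/-- The vanishing of the homology of the cube over `k`, in terms of enhanced states. -/
theorem exists_of_exact (halt : D.Alternating) {k : Type*} [CommRing k] {n T i j : ℤ}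
    (hi : i = D.N - 2 * n) (hj : j = i + 2 * T)
    (hE : (cube halt).Exact k (fun _ => True) n T) (x : D.EnhancedState → k)
    (hx : ∀ S, x S ≠ 0 → S.sigma = i ∧ S.degree = j)
    (hdx : ∀ S', ∑ S, x S * (coefficient S S' : k) = 0) :
    ∃ y : D.EnhancedState → k, (∀ S, y S ≠ 0 → S.sigma = i + 2 ∧ S.degree = j) ∧
      ∀ S', ∑ S, y S * (coefficient S S' : k) = x S' := by
  classical
  have hsum : ∀ (u : Finset (Fin D.N) × (D.Piece → Bool) → k) (v : D.EnhancedState → k),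
      (∀ R, R ∉ Set.range (index (D := D)) → u R = 0) → (∀ S, v S = u (index S)) →
      ∀ S', ∑ S, v S * (coefficient S S' : k) = (u ᵥ* (cube halt).diff k) (index S') := by
    intro u v h1 h2 S'
    rw [Matrix.vecMul, dotProduct]
    refine Fintype.sum_of_injective index index_injective _ _ ?_ ?_
    · intro R hR
      rw [h1 R hR, zero_mul]
    · intro S
      rw [h2, diff_index]
  set u : Finset (Fin D.N) × (D.Piece → Bool) → k := Function.extend index x (fun _ => 0) with hu
  have hux : ∀ S, x S = u (index S) := fun S => (index_injective.extend_apply x _ S).symm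
  have hu0 : ∀ R, R ∉ Set.range (index (D := D)) → u R = 0 := fun R hR =>
    Function.extend_apply' x _ R hR
  obtain ⟨y, hy, hyx⟩ := hE u (by
      intro R hR
      have : R ∈ Set.range (index (D := D)) := by
        by_contra g
        exact hR (hu0 R g)
      obtain ⟨S, rfl⟩ := this
      rw [← hux] at hR
      exact ⟨trivial, (hasDeg_index_iff halt S hi hj).2 (hx S hR)⟩)
    (by
      intro R _
      by_cases hR : R ∈ Set.range (index (D := D))
      · obtain ⟨S, rfl⟩ := hR
        rw [← hsum u x hu0 hux, hdx]
      · refine StateCube.vecMul_eq_zero_of fun R' _ => ?_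
        by_contra g
        obtain ⟨c, -, -, -, hv, -⟩ := (cube halt).diff_ne_zero g
        exact hR (exists_index hv))
  refine ⟨fun S => y (index S), ?_, ?_⟩
  · intro S hS
    exact (hasDeg_index_iff halt S (by rw [hi]; ring) (by rw [hj]; ring)).1 (hy _ hS).2
  · intro S'
    rw [hsum y _ ?_ (fun S => rfl), hyx _ trivial, ← hux]
    intro R hR
    by_contra g
    exact hR (exists_index (hy R g).2.1)

/-! ### Torsion -/

/-- If the homology modulo `p` vanishes in bidegree `(i, j)`, every cycle over the integers is a
boundary up to `p` times a chain. -/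
theorem exists_boundary_add_smul (halt : D.Alternating) {p : ℕ} [Fact p.Prime] {n T i j : ℤ}
    (hi : i = D.N - 2 * n) (hj : j = i + 2 * T)
    (hE : (cube halt).Exact (ZMod p) (fun _ => True) n T) {x : D.Chain} (hx : x ∈ D.chain i j)
    (hdx : ∀ S, (p : ℤ) ∣ D.d x S) :
    ∃ y ∈ D.chain (i + 2) j, ∃ w ∈ D.chain i j, x = D.d y + (p : ℤ) • w := by
  classical
  rw [mem_chain_iff] at hx
  obtain ⟨y, hy, hyx⟩ := exists_of_exact halt hi hj hE (fun S => (x S : ZMod p))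
    (fun S hS => hx S fun e => hS (by simp [e]))
    (fun S' => by
      have := (ZMod.intCast_zmod_eq_zero_iff_dvd (D.d x S') p).2 (hdx S')
      rw [d_apply] at this
      push_cast at this
      exact this)
  -- The lift sends zero to zero, so the bidegree is preserved.
  let y' : D.Chain := Finsupp.equivFunOnFinite.symm fun S => ((y S).val : ℤ)
  have hy'v : ∀ S, ((y' S : ℤ) : ZMod p) = y S := by
    intro S
    simp [y']
  have hy' : y' ∈ D.chain (i + 2) j := by
    rw [mem_chain_iff]
    intro S hS
    refine hy S fun e => hS ?_
    simp [y', e]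
  have hdvd : ∀ S, (p : ℤ) ∣ x S - D.d y' S := by
    intro S
    rw [← ZMod.intCast_zmod_eq_zero_iff_dvd, d_apply]
    push_cast
    simp only [hy'v, hyx, sub_self]
  let w : D.Chain := Finsupp.equivFunOnFinite.symm fun S => (x S - D.d y' S) / p
  have hw : x = D.d y' + (p : ℤ) • w := by
    ext S
    have : (p : ℤ) * w S = x S - D.d y' S := Int.mul_ediv_cancel' (hdvd S)
    rw [Finsupp.add_apply, Finsupp.smul_apply, smul_eq_mul, this]
    ring
  refine ⟨y', hy', w, ?_, hw⟩
  have hdy := mem_chain_iff.1 (d_mem_chain hy')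
  rw [mem_chain_iff]
  intro S hS
  by_cases e : x S = 0
  · refine hdy S fun e' => hS ?_
    simp [w, e, e']
  · exact hx S e

/-- This is the universal coefficient theorem by hand: a class of order `p` survives in the homology
modulo `p`, and a chain bounding `p` times it is itself a cycle modulo `p` one step earlier. -/
theorem not_exact_of_torsion (halt : D.Alternating) {n T i j : ℤ} (hi : i = D.N - 2 * n)
    (hj : j = i + 2 * T) (hT : D.T i j ≠ ⊥) : ∃ p : ℕ, ∃ _ : Fact p.Prime,
      ¬ (cube halt).Exact (ZMod p) (fun _ => True) n T ∧
      ¬ (cube halt).Exact (ZMod p) (fun _ => True) (n - 1) (T - 1) := by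
  obtain ⟨h, hh, hne⟩ := Submodule.exists_mem_ne_zero_of_ne_bot hT
  -- an element of prime order
  obtain ⟨p, hp, g, hg, hpg⟩ : ∃ p : ℕ, p.Prime ∧ ∃ g : D.H i j, g ≠ 0 ∧ (p : ℤ) • g = 0 := by
    have hfin : IsOfFinAddOrder h := by
      obtain ⟨a, ha⟩ := (Submodule.mem_torsion_iff h).1 hh
      rw [isOfFinAddOrder_iff_zsmul_eq_zero]
      exact ⟨a, nonZeroDivisors.coe_ne_zero a, ha⟩
    have h1 : addOrderOf h ≠ 1 := fun e => hne (AddMonoid.addOrderOf_eq_one_iff.1 e)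
    have hpos := hfin.addOrderOf_pos
    have hp := Nat.minFac_prime h1
    obtain ⟨m, hm⟩ := Nat.minFac_dvd (addOrderOf h)
    refine ⟨_, hp, m • h, fun e => ?_, ?_⟩
    · have h2 := addOrderOf_dvd_of_nsmul_eq_zero e
      have hm0 : 0 < m := Nat.pos_of_ne_zero fun e => by rw [e, mul_zero] at hm; omega
      have h3 := Nat.le_of_dvd hm0 h2
      have h4 := hp.two_le
      nlinarith
    · rw [natCast_zsmul, ← mul_nsmul', ← hm, addOrderOf_nsmul_eq_zero]
  have : Fact p.Prime := ⟨hp⟩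
  have hp0 : (p : ℤ) ≠ 0 := by exact_mod_cast hp.ne_zero
  refine ⟨p, ⟨hp⟩, fun hE => ?_, fun hE => ?_⟩
  · -- multiplication by `p` is surjective on the homology
    have hsurj : ∀ u : D.H i j, ∃ v : D.H i j, u = (p : ℤ) • v := by
      intro u
      obtain ⟨⟨x, hx⟩, rfl⟩ := Submodule.Quotient.mk_surjective _ u
      obtain ⟨hxc, hxk⟩ := Submodule.mem_inf.1 hx
      rw [LinearMap.mem_ker] at hxk
      obtain ⟨y, hy, w, hw, e⟩ := exists_boundary_add_smul halt hi hj hE hxc (fun S => by simp [hxk])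
      have hdw : D.d w = 0 := by
        have := congrArg D.d e
        rw [hxk, map_add, d_d halt, zero_add, map_smul] at this
        exact (smul_eq_zero.1 this.symm).resolve_left hp0
      refine ⟨Submodule.Quotient.mk ⟨w, Submodule.mem_inf.2 ⟨hw, hdw⟩⟩, ?_⟩
      rw [← Submodule.Quotient.mk_smul, Submodule.Quotient.eq, Submodule.submoduleOf,
        Submodule.mem_comap]
      refine ⟨y, hy, ?_⟩
      change D.d y = x - (p : ℤ) • w
      rw [e]
      simp
    have : Module.Finite ℤ (D.H i j) := inferInstance
    -- By Nakayama's lemma some `r ≡ 1` modulo `p` annihilates the finitely generated homology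
    -- group; as `p` kills `g`, this gives `g = 0`.
    obtain ⟨r, hr, hr0⟩ := Submodule.exists_sub_one_mem_and_smul_eq_zero_of_fg_of_le_smul
      (Ideal.span {(p : ℤ)}) (⊤ : Submodule ℤ (D.H i j)) Module.Finite.fg_top (by
        intro u _
        obtain ⟨v, rfl⟩ := hsurj u
        exact Submodule.smul_mem_smul (Ideal.mem_span_singleton_self _) trivial)
    obtain ⟨m, hm⟩ := Ideal.mem_span_singleton.1 hr
    apply hg
    have h1 := hr0 g trivial
    have h2 : (r - 1) • g = 0 := by rw [hm, mul_comm, mul_smul, hpg, smul_zero]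
    rw [sub_smul, h1, one_smul, zero_sub, neg_eq_zero] at h2
    exact h2
  · obtain ⟨⟨x, hx⟩, rfl⟩ := Submodule.Quotient.mk_surjective _ g
    rw [← Submodule.Quotient.mk_smul, Submodule.Quotient.mk_eq_zero, Submodule.submoduleOf,
      Submodule.mem_comap] at hpg
    obtain ⟨y, hy, hyx⟩ := hpg
    have hyx : D.d y = (p : ℤ) • x := hyx
    -- If `y = d z + p w`, then `p x = d y = p d w`, and dividing by `p` in the free chain group
    -- makes `x` a boundary.
    obtain ⟨z, hz, w, hw, e⟩ := exists_boundary_add_smul halt (i := i + 2) (j := j)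
      (by rw [hi]; ring) (by rw [hj]; ring) hE hy (fun S => by
        rw [hyx, Finsupp.smul_apply, smul_eq_mul]
        exact dvd_mul_right _ _)
    apply hg
    rw [Submodule.Quotient.mk_eq_zero, Submodule.submoduleOf, Submodule.mem_comap]
    refine ⟨w, hw, ?_⟩
    have := congrArg D.d e
    rw [hyx, map_add, d_d halt, zero_add, map_smul] at this
    exact (smul_right_injective _ hp0 this).symm

/-- The torsion is supported on one diagonal. -/
theorem diagonal_of_torsion (hsplit : D.NonSplit) (halt : D.Alternating) {i j : ℤ}
    (hT : D.T i j ≠ ⊥) : j - 2 * i = 2 * (D.numCircles D.sPlus : ℤ) - D.N := by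
  -- some enhanced state has this bidegree
  obtain ⟨S, hS1, hS2⟩ : ∃ S : D.EnhancedState, S.sigma = i ∧ S.degree = j := by
    obtain ⟨h, -, hne⟩ := Submodule.exists_mem_ne_zero_of_ne_bot hT
    obtain ⟨⟨x, hx⟩, rfl⟩ := Submodule.Quotient.mk_surjective _ h
    by_contra! g
    apply hne
    have hx0 : x = 0 := by
      ext S
      by_contra e
      have := mem_chain_iff.1 (Submodule.mem_inf.1 hx).1 S e
      exact g S this.1 this.2
    subst hx0
    exact Submodule.Quotient.mk_zero _
  set n : ℤ := ((index S).1.card : ℤ) with hn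
  set T := S.tau with hTdef
  have hi : i = D.N - 2 * n := by rw [← hS1, sigma_eq]
  have hj : j = i + 2 * T := by rw [← hS2, ← hS1, degree_eq]
  obtain ⟨p, hp, h1, h2⟩ := not_exact_of_torsion halt hi hj hT
  have sp : D.stateOf ∅ = D.sPlus := by funext c; simp [stateOf, sPlus]
  have sm : D.stateOf (∅ : Finset (Fin D.N))ᶜ = D.sMinus := by funext c; simp [stateOf, sMinus]
  -- The lower bound `|s₊| - 2` is applied to the class in degree `(n - 1, T - 1)`, which cancels
  -- the 2.
  have b1 : (D.numCircles D.sPlus : ℤ) ≤ T + n := by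
    by_contra! g
    refine h2 ((cube halt).exact_univ (ZMod p) ?_)
    have hk := card_span_le_one hsplit (cube halt) (fun _ => rfl) (fun _ => rfl) _ rfl
    have hc : Nat.card (Quotient ((cube halt).rel ∅)) = D.numCircles D.sPlus := by
      rw [← sp]; exact card_circleSetoid _
    rw [hc]
    have : (Nat.card (Quotient ((cube halt).span ∅ Finset.univ)) : ℤ) ≤ 1 := by exact_mod_cast hk
    linarith
  -- In the dual cube the initial vertex is `s₋` and the degree is `(N - n, -T)`.
  have b2 : T + n ≤ D.N + 2 - D.numCircles D.sMinus := by
    by_contra! g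
    refine h1 ((cube halt).exact_of_dual ((cube halt).dual.exact_univ (ZMod p) ?_))
    have hk := card_span_le_one hsplit (cube halt).dual (fun _ => rfl) (fun _ => rfl) _ rfl
    have hc : Nat.card (Quotient ((cube halt).dual.rel ∅)) = D.numCircles D.sMinus := by
      rw [← sm]; exact card_circleSetoid _
    rw [hc, Fintype.card_fin]
    have : (Nat.card (Quotient ((cube halt).dual.span ∅ Finset.univ)) : ℤ) ≤ 1 := by
      exact_mod_cast hk
    linarith
  have hsum : (D.numCircles D.sPlus : ℤ) + D.numCircles D.sMinus = D.N + 2 := by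
    exact_mod_cast numCircles_add hsplit halt
  linarith

end LinkDiagram

theorem corollary5p7 (D : LinkDiagram) (hsplit : D.NonSplit) (halt : D.Alternating)
    (hnug : ∀ c : Fin D.N, ¬ D.Nugatory c) :
    D.THThickPair 0 (-1) ∧ D.THThick 0 ∧
    2 * (D.numCircles D.sPlus : ℤ) - D.N = D.N - 2 * D.numCircles D.sMinus + 4 ∧
    ∀ i j : ℤ, D.T i j ≠ ⊥ → j - 2 * i = 2 * (D.numCircles D.sPlus : ℤ) - D.N := by
  have hsum : (D.numCircles D.sPlus : ℤ) + D.numCircles D.sMinus = D.N + 2 := by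
    exact_mod_cast LinkDiagram.numCircles_add hsplit halt
  have hsumQ : (D.numCircles D.sPlus : ℚ) + D.numCircles D.sMinus = D.N + 2 := by
    exact_mod_cast hsum
  have hdiag : ∀ i j : ℤ, D.T i j ≠ ⊥ → j - 2 * i = 2 * (D.numCircles D.sPlus : ℤ) - D.N :=
    fun i j h => LinkDiagram.diagonal_of_torsion hsplit halt h
  have hpair : D.THThickPair 0 (-1) := by
    intro i j h
    have e : (j : ℚ) - 2 * i = 2 * D.numCircles D.sPlus - D.N := by exact_mod_cast hdiag i j h
    constructor <;> linarith
  -- With `|s₊| + |s₋| - N = 2` the thickness is `0 - 1 + 1 = 0`.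
  exact ⟨hpair, ⟨0, -1, hpair, by linarith⟩, by linarith, hdiag⟩
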